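/- Let $d\ge 1$, let $|\cdot|$ be the Euclidean norm and $\langle\cdot,\cdot\rangle$ the scalar product on $\mathbb R^d$. For $f:\mathbb R^d\to\mathbb R$ put $\mathcal N f:=\mathbb E f(Z)$, where $Z$ is a standard $d$-variate normal vector, and for $r\ge 1$ $$M_r(f):=\sup_{x\ne y}\frac{|\nabla^{r-1}f(x)-\nabla^{r-1}f(y)|_\vee}{|x-y|}$$ if $f$ is $(r-1)$ times differentiable everywhere, where $|T|_\vee:=\sup\{|T(u_1,\dots,u_{r-1})| : |u_1|,\dots,|u_{r-1}|\le 1\}$ is the injective norm; otherwise put $M_r(f):=\infty$. Let $W$ be an $\mathbb R^d$-valued random vector with $\mathbb E|W|^2<\infty$, $\mathbb E W=0$ and $\operatorname{Var}(W)=I_d$. Let $(\Xi,\mathcal X)$ be a measurable space. For each $\xi\in\Xi$ let $V_\xi$ be an $\mathbb R^d$-valued random vector, defined on its own probability space with probability $\mathbb P_\xi$ and expectation $\mathbb E_\xi$, such that $\xi\mapsto\mathbb P_\xi(V_\xi\in A)$ is measurable for each Borel set $A$. Let $\mu$ be an $\mathbb R^d$-valued (countably additive) measure on $(\Xi,\mathcal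 X)$, and for each $\xi\in\Xi$ let $\nu_\xi$ be an $\mathbb R^d$-valued measure on $(\Xi,\mathcal X)$ such that $\xi\mapsto\nu_\xi(A)$ is measurable for each $A\in\mathcal X$. Assume: (S) for all bounded measurable $f:\mathbb R^d\to\mathbb R$, $$\mathbb E[f(W)W]=\int_\Xi\mathbb E_\xi[f(V_\xi)]\,\mu(d\xi);$$ (Px) for each $\xi\in\Xi$, $\mathbb E_\xi|V_\xi|<\infty$, and for all continuously differentiable $f:\mathbb R^d\to\mathbb R$ with bounded derivative, $$\mathbb E[f(W)]-\mathbb E_\xi[f(V_\xi)]=\int_\Xi\big\langle\mathbb E_\eta[\nabla f(V_\eta)],\,\nu_\xi(d\eta)\big\rangle .$$ Let $|\mu|$ and $|\nu_\xi|$ denote total variation measures with respect to the Euclidean norm and define, for $a,b,c\ge 0$, $$\beta_1^{(\xi)}:=|\nu_\xi|(\Xi),\qquad \beta_2:=\int_\Xi\beta_1^{(\xi)}\,|\mu|(d\xi),$$ $$\beta_2^{(\xi)}:=\int_\Xi\beta_1^{(\eta)}\,|\nu_\xi|(d\eta),\qquad \beta_3:=\int_\Xi\beta_2^{(\xi)}\,|\mu|(d\xi),$$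 $$\beta_{23}(a,b):=\int_\Xi\int_\Xi\min\{a,\,b\,\beta_1^{(\eta)}\}\,|\nu_\xi|(d\eta)\,|\mu|(d\xi),$$ $$\beta_{234}(a,b,c):=\int_\Xi\int_\Xi\min\Big\{a,\,b\,\beta_1^{(\eta)}+c\sqrt{\beta_2^{(\eta)}}\Big\}\,|\nu_\xi|(d\eta)\,|\mu|(d\xi).$$ Suppose that $\beta_2<\infty$. Then for every $f:\mathbb R^d\to\mathbb R$, under the convention $\infty\cdot 0=0$: 1. If $M_3(f)<\infty$, then $\mathcal N|f|<\infty$, and if moreover $\frac{\beta_3}{3}M_3(f)<\infty$, then $\mathbb E|f(W)|<\infty$ and $$\big|\mathbb E[f(W)]-\mathcal N f\big|\le\frac{\beta_3}{3}\,M_3(f).$$ 2. If $M_2(f)<\infty$, then $\mathbb E|f(W)|<\infty$, $\mathcal N|f|<\infty$ and $$\big|\mathbb E[f(W)]-\mathcal N f\big|\le\beta_{23}\Big(1,\,\frac{\sqrt{2\pi}}{4}\Big)M_2(f).$$ 3. If $M_1(f)<\infty$, then $\mathbb E|f(W)|<\infty$, $\mathcal N|f|<\infty$ and $$\big|\mathbb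 E[f(W)]-\mathcal N f\big|\le\beta_{234}\big(1.8,\;3.58+0.55\log d,\;3.5\big)\,M_1(f).$$ -/

import Mathlib

open MeasureTheory ProbabilityTheory
open scoped ENNReal

noncomputable section

namespace SteinCLT

/-- The Euclidean space of dimension `d`, with the Euclidean norm. -/
abbrev Euc (d : ℕ) : Type := EuclideanSpace ℝ (Fin d)

/-- The quantity `M_r(f)`, valued in `[0, ∞]`. For `r = 0` it is the supremum norm of `f`.
For `r = s + 1` it is the best Lipschitz constant of the `s`-th derivative of `f` if `f` is `s`
times differentiable everywhere, and `∞` otherwise. The derivative is a continuous multilinear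
map; its operator norm (the supremum over tuples of vectors in the unit ball) is the injective
norm of the corresponding tensor. -/
def M {d : ℕ} (r : ℕ) (f : Euc d → ℝ) : ℝ≥0∞ :=
  match r with
  | 0 => ⨆ x, ‖f x‖ₑ
  | s + 1 =>
    open Classical in
    if ∀ k < s, Differentiable ℝ (iteratedFDeriv ℝ k f) then
      ⨆ (x : Euc d) (y : Euc d) (_ : x ≠ y),
        ‖iteratedFDeriv ℝ s f x - iteratedFDeriv ℝ s f y‖ₑ / ‖x - y‖ₑ
    else ∞

section Assumptions

variable {d : ℕ} {Ω : Type*} [MeasurableSpace Ω] {Ξ : Type*} [MeasurableSpace Ξ]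
  {Ω' : Ξ → Type*} [∀ ξ, MeasurableSpace (Ω' ξ)]

/-- The random vector `W` is square integrable and centred, and its covariance matrix is the
identity. -/
structure Standardized (P : Measure Ω) (W : Ω → Euc d) : Prop where
  memLp : MemLp W 2 P
  mean : ∫ ω, W ω ∂P = 0
  cov : ∀ i j : Fin d, cov[fun ω => W ω i, fun ω => W ω j; P] = if i = j then 1 else 0

/-- The random vectors `V ξ`, each on its own probability space `(Ω' ξ, Q ξ)`, have laws that
depend measurably on `ξ`. -/
structure MeasurableFamily (Q : ∀ ξ, Measure (Ω' ξ)) (V : ∀ ξ, Ω' ξ → Euc d) : Prop where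
  measurable : ∀ ξ, Measurable (V ξ)
  measurable_law : ∀ A : Set (Euc d), MeasurableSet A → Measurable fun ξ => Q ξ (V ξ ⁻¹' A)

/-- The generalized size-bias identity `E[f(W) W] = ∫ E_ξ[f(V_ξ)] μ(dξ)`, for all bounded
measurable `f`; the integral is that of a real function against a vector measure. -/
structure SizeBias (P : Measure Ω) (W : Ω → Euc d) (Q : ∀ ξ, Measure (Ω' ξ))
    (V : ∀ ξ, Ω' ξ → Euc d) (μ : VectorMeasure Ξ (Euc d)) : Prop where
  integrable : Integrable W P
  identity : ∀ f : Euc d → ℝ, Measurable f → (∃ C, ∀ x, |f x| ≤ C) →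
    ∫ ω, f (W ω) • W ω ∂P = ∫ᵛ ξ, (∫ ω, f (V ξ ω) ∂(Q ξ)) ∂•μ

/-- The proximity identity `E[f(W)] - E_ξ[f(V_ξ)] = ∫ ⟨E_η[∇f(V_η)], ν_ξ(dη)⟩`, for all
continuously differentiable `f` with bounded derivative; the integral is that of a vector function
against a vector measure, paired through the Euclidean scalar product. -/
structure Proximity (P : Measure Ω) (W : Ω → Euc d) (Q : ∀ ξ, Measure (Ω' ξ))
    (V : ∀ ξ, Ω' ξ → Euc d) (ν : Ξ → VectorMeasure Ξ (Euc d)) : Prop where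
  integrable : Integrable W P
  integrable_family : ∀ ξ, Integrable (V ξ) (Q ξ)
  identity : ∀ (ξ : Ξ) (f : Euc d → ℝ), ContDiff ℝ 1 f → (∃ C, ∀ x, ‖fderiv ℝ f x‖ ≤ C) →
    ∫ ω, f (W ω) ∂P - ∫ ω, f (V ξ ω) ∂(Q ξ) =
      ∫ᵛ η, (∫ ω, gradient f (V η ω) ∂(Q η)) ∂[innerSL ℝ; ν ξ]

end Assumptions

section Beta

variable {d : ℕ} {Ξ : Type*} [MeasurableSpace Ξ]

/-- `β_1^{(ξ)}`, the total variation of `ν_ξ` on the whole space. -/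
def betaXi1 (ν : Ξ → VectorMeasure Ξ (Euc d)) (ξ : Ξ) : ℝ≥0∞ :=
  (ν ξ).variation Set.univ

/-- `β_2`. -/
def beta2 (μ : VectorMeasure Ξ (Euc d)) (ν : Ξ → VectorMeasure Ξ (Euc d)) : ℝ≥0∞ :=
  ∫⁻ ξ, betaXi1 ν ξ ∂μ.variation

/-- `β_2^{(ξ)}`. -/
def betaXi2 (ν : Ξ → VectorMeasure Ξ (Euc d)) (ξ : Ξ) : ℝ≥0∞ :=
  ∫⁻ η, betaXi1 ν η ∂(ν ξ).variation

/-- `β_3`. -/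
def beta3 (μ : VectorMeasure Ξ (Euc d)) (ν : Ξ → VectorMeasure Ξ (Euc d)) : ℝ≥0∞ :=
  ∫⁻ ξ, betaXi2 ν ξ ∂μ.variation

/-- `β_{12}^{(ξ)}(a, b)`. -/
def betaXi12 (ν : Ξ → VectorMeasure Ξ (Euc d)) (a b : ℝ≥0∞) (ξ : Ξ) : ℝ≥0∞ :=
  ∫⁻ η, min a (b * betaXi1 ν η) ∂(ν ξ).variation

/-- `β_{23}(a, b)`. -/
def beta23 (μ : VectorMeasure Ξ (Euc d)) (ν : Ξ → VectorMeasure Ξ (Euc d))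
    (a b : ℝ≥0∞) : ℝ≥0∞ :=
  ∫⁻ ξ, betaXi12 ν a b ξ ∂μ.variation

/-- `β_{123}^{(ξ)}(a, b, c)`; the power `1 / 2` is the square root on `[0, ∞]`. -/
def betaXi123 (ν : Ξ → VectorMeasure Ξ (Euc d)) (a b c : ℝ≥0∞) (ξ : Ξ) : ℝ≥0∞ :=
  ∫⁻ η, min a (b * betaXi1 ν η + c * betaXi2 ν η ^ (1 / 2 : ℝ)) ∂(ν ξ).variation

/-- `β_{234}(a, b, c)`. -/
def beta234 (μ : VectorMeasure Ξ (Euc d)) (ν : Ξ → VectorMeasure Ξ (Euc d))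
    (a b c : ℝ≥0∞) : ℝ≥0∞ :=
  ∫⁻ ξ, betaXi123 ν a b c ξ ∂μ.variation

end Beta

end SteinCLT

end

/-! The proof is Stein's method along the Ornstein-Uhlenbeck interpolation `U c h x`, the mean of `h
(c x + √(1 - c²) Z)`, which joins the Gaussian mean of `h` at `c = 0` to `h x` at `c = 1`. Gaussian
integration by parts gives its derivative in `c` (`hasDerivAt_U`). Integrating it and evaluating at
`W` writes the error for `U c h` as the mean of the sum over `i` of `W_i φ_i(W) - ∂_i φ_i(W)`, where
`φ_i` is an average of `∂_i h`. Subtracting from `φ_i` the linear function whose gradient is the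
mean of `∇φ_i(W)` removes the second term, because `W` has identity covariance. The size-bias
identity turns the rest into an integral against `μ`. Since `μ(Ξ) = E W = 0`, the integrand may be
centred, and the proximity identity then leaves differences of the means of `∇φ_i` at `V_η` and at
`W`. Hence `enorm_integral_U_sub_le`: the error is at most `∫∫ Ψ(η) |ν_ξ|(dη) |μ|(dξ)`, where `Ψ(η)`
bounds such a difference for the averaged second derivatives `T 1 0 c (∂∂h)`.

`Ψ` is estimated by twice a supremum, or by proximity again at the price of one more derivative and
a factor `β_1^{(η)}`. Derivatives that `f` cannot bear are moved to the Gaussian kernel, `k` of them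
costing the absolute moment of the `k`-th Hermite polynomial over `(1 - c²)^{k/2}`. For three or two
bounded derivatives the resulting integrals over `c` converge up to `c = 1` and give `1/3` and
`√(2π)/4`.

For a Lipschitz `f` they diverge, so `f` is replaced by `U c f` with `c < 1`, at a cost of order
`√((1 - c) d)` (`abs_integral_sub_U_le`). Proximity is now used twice (`proximity_two`), which
requires the mean under `W` of averaged third derivatives and the supremum of averaged fourth
derivatives. Cutting the integral over `c` at the noise level `√(1 - c²)` of order `√β_2^{(η)}`
turns the latter into the square root term. The supremum of the former would contain the logarithm
of the smoothing level. Instead the second-order bound is applied to the third-order average itself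
(`abs_integral_T_two_le_of_le`): it compares the mean under `W` with a harmless Gaussian mean as
long as the noise exceeds a multiple of `p = cutoff μ ν`. Only noise levels between `p` and the
smoothing level, taken of order `p / √d`, then contribute a logarithm, whence `log d`.

All this is done for smooth compactly supported functions. The passage to general `f` mollifies,
with finite differences carrying the Lipschitz constant of the top derivative (`FD`), and multiplies
by a cutoff depending on `ε log √(1 + |x|²)`, whose derivatives decay fast enough to change that
constant by `O(ε)` only (`Top.mul_cutoff`). -/

namespace SteinCLT

noncomputable section

open Filter Topology Set
open scoped NNReal RealInnerProductSpace ContDiff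

/-! ### Directional derivatives and classes of bounded smooth functions. -/

variable {d : ℕ}

/-- The directional derivative of `f` in the direction `u`. -/
def dd (u : Euc d) (f : Euc d → ℝ) : Euc d → ℝ := fun x => fderiv ℝ f x u

/-- `f` is `n` times differentiable, with bounded directional derivatives up to the order `n`,
those of order `n` being continuous. -/
def SB : ℕ → (Euc d → ℝ) → Prop
  | 0, f => Continuous f ∧ ∃ C, ∀ x, |f x| ≤ C
  | n + 1, f => Differentiable ℝ f ∧ (∃ C, ∀ x, |f x| ≤ C) ∧ ∀ u, SB n (dd u f)

lemma SB.continuous {n : ℕ} {f : Euc d → ℝ} (h : SB n f) : Continuous f := by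
  cases n with
  | zero => exact h.1
  | succ n => exact h.1.continuous

lemma SB.bounded {n : ℕ} {f : Euc d → ℝ} (h : SB n f) : ∃ C, ∀ x, |f x| ≤ C := by
  cases n with
  | zero => exact h.2
  | succ n => exact h.2.1

lemma SB.differentiable {n : ℕ} {f : Euc d → ℝ} (h : SB (n + 1) f) : Differentiable ℝ f := h.1

lemma SB.dd {n : ℕ} {f : Euc d → ℝ} (h : SB (n + 1) f) (u : Euc d) : SB n (dd u f) := h.2.2 u

lemma SB.pred {n : ℕ} {f : Euc d → ℝ} (h : SB (n + 1) f) : SB n f := by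
  induction n generalizing f with
  | zero => exact ⟨h.continuous, h.bounded⟩
  | succ n ih => exact ⟨h.1, h.2.1, fun u => ih (h.2.2 u)⟩

lemma SB.mono {m n : ℕ} (hmn : m ≤ n) {f : Euc d → ℝ} (h : SB n f) : SB m f := by
  induction n, hmn using Nat.le_induction with
  | base => exact h
  | succ n _ ih => exact ih h.pred

lemma dd_const_mul (a : ℝ) (f : Euc d → ℝ) (u : Euc d) :
    dd u (fun x => a * f x) = fun x => a * dd u f x := by
  ext x
  have h2 : (fun x => a * f x) = a • f := by ext; simp
  simp only [dd]
  rw [h2, fderiv_const_smul_field]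
  simp

lemma dd_add_dir (u v : Euc d) (f : Euc d → ℝ) (x : Euc d) :
    dd (u + v) f x = dd u f x + dd v f x := by simp [dd]

lemma dd_smul_dir (a : ℝ) (u : Euc d) (f : Euc d → ℝ) (x : Euc d) :
    dd (a • u) f x = a * dd u f x := by simp [dd]

lemma sum_smul_basis (u : Euc d) :
    ∑ i, u i • (EuclideanSpace.single i (1 : ℝ) : Euc d) = u := by
  ext j
  simp [Finset.sum_apply, Pi.single_apply]

lemma dd_eq_sum (u : Euc d) (f : Euc d → ℝ) (x : Euc d) :
    dd u f x = ∑ i, u i * dd (EuclideanSpace.single i 1) f x := by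
  conv_lhs => rw [← sum_smul_basis u]
  simp [dd]

lemma SB.fderiv_bounded {n : ℕ} {f : Euc d → ℝ} (h : SB (n + 1) f) :
    ∃ C, 0 ≤ C ∧ ∀ x, ‖fderiv ℝ f x‖ ≤ C := by
  choose C hC using fun i : Fin d => (h.dd (EuclideanSpace.single i 1)).bounded
  have hC0 : ∀ i, 0 ≤ C i := fun i => (abs_nonneg _).trans (hC i 0)
  refine ⟨∑ i, C i, Finset.sum_nonneg fun i _ => hC0 i, fun x => ?_⟩
  refine ContinuousLinearMap.opNorm_le_bound _ (Finset.sum_nonneg fun i _ => hC0 i) fun u => ?_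
  change |SteinCLT.dd u f x| ≤ _
  rw [dd_eq_sum, Finset.sum_mul]
  refine (Finset.abs_sum_le_sum_abs _ _).trans (Finset.sum_le_sum fun i _ => ?_)
  rw [abs_mul, mul_comm]
  exact mul_le_mul (hC i x) (PiLp.norm_apply_le u i) (abs_nonneg _) (hC0 i)

lemma SB.continuous_fderiv {n : ℕ} {f : Euc d → ℝ} (h : SB (n + 1) f) :
    Continuous (fderiv ℝ f) := by
  rw [continuous_clm_apply]
  exact fun u => (h.dd u).continuous

lemma SB.contDiff_one {n : ℕ} {f : Euc d → ℝ} (h : SB (n + 1) f) : ContDiff ℝ 1 f :=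
  contDiff_one_iff_fderiv.2 ⟨h.1, h.continuous_fderiv⟩

lemma contDiff_dd {f : Euc d → ℝ} (hf : ContDiff ℝ ∞ f) (u : Euc d) : ContDiff ℝ ∞ (dd u f) :=
  (hf.fderiv_right (m := ∞) (by simp)).clm_apply contDiff_const

lemma hasCompactSupport_dd {f : Euc d → ℝ} (hf : HasCompactSupport f) (u : Euc d) :
    HasCompactSupport (dd u f) := hf.fderiv_apply (𝕜 := ℝ) u

lemma SB.of_compactSupport {f : Euc d → ℝ} (hf : ContDiff ℝ ∞ f) (hc : HasCompactSupport f)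
    (n : ℕ) : SB n f := by
  have hb : ∀ {f : Euc d → ℝ}, ContDiff ℝ ∞ f → HasCompactSupport f → ∃ C, ∀ x, |f x| ≤ C :=
    fun hf hc => hf.continuous.bounded_above_of_compact_support hc
  induction n generalizing f with
  | zero => exact ⟨hf.continuous, hb hf hc⟩
  | succ n ih =>
    exact ⟨hf.differentiable (by simp), hb hf hc,
      fun u => ih (contDiff_dd hf u) (hasCompactSupport_dd hc u)⟩

lemma dd_comm {f : Euc d → ℝ} (hf : ContDiff ℝ ∞ f) (u v : Euc d) :
    dd u (dd v f) = dd v (dd u f) := by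
  ext x
  have hd : DifferentiableAt ℝ (fderiv ℝ f) x :=
    (hf.fderiv_right (m := 1) (by norm_cast)).differentiable (by norm_num) x
  have key : ∀ a b : Euc d, dd a (dd b f) x = fderiv ℝ (fderiv ℝ f) x a b := by
    intro a b
    have : fderiv ℝ (fun y => fderiv ℝ f y b) x = (fderiv ℝ (fderiv ℝ f) x).flip b := by
      have := hd.hasFDerivAt.clm_apply (hasFDerivAt_const b x)
      rw [this.fderiv]; ext; simp
    change fderiv ℝ (fun y => fderiv ℝ f y b) x a = _
    rw [this]; simp
  rw [key, key]
  have hs : IsSymmSndFDerivAt ℝ f x :=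
    (hf.contDiffAt).isSymmSndFDerivAt (by simp; norm_cast)
  exact hs u v

lemma dd_eq_inner_gradient {f : Euc d → ℝ} {x : Euc d} (u : Euc d) :
    dd u f x = ⟪gradient f x, u⟫ := by
  simp [dd, gradient]

lemma norm_gradient (f : Euc d → ℝ) (x : Euc d) : ‖gradient f x‖ = ‖fderiv ℝ f x‖ := by
  simp [gradient]

lemma SB.continuous_gradient {n : ℕ} {f : Euc d → ℝ} (h : SB (n + 1) f) :
    Continuous (gradient f) :=
  (InnerProductSpace.toDual ℝ (Euc d)).symm.continuous.comp h.continuous_fderiv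

end

end SteinCLT

/-! ### The Gaussian distribution on the line: Hermite identities and absolute moments. -/

namespace SteinCLT

noncomputable section

open Filter Topology Set
open scoped NNReal RealInnerProductSpace ContDiff

variable {d : ℕ}

/-- The standard Gaussian measure on the line. -/
abbrev g1 : Measure ℝ := gaussianReal 0 1

lemma integrable_pow_g1 (n : ℕ) : Integrable (fun t : ℝ => t ^ n) g1 := by
  rcases Nat.eq_zero_or_pos n with rfl | hn
  · simp
  have h := (IsGaussian.memLp_id g1 n (by simp)).integrable_norm_pow (by omega)
  refine h.mono' (by fun_prop) (ae_of_all _ fun t => ?_)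
  simp

lemma integrable_abs_pow_g1 (n : ℕ) : Integrable (fun t : ℝ => |t| ^ n) g1 := by
  simpa [abs_pow] using (integrable_pow_g1 n).abs

lemma integrable_g1_iff (f : ℝ → ℝ) :
    Integrable f g1 ↔ Integrable (fun t => gaussianPDFReal 0 1 t * f t) volume := by
  rw [g1, gaussianReal_of_var_ne_zero 0 one_ne_zero,
    integrable_withDensity_iff_integrable_smul' (measurable_gaussianPDF 0 1)
      (ae_of_all _ fun _ => gaussianPDF_lt_top)]
  simp [smul_eq_mul]

lemma hasDerivAt_gaussianPDFReal (t : ℝ) :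
    HasDerivAt (gaussianPDFReal 0 1) (-(t * gaussianPDFReal 0 1 t)) t := by
  have h : HasDerivAt (fun x : ℝ => (√(2 * Real.pi))⁻¹ * Real.exp (-x ^ 2 / 2))
      ((√(2 * Real.pi))⁻¹ * (Real.exp (-t ^ 2 / 2) * (-(2 * t) / 2))) t := by
    refine HasDerivAt.const_mul _ (HasDerivAt.exp ?_)
    simpa using ((hasDerivAt_pow 2 t).neg.div_const 2)
  have he : gaussianPDFReal 0 1 = fun x : ℝ => (√(2 * Real.pi))⁻¹ * Real.exp (-x ^ 2 / 2) := by
    ext x; simp [gaussianPDFReal]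
  rw [he]
  refine h.congr_deriv ?_
  ring

/-- The density has derivative `-t` times itself, so the difference of the two integrands, weighted
by the density, is the derivative of an integrable function and has integral zero. -/
lemma integral_deriv_g1 {F F' : ℝ → ℝ} (hF : ∀ t, HasDerivAt F (F' t) t)
    (h1 : Integrable (fun t => t * F t) g1) (h2 : Integrable F' g1) (h3 : Integrable F g1) :
    ∫ t, F' t ∂g1 = ∫ t, t * F t ∂g1 := by
  rw [integrable_g1_iff] at h1 h2 h3
  rw [g1, integral_gaussianReal_eq_integral_smul one_ne_zero,
    integral_gaussianReal_eq_integral_smul one_ne_zero]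
  simp only [smul_eq_mul]
  rw [← sub_eq_zero, ← integral_sub h2 h1]
  refine integral_eq_zero_of_hasDerivAt_of_integrable (f := fun t => gaussianPDFReal 0 1 t * F t)
    (fun t => ?_) (h2.sub h1) h3
  refine ((hasDerivAt_gaussianPDFReal t).fun_mul (hF t)).congr_deriv ?_
  ring

lemma integrable_pow_mul_bdd_g1 {F : ℝ → ℝ} (hF : Continuous F) {C : ℝ} (hC : ∀ t, |F t| ≤ C)
    (n : ℕ) : Integrable (fun t => t ^ n * F t) g1 := by
  refine ((integrable_abs_pow_g1 n).mul_const C).mono' (by fun_prop) (ae_of_all _ fun t => ?_)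
  rw [Real.norm_eq_abs, abs_mul, abs_pow]
  exact mul_le_mul_of_nonneg_left (hC t) (by positivity)

section Hermite

variable {F F1 F2 F3 : ℝ → ℝ} {C C1 C2 C3 : ℝ}

/-- This identity and its two successors trade derivatives of `F` for Hermite polynomials, so that
afterwards only the supremum of `F` has to be paid. The bounds on the derivatives serve
integrability alone. -/
lemma integral_hermite_one (h1 : ∀ t, HasDerivAt F (F1 t) t) (hc1 : Continuous F1)
    (hC : ∀ t, |F t| ≤ C) (hC1 : ∀ t, |F1 t| ≤ C1) :
    ∫ t, F1 t ∂g1 = ∫ t, t * F t ∂g1 := by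
  have hc : Continuous F := continuous_iff_continuousAt.2 fun t => (h1 t).continuousAt
  refine integral_deriv_g1 h1 ?_ ?_ ?_
  · simpa using integrable_pow_mul_bdd_g1 hc hC 1
  · simpa using integrable_pow_mul_bdd_g1 hc1 hC1 0
  · simpa using integrable_pow_mul_bdd_g1 hc hC 0

lemma integral_hermite_two (h1 : ∀ t, HasDerivAt F (F1 t) t) (h2 : ∀ t, HasDerivAt F1 (F2 t) t)
    (hc2 : Continuous F2)
    (hC : ∀ t, |F t| ≤ C) (hC1 : ∀ t, |F1 t| ≤ C1) (hC2 : ∀ t, |F2 t| ≤ C2) :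
    ∫ t, F2 t ∂g1 = ∫ t, (t ^ 2 - 1) * F t ∂g1 := by
  have hc : Continuous F := continuous_iff_continuousAt.2 fun t => (h1 t).continuousAt
  have hc1 : Continuous F1 := continuous_iff_continuousAt.2 fun t => (h2 t).continuousAt
  have i0 := integrable_pow_mul_bdd_g1 hc hC 0
  have i1 := integrable_pow_mul_bdd_g1 hc hC 1
  have i2 := integrable_pow_mul_bdd_g1 hc hC 2
  have j1 := integrable_pow_mul_bdd_g1 hc1 hC1 1
  simp only [pow_zero, one_mul, pow_one] at i0 i1 j1
  rw [integral_hermite_one h2 hc2 hC1 hC2]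
  have key := integral_deriv_g1 (F := fun t => t * F t) (F' := fun t => F t + t * F1 t)
    (fun t => by simpa using (hasDerivAt_id' t).fun_mul (h1 t))
    (by simpa [pow_two, mul_assoc] using i2) (i0.add j1) i1
  rw [integral_add i0 j1] at key
  have e : ∫ t, (t ^ 2 - 1) * F t ∂g1 = ∫ t, t * (t * F t) ∂g1 - ∫ t, F t ∂g1 := by
    rw [← integral_sub (by simpa [pow_two, mul_assoc] using i2) i0]
    congr 1; ext t; ring
  rw [e, ← key]; ring

lemma integral_hermite_three (h1 : ∀ t, HasDerivAt F (F1 t) t)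
    (h2 : ∀ t, HasDerivAt F1 (F2 t) t) (h3 : ∀ t, HasDerivAt F2 (F3 t) t)
    (hc3 : Continuous F3) (hC : ∀ t, |F t| ≤ C) (hC1 : ∀ t, |F1 t| ≤ C1)
    (hC2 : ∀ t, |F2 t| ≤ C2) (hC3 : ∀ t, |F3 t| ≤ C3) :
    ∫ t, F3 t ∂g1 = ∫ t, (t ^ 3 - 3 * t) * F t ∂g1 := by
  have hc : Continuous F := continuous_iff_continuousAt.2 fun t => (h1 t).continuousAt
  have hc1 : Continuous F1 := continuous_iff_continuousAt.2 fun t => (h2 t).continuousAt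
  have i0 := integrable_pow_mul_bdd_g1 hc hC 0
  have i1 := integrable_pow_mul_bdd_g1 hc hC 1
  have i2 := integrable_pow_mul_bdd_g1 hc hC 2
  have i3 := integrable_pow_mul_bdd_g1 hc hC 3
  have j0 := integrable_pow_mul_bdd_g1 hc1 hC1 0
  have j2 := integrable_pow_mul_bdd_g1 hc1 hC1 2
  simp only [pow_zero, one_mul, pow_one] at i0 i1 j0
  rw [integral_hermite_two h2 h3 hc3 hC1 hC2 hC3]
  have k1 : Integrable (fun t => 2 * (t * F t)) g1 := i1.const_mul 2
  have k2 : Integrable (fun t => (t ^ 2 - 1) * F1 t) g1 := by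
    refine (j2.sub j0).congr (ae_of_all _ fun t => ?_)
    simp only [Pi.sub_apply]; ring
  have k3 : Integrable (fun t => t * ((t ^ 2 - 1) * F t)) g1 := by
    refine (i3.sub i1).congr (ae_of_all _ fun t => ?_)
    simp only [Pi.sub_apply]; ring
  have key := integral_deriv_g1 (F := fun t => (t ^ 2 - 1) * F t)
    (F' := fun t => 2 * (t * F t) + (t ^ 2 - 1) * F1 t)
    (fun t => by
      refine (((hasDerivAt_pow 2 t).sub_const 1).fun_mul (h1 t)).congr_deriv ?_
      simp; ring)
    k3 (k1.add k2)
    ((i2.sub i0).congr (ae_of_all _ fun t => by simp only [Pi.sub_apply]; ring))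
  rw [integral_add k1 k2] at key
  have e : ∫ t, (t ^ 3 - 3 * t) * F t ∂g1 =
      ∫ t, t * ((t ^ 2 - 1) * F t) ∂g1 - ∫ t, 2 * (t * F t) ∂g1 := by
    rw [← integral_sub k3 k1]
    congr 1; ext t; ring
  rw [e, ← key]; ring

end Hermite

/-- The first absolute moment of the standard Gaussian distribution on the line. -/
def e1 : ℝ := √(2 / Real.pi)

lemma integral_abs_g1 : ∫ t, |t| ∂g1 = e1 := by
  rw [g1, integral_gaussianReal_eq_integral_smul one_ne_zero]
  have h : ∀ t : ℝ, gaussianPDFReal 0 1 t • |t| =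
      (fun x => (√(2 * Real.pi))⁻¹ * (x ^ (1 : ℝ) * Real.exp (-(1 / 2) * x ^ (2 : ℝ)))) |t| := by
    intro t
    have : (|t| : ℝ) ^ (2 : ℝ) = t ^ 2 := by rw [Real.rpow_two, sq_abs]
    simp only [this, gaussianPDFReal, smul_eq_mul, Real.rpow_one]
    simp
    ring_nf
  simp_rw [h]
  rw [integral_comp_abs (f := fun x => (√(2 * Real.pi))⁻¹ *
    (x ^ (1 : ℝ) * Real.exp (-(1 / 2) * x ^ (2 : ℝ)))), integral_const_mul,
    integral_rpow_mul_exp_neg_mul_rpow (by norm_num) (by norm_num) (by norm_num)]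
  norm_num
  rw [e1, Real.sqrt_div (by norm_num)]
  have h2 : √(2 : ℝ) * √2 = 2 := Real.mul_self_sqrt (by norm_num)
  have hp : √Real.pi ≠ 0 := by positivity
  field_simp
  nlinarith [h2]

/-- Integration by parts with `t |t|`, which is continuously differentiable with derivative `2 |t|`.
-/
lemma integral_abs_cube_g1 : ∫ t, |t| ^ 3 ∂g1 = 2 * e1 := by
  have hd : ∀ t : ℝ, HasDerivAt (fun t : ℝ => t * |t|) (2 * |t|) t := by
    intro t
    rcases lt_trichotomy t 0 with h | h | h
    · refine ((hasDerivAt_id' t).fun_mul (hasDerivAt_abs_neg h)).congr_deriv ?_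
      simp [abs_of_neg h]; ring
    -- At the origin the difference quotient of `t |t|` is `|t|`, which tends to zero.
    · subst h
      rw [hasDerivAt_iff_isLittleO_nhds_zero]
      simp only [zero_add, abs_zero, mul_zero, smul_eq_mul, sub_zero]
      refine Asymptotics.isLittleO_of_tendsto (by simp) ?_
      have : Tendsto (fun t : ℝ => |t|) (𝓝 0) (𝓝 0) := by
        simpa using (continuous_abs (G := ℝ)).tendsto 0
      refine this.congr' ?_
      filter_upwards with t
      rcases eq_or_ne t 0 with rfl | h
      · simp
      · field_simp
    · refine ((hasDerivAt_id' t).fun_mul (hasDerivAt_abs_pos h)).congr_deriv ?_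
      simp [abs_of_pos h]; ring
  have e3 : ∀ t : ℝ, t * (t * |t|) = |t| ^ 3 := fun t => by
    rw [← mul_assoc, ← sq, ← sq_abs t]; ring
  have := integral_deriv_g1 hd (by simpa [e3] using integrable_abs_pow_g1 3)
    (by simpa using (integrable_abs_pow_g1 1).const_mul 2)
    ((integrable_abs_pow_g1 2).mono' (by fun_prop) (ae_of_all _ fun t => by
      simp [sq]))
  simp only [e3] at this
  rw [← this, integral_const_mul, integral_abs_g1]

lemma integral_abs_pow_five_g1 : ∫ t, |t| ^ 5 ∂g1 = 8 * e1 := by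
  have hd : ∀ t : ℝ, HasDerivAt (fun t : ℝ => t ^ 3 * |t|) (4 * |t| ^ 3) t := by
    intro t
    rcases lt_trichotomy t 0 with h | h | h
    · refine ((hasDerivAt_pow 3 t).fun_mul (hasDerivAt_abs_neg h)).congr_deriv ?_
      simp [abs_of_neg h]; ring
    · subst h
      rw [hasDerivAt_iff_isLittleO_nhds_zero]
      simp only [zero_add, abs_zero, smul_eq_mul]
      refine Asymptotics.isLittleO_of_tendsto (by simp) ?_
      have : Tendsto (fun t : ℝ => t ^ 2 * |t|) (𝓝 0) (𝓝 0) := by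
        have : Continuous fun t : ℝ => t ^ 2 * |t| := by fun_prop
        simpa using this.tendsto 0
      refine this.congr' ?_
      filter_upwards with t
      rcases eq_or_ne t 0 with rfl | h
      · simp
      · field_simp
        simp
    · refine ((hasDerivAt_pow 3 t).fun_mul (hasDerivAt_abs_pos h)).congr_deriv ?_
      simp [abs_of_pos h]; ring
  have e3 : ∀ t : ℝ, t * (t ^ 3 * |t|) = |t| ^ 5 := fun t => by
    rw [show t * (t ^ 3 * |t|) = (t ^ 2) ^ 2 * |t| by ring, ← sq_abs t]; ring
  have := integral_deriv_g1 hd (by simpa [e3] using integrable_abs_pow_g1 5)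
    ((integrable_abs_pow_g1 3).const_mul 4)
    ((integrable_abs_pow_g1 4).mono' (by fun_prop) (ae_of_all _ fun t => by
      rw [Real.norm_eq_abs, abs_mul, abs_pow, abs_abs]; exact le_of_eq (by ring)))
  simp only [e3] at this
  rw [← this, integral_const_mul, integral_abs_cube_g1]
  ring

lemma e1_nonneg : 0 ≤ e1 := Real.sqrt_nonneg _

lemma e1_le : e1 ≤ 0.798 := by
  rw [e1, Real.sqrt_le_left (by norm_num), div_le_iff₀ Real.pi_pos]
  nlinarith [Real.pi_gt_d4]

/-- The inequality of the means replaces `|t² - 3|` by a polynomial. The constant `2.25` is close to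
the optimal `√5`, the root mean square of `|t² - 3|` under the weight `|t|`. The odd absolute
moments `e1`, `2 e1`, `8 e1` then give about `2.236 e1`. -/
lemma integral_abs_hermite_three_le : ∫ t, |t ^ 3 - 3 * t| ∂g1 ≤ 1.8 := by
  have h : ∀ t : ℝ, |t ^ 3 - 3 * t| ≤ 2 / 9 * |t| ^ 5 - 4 / 3 * |t| ^ 3 + 25 / 8 * |t| := by
    intro t
    have h1 : |t ^ 3 - 3 * t| = |t| * |t ^ 2 - 3| := by rw [← abs_mul]; ring_nf
    have h2 : |t ^ 2 - 3| ≤ ((t ^ 2 - 3) ^ 2 / 2.25 + 2.25) / 2 := by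
      have h3 := sq_nonneg (|t ^ 2 - 3| - 2.25)
      have h4 := sq_abs (t ^ 2 - 3)
      have : ((t ^ 2 - 3) ^ 2 / 2.25 + 2.25) / 2 - |t ^ 2 - 3| = (|t ^ 2 - 3| - 2.25) ^ 2 / 4.5 := by
        rw [← h4]; ring
      have : 0 ≤ (|t ^ 2 - 3| - 2.25) ^ 2 / 4.5 := by positivity
      linarith
    calc _ ≤ |t| * (((t ^ 2 - 3) ^ 2 / 2.25 + 2.25) / 2) := by
          rw [h1]; exact mul_le_mul_of_nonneg_left h2 (abs_nonneg t)
      _ = _ := by rw [← sq_abs t]; ring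
  have i1 := integrable_abs_pow_g1 1
  simp only [pow_one] at i1
  have i3 := integrable_abs_pow_g1 3
  have i5 := integrable_abs_pow_g1 5
  refine (integral_mono ?_ (((i5.const_mul (2 / 9)).sub (i3.const_mul (4 / 3))).add
    (i1.const_mul (25 / 8))) h).trans ?_
  · exact ((integrable_pow_g1 3).sub (by simpa using (integrable_pow_g1 1).const_mul 3)).abs
  · rw [integral_add' ((i5.const_mul _).sub (i3.const_mul _)) (i1.const_mul _),
      integral_sub' (i5.const_mul _) (i3.const_mul _), integral_const_mul, integral_const_mul,
      integral_const_mul, integral_abs_g1, integral_abs_cube_g1, integral_abs_pow_five_g1]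
    linarith [e1_le]

lemma integral_sq_g1 : ∫ t, t ^ 2 ∂g1 = 1 := by
  have := integral_deriv_g1 (F := fun t => t) (F' := fun _ => 1) (fun t => hasDerivAt_id t)
    (by simpa [sq] using integrable_pow_g1 2) (by simp) (by simpa using integrable_pow_g1 1)
  simpa [sq] using this.symm

/-- As `Z² - 1` has mean zero, its absolute mean is twice the mean of the positive part of `1 - Z²`.
Against the density, `1 - t²` has the antiderivative `t` times the density, so the exact value is
four times the density at `1`. -/
lemma integral_abs_hermite_two_le : ∫ t, |t ^ 2 - 1| ∂g1 ≤ 0.968 := by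
  have h : ∀ t : ℝ, |t ^ 2 - 1| = (t ^ 2 - 1) + 2 * (Icc (-1) 1).indicator (fun t => 1 - t ^ 2) t := by
    intro t
    by_cases ht : t ∈ Icc (-1 : ℝ) 1
    · rw [indicator_of_mem ht, abs_of_nonpos (by nlinarith [ht.1, ht.2])]; ring
    · rw [indicator_of_notMem ht, abs_of_nonneg]
      · ring
      · rw [mem_Icc, not_and_or, not_le, not_le] at ht
        rcases ht with h | h <;> nlinarith
  have i2 : Integrable (fun t : ℝ => t ^ 2 - 1) g1 := (integrable_pow_g1 2).sub (integrable_const 1)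
  have i3 : Integrable (fun t : ℝ => 1 - t ^ 2) g1 := (integrable_const 1).sub (integrable_pow_g1 2)
  simp_rw [h]
  rw [integral_add i2 ((i3.indicator measurableSet_Icc).const_mul 2), integral_const_mul,
    integral_sub (integrable_pow_g1 2) (integrable_const 1), integral_sq_g1]
  have e : ∫ t, (Icc (-1) 1).indicator (fun t : ℝ => 1 - t ^ 2) t ∂g1 =
      2 * gaussianPDFReal 0 1 1 := by
    rw [g1, integral_gaussianReal_eq_integral_smul one_ne_zero]
    have : ∀ t : ℝ, gaussianPDFReal 0 1 t • (Icc (-1) 1).indicator (fun t : ℝ => 1 - t ^ 2) t =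
        (Icc (-1) 1).indicator (fun t => gaussianPDFReal 0 1 t * (1 - t ^ 2)) t := by
      intro t
      by_cases ht : t ∈ Icc (-1 : ℝ) 1 <;> simp [ht, -mem_Icc]
    simp_rw [this]
    have hcg : Continuous (gaussianPDFReal 0 1) :=
      continuous_iff_continuousAt.2 fun t => (hasDerivAt_gaussianPDFReal t).continuousAt
    rw [integral_indicator measurableSet_Icc, integral_Icc_eq_integral_Ioc,
      ← intervalIntegral.integral_of_le (by norm_num),
      intervalIntegral.integral_eq_sub_of_hasDerivAt
        (f := fun t => t * gaussianPDFReal 0 1 t)]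
    · have : gaussianPDFReal 0 1 (-1) = gaussianPDFReal 0 1 1 := by simp [gaussianPDFReal]
      rw [this]; ring
    · intro t _
      refine ((hasDerivAt_id' t).fun_mul (hasDerivAt_gaussianPDFReal t)).congr_deriv ?_
      simp; ring
    · exact (by fun_prop : Continuous _).intervalIntegrable _ _
  rw [e]
  -- The square of the density at `1` is `1 / (2πe)`, which avoids estimating a square root. Four
  -- times `0.242` is `0.968`.
  have hp : gaussianPDFReal 0 1 1 ≤ 0.242 := by
    have h1 : gaussianPDFReal 0 1 1 ^ 2 = (2 * Real.pi * Real.exp 1)⁻¹ := by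
      have : Real.exp (-(1 - 0) ^ 2 / (2 * 1)) ^ 2 = (Real.exp 1)⁻¹ := by
        rw [← Real.exp_neg, ← Real.exp_nat_mul]; norm_num
      simp only [gaussianPDFReal, NNReal.coe_one]
      rw [mul_pow, this, inv_pow, Real.sq_sqrt (by positivity)]
      rw [mul_inv (2 * Real.pi)]; simp [mul_comm]
    refine abs_le_of_sq_le_sq' ?_ (by norm_num) |>.2
    rw [h1]
    refine inv_le_of_inv_le₀ (by positivity) ?_
    have a := Real.pi_gt_d4
    have b := Real.exp_one_gt_d9
    have : 3.1415 * 2.718 ≤ Real.pi * Real.exp 1 := by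
      refine mul_le_mul a.le (by linarith) (by norm_num) Real.pi_pos.le
    norm_num at this ⊢
    nlinarith
  simp
  linarith

end

end SteinCLT

/-! ### The standard Gaussian measure on the Euclidean space and derivatives moved to its kernel. -/

namespace SteinCLT

noncomputable section

open Filter Topology Set
open scoped NNReal RealInnerProductSpace ContDiff

variable {d : ℕ}

/-- The standard Gaussian measure on the Euclidean space. -/
abbrev gd (d : ℕ) : Measure (Euc d) := stdGaussian (Euc d)

/-- `A` and `B` are the adjoints of the two components of the linear map `φ`, so the characteristic
function of the image factorizes. -/
lemma map_prod_gd_of_charFun {E : Type*} [NormedAddCommGroup E] [InnerProductSpace ℝ E]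
    [MeasurableSpace E] [BorelSpace E] [SecondCountableTopology E]
    {ρ : Measure (Euc d)} {σ : Measure E} [IsFiniteMeasure ρ] [IsFiniteMeasure σ]
    (φ : Euc d × E → Euc d) (hφ : Continuous φ) (A : Euc d → Euc d) (B : Euc d → E)
    (h : ∀ p t, ⟪φ p, t⟫ = ⟪p.1, A t⟫ + ⟪p.2, B t⟫)
    (hc : ∀ t, charFun ρ (A t) * charFun σ (B t) = charFun (gd d) t) :
    (ρ.prod σ).map φ = gd d := by
  refine Measure.ext_of_charFun ?_
  ext t
  rw [← hc, charFun_apply, integral_map hφ.measurable.aemeasurable (by fun_prop)]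
  simp only [h, charFun_apply]
  rw [← integral_prod_mul]
  congr 1
  ext p
  rw [← Complex.exp_add]
  push_cast
  ring_nf

/-- Replacing the component along `u` by an independent scalar normal does not change the law.
Directional derivatives under the Gaussian mean thereby reduce to one dimension. -/
lemma map_split_gd {u : Euc d} (hu : ‖u‖ = 1) :
    ((gd d).prod g1).map (fun p => p.1 + (p.2 - ⟪u, p.1⟫) • u) = gd d := by
  refine map_prod_gd_of_charFun _ (by fun_prop) (fun t => t - ⟪u, t⟫ • u) (fun t => ⟪u, t⟫)
    (fun p t => ?_) (fun t => ?_)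
  · simp only [inner_add_left, inner_sub_right, inner_smul_left, inner_smul_right,
      RCLike.inner_apply, conj_trivial, real_inner_comm u p.1]
    ring
  · rw [charFun_stdGaussian, charFun_stdGaussian, charFun_gaussianReal, ← Complex.exp_add]
    congr 1
    have : ‖t - ⟪u, t⟫ • u‖ ^ 2 = ‖t‖ ^ 2 - ⟪u, t⟫ ^ 2 := by
      rw [norm_sub_sq_real, norm_smul, hu, inner_smul_right, real_inner_comm u t,
        Real.norm_eq_abs, mul_one, sq_abs]
      ring
    have h2 : ((‖t - ⟪u, t⟫ • u‖ : ℝ) : ℂ) ^ 2 = (‖t‖ : ℂ) ^ 2 - (⟪u, t⟫ : ℂ) ^ 2 := by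
      exact_mod_cast this
    rw [h2]
    simp
    ring

/-- Rotation invariance, from which the composition laws of `U` and of `GA` follow. -/
lemma map_add_gd {a b : ℝ} (h : a ^ 2 + b ^ 2 = 1) :
    ((gd d).prod (gd d)).map (fun p => a • p.1 + b • p.2) = gd d := by
  refine map_prod_gd_of_charFun _ (by fun_prop) (fun t => a • t) (fun t => b • t)
    (fun p t => ?_) (fun t => ?_)
  · simp [inner_add_left, inner_smul_left, inner_smul_right]
  · rw [charFun_stdGaussian, charFun_stdGaussian, charFun_stdGaussian, ← Complex.exp_add]
    congr 1
    simp only [norm_smul]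
    have h2 : ((|a| : ℝ) : ℂ) ^ 2 + ((|b| : ℝ) : ℂ) ^ 2 = 1 := by
      rw [← sq_abs a, ← sq_abs b] at h
      exact_mod_cast h
    push_cast
    simp only [Real.norm_eq_abs] at *
    linear_combination (-(‖t‖ : ℂ) ^ 2 / 2) * h2

lemma integral_add_gd {a b : ℝ} (h : a ^ 2 + b ^ 2 = 1) {F : Euc d → ℝ} (hF : Continuous F)
    {C : ℝ} (hC : ∀ x, |F x| ≤ C) :
    ∫ z, F z ∂gd d = ∫ y, ∫ z, F (a • y + b • z) ∂gd d ∂gd d := by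
  conv_lhs => rw [← map_add_gd h]
  rw [integral_map (by fun_prop) hF.aestronglyMeasurable, integral_prod]
  exact Integrable.of_bound (by fun_prop) C (ae_of_all _ fun p => hC _)

lemma memLp_id_gd : MemLp id 2 (gd d) := IsGaussian.memLp_id (gd d) 2 (by simp)

lemma integrable_norm_sq_gd : Integrable (fun z => ‖z‖ ^ 2) (gd d) :=
  memLp_id_gd.integrable_norm_pow (by norm_num)

lemma integrable_norm_pow_gd (n : ℕ) : Integrable (fun z => ‖z‖ ^ n) (gd d) := by
  rcases Nat.eq_zero_or_pos n with rfl | hn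
  · simp
  exact (IsGaussian.memLp_id (gd d) n (by simp)).integrable_norm_pow (by omega)

lemma integrable_norm_gd : Integrable (fun z => ‖z‖) (gd d) := by
  simpa using integrable_norm_pow_gd (d := d) 1

lemma integral_split_gd {u : Euc d} (hu : ‖u‖ = 1) {F : Euc d → ℝ} (hF : Continuous F)
    (hi : Integrable F (gd d)) :
    ∫ z, F z ∂gd d = ∫ y, ∫ t, F (y - ⟪u, y⟫ • u + t • u) ∂g1 ∂gd d := by
  conv_lhs => rw [← map_split_gd hu]
  rw [integral_map (by fun_prop) hF.aestronglyMeasurable, integral_prod]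
  · refine integral_congr_ae (ae_of_all _ fun y => ?_)
    refine integral_congr_ae (ae_of_all _ fun t => ?_)
    simp only [sub_smul]
    congr 1
    abel
  · rw [← map_split_gd hu] at hi
    exact (integrable_map_measure hF.aestronglyMeasurable (by fun_prop)).1 hi

lemma integrable_bdd_gd {F : Euc d → ℝ} (hF : Continuous F) {C : ℝ} (hC : ∀ x, |F x| ≤ C)
    (s : ℝ) (x : Euc d) : Integrable (fun z => F (x + s • z)) (gd d) :=
  Integrable.of_bound (by fun_prop) C (ae_of_all _ fun p => hC _)

lemma hasDerivAt_line {F : Euc d → ℝ} (hF : Differentiable ℝ F) (y u : Euc d) (s t : ℝ) :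
    HasDerivAt (fun t : ℝ => F (y + (s * t) • u)) (s * dd u F (y + (s * t) • u)) t := by
  have h1 : HasDerivAt (fun t : ℝ => y + (s * t) • u) (s • u) t := by
    have := (((hasDerivAt_id' t).const_mul s).smul_const u).const_add y
    simpa using this
  have := (hF (y + (s * t) • u)).hasFDerivAt.comp_hasDerivAt t h1
  simpa [dd, Function.comp_def] using this

lemma integral_line_gd {u : Euc d} (hu : ‖u‖ = 1) {F : Euc d → ℝ} (hF : Continuous F)
    {C : ℝ} (hC : ∀ x, |F x| ≤ C) (s : ℝ) (x : Euc d) :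
    ∫ z, F (x + s • z) ∂gd d =
      ∫ y, ∫ t, F (x + s • (y - ⟪u, y⟫ • u) + (s * t) • u) ∂g1 ∂gd d := by
  rw [integral_split_gd hu (F := fun z => F (x + s • z)) (by fun_prop)
    (integrable_bdd_gd hF hC s x)]
  simp only [smul_add, smul_smul, add_assoc]

/-- Gaussian integration by parts. -/
lemma integral_inner_mul_gd {F : Euc d → ℝ} (hF : SB 1 F) (u : Euc d) (s : ℝ) (x : Euc d) :
    ∫ z, ⟪u, z⟫ * F (x + s • z) ∂gd d = s * ∫ z, dd u F (x + s • z) ∂gd d := by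
  obtain ⟨C, hC⟩ := hF.bounded
  obtain ⟨C1, hC1⟩ := (hF.dd u).bounded
  have hFc := hF.continuous
  have hFc1 := (hF.dd u).continuous
  have unit : ∀ u : Euc d, ‖u‖ = 1 → ∫ z, ⟪u, z⟫ * F (x + s • z) ∂gd d =
      s * ∫ z, dd u F (x + s • z) ∂gd d := by
    intro u hu
    obtain ⟨C1, hC1⟩ := (hF.dd u).bounded
    have hFc1 := (hF.dd u).continuous
    rw [integral_split_gd hu (F := fun z => ⟪u, z⟫ * F (x + s • z)) (by fun_prop),
      integral_line_gd hu hFc1 hC1, ← integral_const_mul]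
    · refine integral_congr_ae (ae_of_all _ fun y => ?_)
      simp only
      rw [← integral_const_mul]
      have := integral_hermite_one
        (F := fun t => F (x + s • (y - ⟪u, y⟫ • u) + (s * t) • u)) (C := C) (C1 := |s| * C1)
        (fun t => hasDerivAt_line hF.1 _ u s t) (by fun_prop) (fun t => hC _)
        (fun t => by rw [abs_mul]; exact mul_le_mul_of_nonneg_left (hC1 _) (abs_nonneg s))
      rw [this]
      refine integral_congr_ae (ae_of_all _ fun t => ?_)
      simp [inner_add_right, inner_sub_right, inner_smul_right, hu, smul_add, smul_smul, add_assoc]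
    · refine (integrable_norm_gd.mul_const C).mono' (by fun_prop) (ae_of_all _ fun z => ?_)
      rw [norm_mul]
      refine mul_le_mul ?_ (hC _) (norm_nonneg _) (norm_nonneg _)
      simpa [hu] using norm_inner_le_norm (𝕜 := ℝ) u z
  rcases eq_or_ne u 0 with rfl | h0
  · simp [dd]
  have h := unit (‖u‖⁻¹ • u) (norm_smul_inv_norm h0)
  have hn : ‖u‖ ≠ 0 := norm_ne_zero_iff.2 h0
  simp only [inner_smul_left, dd_smul_dir, conj_trivial, mul_assoc] at h
  rw [integral_const_mul, integral_const_mul] at h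
  field_simp at h
  simpa [mul_assoc] using h

/-- A bound for the second Gaussian constant, `E|Z^2 - 1|`. -/
def e2 : ℝ := 0.968
/-- A bound for the third Gaussian constant, `E|Z^3 - 3Z|`. -/
def e3 : ℝ := 1.8

lemma integral_mul_bdd_le {H : ℝ → ℝ} (hi : Integrable H g1) {F : ℝ → ℝ} {B e : ℝ} (hB : ∀ t, |F t| ≤ B) (he : ∫ t, |H t| ∂g1 ≤ e) :
    |∫ t, H t * F t ∂g1| ≤ e * B := by
  have hB0 : 0 ≤ B := (abs_nonneg _).trans (hB 0)
  calc |∫ t, H t * F t ∂g1| ≤ ∫ t, |H t * F t| ∂g1 := abs_integral_le_integral_abs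
    _ ≤ ∫ t, |H t| * B ∂g1 := by
        refine integral_mono_of_nonneg (ae_of_all _ fun t => abs_nonneg _) (hi.abs.mul_const B)
          (ae_of_all _ fun t => ?_)
        simp only [abs_mul]
        exact mul_le_mul_of_nonneg_left (hB t) (abs_nonneg _)
    _ ≤ e * B := by
        rw [integral_mul_const]; exact mul_le_mul_of_nonneg_right he hB0

lemma abs_integral_gd_le {F : Euc d → ℝ} {B : ℝ} (h : ∀ y, |F y| ≤ B) :
    |∫ y, F y ∂gd d| ≤ B := by
  have := norm_integral_le_of_norm_le_const (μ := gd d) (f := F) (C := B) (ae_of_all _ fun y => (by simpa using h y))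
  simpa using this

section Bounds

variable {F : Euc d → ℝ} {B s : ℝ}

/-- On each line in the direction `u` the derivative is transferred to the one-dimensional density,
each unit of order costing a factor `1/s` from the scaling of the noise. The bounds of second and
third order below have the same proof. -/
lemma abs_integral_dd_le (hF : SB 1 F) (hB : ∀ x, |F x| ≤ B) (hs : 0 < s) (u x : Euc d) :
    |∫ z, dd u F (x + s • z) ∂gd d| ≤ e1 / s * B * ‖u‖ := by
  rcases eq_or_ne u 0 with rfl | h0
  · simp [dd]
  have hn : 0 < ‖u‖ := norm_pos_iff.2 h0
  set v := ‖u‖⁻¹ • u with hv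
  have hv1 : ‖v‖ = 1 := norm_smul_inv_norm h0
  have huv : u = ‖u‖ • v := by rw [hv, smul_smul, mul_inv_cancel₀ hn.ne', one_smul]
  have unit : |∫ z, dd v F (x + s • z) ∂gd d| ≤ e1 / s * B := by
    obtain ⟨C1, hC1⟩ := (hF.dd v).bounded
    have hc := hF.continuous
    have hc1 := (hF.dd v).continuous
    rw [integral_line_gd hv1 hc1 hC1]
    refine abs_integral_gd_le fun y => ?_
    have := integral_hermite_one
      (F := fun t => F (x + s • (y - ⟪v, y⟫ • v) + (s * t) • v)) (C := B) (C1 := |s| * C1)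
      (fun t => hasDerivAt_line hF.1 _ v s t) (by fun_prop) (fun t => hB _)
      (fun t => by rw [abs_mul]; exact mul_le_mul_of_nonneg_left (hC1 _) (abs_nonneg s))
    rw [integral_const_mul] at this
    have h2 := integral_mul_bdd_le (H := fun t => t)
      (by simpa using integrable_pow_g1 1)
      (F := fun t => F (x + s • (y - ⟪v, y⟫ • v) + (s * t) • v)) (fun t => hB _)
      integral_abs_g1.le
    rw [← this, abs_mul, abs_of_pos hs] at h2
    rw [div_mul_eq_mul_div, le_div_iff₀ hs]
    linarith
  rw [huv]
  simp only [dd_smul_dir]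
  rw [integral_const_mul, abs_mul, abs_norm, norm_smul, hv1, mul_one, norm_norm, mul_comm]
  exact mul_le_mul_of_nonneg_right unit hn.le

lemma abs_integral_dd_two_le (hF : SB 2 F) (hB : ∀ x, |F x| ≤ B) (hs : 0 < s) (u x : Euc d) :
    |∫ z, dd u (dd u F) (x + s • z) ∂gd d| ≤ e2 / s ^ 2 * B * ‖u‖ ^ 2 := by
  rcases eq_or_ne u 0 with rfl | h0
  · simp [dd]
  have hn : 0 < ‖u‖ := norm_pos_iff.2 h0
  set v := ‖u‖⁻¹ • u with hv
  have hv1 : ‖v‖ = 1 := norm_smul_inv_norm h0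
  have huv : u = ‖u‖ • v := by rw [hv, smul_smul, mul_inv_cancel₀ hn.ne', one_smul]
  have unit : |∫ z, dd v (dd v F) (x + s • z) ∂gd d| ≤ e2 / s ^ 2 * B := by
    obtain ⟨C1, hC1⟩ := (hF.dd v).bounded
    obtain ⟨C2, hC2⟩ := ((hF.dd v).dd v).bounded
    have hc := hF.continuous
    have hc2 := ((hF.dd v).dd v).continuous
    rw [integral_line_gd hv1 hc2 hC2]
    refine abs_integral_gd_le fun y => ?_
    have := integral_hermite_two
      (F := fun t => F (x + s • (y - ⟪v, y⟫ • v) + (s * t) • v)) (C := B) (C1 := |s| * C1)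
      (C2 := |s| * (|s| * C2))
      (fun t => hasDerivAt_line hF.1 _ v s t)
      (fun t => (hasDerivAt_line (hF.dd v).1 _ v s t).const_mul s) (by fun_prop) (fun t => hB _)
      (fun t => by rw [abs_mul]; gcongr; exact hC1 _)
      (fun t => by rw [abs_mul, abs_mul]; gcongr; exact hC2 _)
    rw [integral_const_mul, integral_const_mul] at this
    have h2 := integral_mul_bdd_le (H := fun t => t ^ 2 - 1)
      ((integrable_pow_g1 2).sub (integrable_const 1))
      (F := fun t => F (x + s • (y - ⟪v, y⟫ • v) + (s * t) • v)) (fun t => hB _)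
      integral_abs_hermite_two_le
    rw [← this, ← mul_assoc, abs_mul, abs_of_pos (mul_pos hs hs)] at h2
    rw [div_mul_eq_mul_div, le_div_iff₀ (by positivity), e2]
    linarith
  rw [huv]
  have e : ∀ y, dd (‖u‖ • v) (dd (‖u‖ • v) F) y = ‖u‖ ^ 2 * dd v (dd v F) y := by
    clear_value v
    have : ∀ G : Euc d → ℝ, dd (‖u‖ • v) G = fun y => ‖u‖ * dd v G y := by
      intro G; ext y; exact dd_smul_dir _ _ _ _
    intro y
    simp only [this, dd_const_mul]; ring
  simp only [e]
  rw [integral_const_mul, abs_mul, abs_of_nonneg (by positivity), norm_smul, hv1, mul_one,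
    norm_norm, mul_comm]
  exact mul_le_mul_of_nonneg_right unit (by positivity)

lemma abs_integral_dd_three_le (hF : SB 3 F) (hB : ∀ x, |F x| ≤ B) (hs : 0 < s) (u x : Euc d) :
    |∫ z, dd u (dd u (dd u F)) (x + s • z) ∂gd d| ≤ e3 / s ^ 3 * B * ‖u‖ ^ 3 := by
  rcases eq_or_ne u 0 with rfl | h0
  · simp [dd]
  have hn : 0 < ‖u‖ := norm_pos_iff.2 h0
  set v := ‖u‖⁻¹ • u with hv
  have hv1 : ‖v‖ = 1 := norm_smul_inv_norm h0
  have huv : u = ‖u‖ • v := by rw [hv, smul_smul, mul_inv_cancel₀ hn.ne', one_smul]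
  have unit : |∫ z, dd v (dd v (dd v F)) (x + s • z) ∂gd d| ≤ e3 / s ^ 3 * B := by
    obtain ⟨C1, hC1⟩ := (hF.dd v).bounded
    obtain ⟨C2, hC2⟩ := ((hF.dd v).dd v).bounded
    obtain ⟨C3, hC3⟩ := (((hF.dd v).dd v).dd v).bounded
    have hc := hF.continuous
    have hc3 := (((hF.dd v).dd v).dd v).continuous
    rw [integral_line_gd hv1 hc3 hC3]
    refine abs_integral_gd_le fun y => ?_
    have := integral_hermite_three
      (F := fun t => F (x + s • (y - ⟪v, y⟫ • v) + (s * t) • v)) (C := B) (C1 := |s| * C1)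
      (C2 := |s| * (|s| * C2)) (C3 := |s| * (|s| * (|s| * C3)))
      (fun t => hasDerivAt_line hF.1 _ v s t)
      (fun t => (hasDerivAt_line (hF.dd v).1 _ v s t).const_mul s)
      (fun t => ((hasDerivAt_line ((hF.dd v).dd v).1 _ v s t).const_mul s).const_mul s)
      (by fun_prop) (fun t => hB _)
      (fun t => by rw [abs_mul]; gcongr; exact hC1 _)
      (fun t => by rw [abs_mul, abs_mul]; gcongr; exact hC2 _)
      (fun t => by rw [abs_mul, abs_mul, abs_mul]; gcongr; exact hC3 _)
    rw [integral_const_mul, integral_const_mul, integral_const_mul] at this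
    have h2 := integral_mul_bdd_le (H := fun t => t ^ 3 - 3 * t)
      ((integrable_pow_g1 3).sub (by simpa using (integrable_pow_g1 1).const_mul 3))
      (F := fun t => F (x + s • (y - ⟪v, y⟫ • v) + (s * t) • v)) (fun t => hB _)
      integral_abs_hermite_three_le
    rw [← this, ← mul_assoc, ← mul_assoc, abs_mul,
      abs_of_pos (mul_pos (mul_pos hs hs) hs)] at h2
    rw [div_mul_eq_mul_div, le_div_iff₀ (by positivity), e3]
    linarith
  rw [huv]
  have e : ∀ y, dd (‖u‖ • v) (dd (‖u‖ • v) (dd (‖u‖ • v) F)) y =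
      ‖u‖ ^ 3 * dd v (dd v (dd v F)) y := by
    clear_value v
    have : ∀ G : Euc d → ℝ, dd (‖u‖ • v) G = fun y => ‖u‖ * dd v G y := by
      intro G; ext y; exact dd_smul_dir _ _ _ _
    intro y
    simp only [this, dd_const_mul]; ring
  simp only [e]
  rw [integral_const_mul, abs_mul, abs_of_nonneg (by positivity), norm_smul, hv1, mul_one,
    norm_norm, mul_comm]
  exact mul_le_mul_of_nonneg_right unit (by positivity)

end Bounds

/-! ### Symmetric forms are bounded by their diagonals, without loss in the constant. -/

section Polarization

/-- In a Hilbert space the parallelogram law makes polarization lossless: for unit vectors `‖a + b‖²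
+ ‖a - b‖² = 4`. -/
lemma abs_bilin_le {T : Euc d → Euc d → ℝ} {δ : ℝ} (hsymm : ∀ a b, T a b = T b a)
    (hadd : ∀ a a' b, T (a + a') b = T a b + T a' b)
    (hsmul : ∀ (r : ℝ) a b, T (r • a) b = r * T a b)
    (hdiag : ∀ a, |T a a| ≤ δ * ‖a‖ ^ 2) (a b : Euc d) : |T a b| ≤ δ * ‖a‖ * ‖b‖ := by
  have hadd' : ∀ a b b', T a (b + b') = T a b + T a b' := fun a b b' => by
    rw [hsymm, hadd, hsymm, hsymm b']
  have hsmul' : ∀ (r : ℝ) a b, T a (r • b) = r * T a b := fun r a b => by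
    rw [hsymm, hsmul, hsymm]
  have hneg : ∀ a b, T a (-b) = - T a b := fun a b => by
    rw [← neg_one_smul ℝ b, hsmul']; ring
  have unit : ∀ a b : Euc d, ‖a‖ = 1 → ‖b‖ = 1 → |T a b| ≤ δ := by
    intro a b ha hb
    have h1 := hdiag (a + b)
    have h2 := hdiag (a - b)
    have e1 : T (a + b) (a + b) = T a a + 2 * T a b + T b b := by
      rw [hadd, hadd', hadd', hsymm b a]; ring
    have e2 : T (a - b) (a - b) = T a a - 2 * T a b + T b b := by
      have hn : ∀ c, T (-b) c = - T b c := fun c => by rw [hsymm, hneg, hsymm]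
      rw [sub_eq_add_neg, hadd, hadd', hadd', hneg, hn, hn, hneg, hsymm b a]; ring
    have par : ‖a + b‖ ^ 2 + ‖a - b‖ ^ 2 = 4 := by
      have := parallelogram_law_with_norm ℝ a b
      rw [ha, hb] at this
      nlinarith
    have : |4 * T a b| ≤ 4 * δ := by
      calc |4 * T a b| = |T (a + b) (a + b) - T (a - b) (a - b)| := by rw [e1, e2]; ring_nf
        _ ≤ |T (a + b) (a + b)| + |T (a - b) (a - b)| := abs_sub _ _
        _ ≤ δ * (‖a + b‖ ^ 2 + ‖a - b‖ ^ 2) := by rw [mul_add]; exact add_le_add h1 h2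
        _ = 4 * δ := by rw [par]; ring
    rw [abs_mul, abs_of_pos (by norm_num : (0 : ℝ) < 4)] at this
    linarith
  have hz : ∀ b, T 0 b = 0 := fun b => by have := hsmul 0 0 b; simpa using this
  rcases eq_or_ne a 0 with rfl | ha
  · simp [hz]
  rcases eq_or_ne b 0 with rfl | hb
  · rw [hsymm]; simp [hz]
  have h := unit (‖a‖⁻¹ • a) (‖b‖⁻¹ • b) (norm_smul_inv_norm ha) (norm_smul_inv_norm hb)
  rw [hsmul, hsmul', abs_mul, abs_mul, abs_inv, abs_inv, abs_norm, abs_norm] at h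
  have hna := norm_pos_iff.2 ha
  have hnb := norm_pos_iff.2 hb
  field_simp at h
  linarith

/-- One step of the polarization of a symmetric form of degree four. -/
lemma abs_quadrilin_step {T : Euc d → Euc d → Euc d → Euc d → ℝ} {δ S : ℝ}
    (h12 : ∀ a b c e, T a b c e = T b a c e) (h23 : ∀ a b c e, T a b c e = T a c b e)
    (h34 : ∀ a b c e, T a b c e = T a b e c)
    (hadd : ∀ a a' b c e, T (a + a') b c e = T a b c e + T a' b c e)
    (hsmul : ∀ (r : ℝ) a b c e, T (r • a) b c e = r * T a b c e)
    (hdiag : ∀ a, |T a a a a| ≤ δ * ‖a‖ ^ 4)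
    (hS : ∀ a b c e, |T a b c e| ≤ S * ‖a‖ * ‖b‖ * ‖c‖ * ‖e‖) (hδS : δ ≤ S) (a b c e : Euc d) :
    |T a b c e| ≤ (δ + S) / 2 * ‖a‖ * ‖b‖ * ‖c‖ * ‖e‖ := by
  have add2 : ∀ a b b' c e, T a (b + b') c e = T a b c e + T a b' c e := fun a b b' c e => by
    rw [h12, hadd, h12, h12 b']
  have add3 : ∀ a b c c' e, T a b (c + c') e = T a b c e + T a b c' e := fun a b c c' e => by
    rw [h23, add2, h23, h23 _ c']
  have add4 : ∀ a b c e e', T a b c (e + e') = T a b c e + T a b c e' := fun a b c e e' => by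
    rw [h34, add3, h34, h34 _ _ e']
  have smul2 : ∀ (r : ℝ) a b c e, T a (r • b) c e = r * T a b c e := fun r a b c e => by
    rw [h12, hsmul, h12]
  have smul3 : ∀ (r : ℝ) a b c e, T a b (r • c) e = r * T a b c e := fun r a b c e => by
    rw [h23, smul2, h23]
  have smul4 : ∀ (r : ℝ) a b c e, T a b c (r • e) = r * T a b c e := fun r a b c e => by
    rw [h34, smul3, h34]
  have neg1 : ∀ a b c e, T (-a) b c e = - T a b c e := fun a b c e => by
    rw [← neg_one_smul ℝ a, hsmul]; ring
  have neg2 : ∀ a b c e, T a (-b) c e = - T a b c e := fun a b c e => by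
    rw [← neg_one_smul ℝ b, smul2]; ring
  have neg3 : ∀ a b c e, T a b (-c) e = - T a b c e := fun a b c e => by
    rw [← neg_one_smul ℝ c, smul3]; ring
  have neg4 : ∀ a b c e, T a b c (-e) = - T a b c e := fun a b c e => by
    rw [← neg_one_smul ℝ e, smul4]; ring
  -- The polarized form of `((a + b)² - (a - b)²)² = 16 a² b²`. Two terms lie on the diagonal, and
  -- the third has the shape of the left side and is bounded by `S`.
  have expand : ∀ a b, 16 * T a a b b = T (a + b) (a + b) (a + b) (a + b) +
      T (a - b) (a - b) (a - b) (a - b) - 2 * T (a + b) (a + b) (a - b) (a - b) := by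
    intro a b
    simp only [sub_eq_add_neg, hadd, add2, add3, add4, neg1, neg2, neg3, neg4]
    have r1 : T a b a b = T a a b b := by rw [h23]
    have r2 : T a b b a = T a a b b := by rw [h34, r1]
    have r3 : T b a a b = T a a b b := by rw [h12, r1]
    have r4 : T b a b a = T a a b b := by rw [h12, r2]
    have r5 : T b b a a = T a a b b := by rw [h23, r4]
    have p1 : T a a b a = T a a a b := by rw [h34]
    have p2 : T a b a a = T a a a b := by rw [h23, p1]
    have p3 : T b a a a = T a a a b := by rw [h12, p2]
    have q1 : T b b a b = T b b b a := by rw [h34]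
    have q2 : T b a b b = T b b b a := by rw [h23, q1]
    have q3 : T a b b b = T b b b a := by rw [h12, q2]
    rw [r1, r2, r3, r4, r5, p1, p2, p3, q1, q2, q3]
    ring
  have unit2 : ∀ a b : Euc d, ‖a‖ = 1 → ‖b‖ = 1 → |T a a b b| ≤ (δ + S) / 2 := by
    intro a b ha hb
    have h1 := hdiag (a + b)
    have h2 := hdiag (a - b)
    have h3 := hS (a + b) (a + b) (a - b) (a - b)
    have par : ‖a + b‖ ^ 2 + ‖a - b‖ ^ 2 = 4 := by
      have := parallelogram_law_with_norm ℝ a b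
      rw [ha, hb] at this
      nlinarith
    set x := ‖a + b‖ ^ 2 with hx
    set y := ‖a - b‖ ^ 2 with hy
    have hx0 : 0 ≤ x := by positivity
    have hy0 : 0 ≤ y := by positivity
    have h1' : |T (a + b) (a + b) (a + b) (a + b)| ≤ δ * x ^ 2 := by rw [hx]; linarith
    have h2' : |T (a - b) (a - b) (a - b) (a - b)| ≤ δ * y ^ 2 := by rw [hy]; linarith
    have h3' : |T (a + b) (a + b) (a - b) (a - b)| ≤ S * x * y := by rw [hx, hy]; linarith
    have key : |16 * T a a b b| ≤ δ * x ^ 2 + δ * y ^ 2 + 2 * (S * x * y) := by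
      rw [expand]
      rw [abs_le] at *
      constructor <;> linarith [h1'.1, h2'.1, h3'.1, h1'.2, h2'.2, h3'.2]
    have hxy : x * y ≤ 4 := by nlinarith [sq_nonneg (x - y)]
    have : δ * x ^ 2 + δ * y ^ 2 + 2 * (S * x * y) ≤ 8 * (δ + S) := by
      have hy' : y = 4 - x := by linarith
      -- As `x + y = 4`, the bound is increasing in `x y` when `δ ≤ S`, and `x y ≤ 4`.
      have : δ * x ^ 2 + δ * y ^ 2 + 2 * (S * x * y) = 16 * δ + 2 * (S - δ) * (x * y) := by
        rw [hy']; ring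
      rw [this]
      nlinarith
    rw [abs_mul, abs_of_pos (by norm_num : (0 : ℝ) < 16)] at key
    linarith
  have z1 : ∀ b c e, T 0 b c e = 0 := fun b c e => by simpa using hsmul 0 0 b c e
  have hom2 : ∀ a b : Euc d, |T a a b b| ≤ (δ + S) / 2 * ‖a‖ ^ 2 * ‖b‖ ^ 2 := by
    intro a b
    rcases eq_or_ne a 0 with rfl | ha
    · simp [z1]
    rcases eq_or_ne b 0 with rfl | hb
    · have : T a a 0 0 = 0 := by simpa using smul3 0 a a 0 0
      simp [this]
    have h := unit2 (‖a‖⁻¹ • a) (‖b‖⁻¹ • b) (norm_smul_inv_norm ha) (norm_smul_inv_norm hb)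
    rw [hsmul, smul2, smul3, smul4] at h
    have hna := norm_pos_iff.2 ha
    have hnb := norm_pos_iff.2 hb
    simp only [abs_mul, abs_inv, abs_norm] at h
    field_simp at h
    linarith
  have step : ∀ a c e, |T a a c e| ≤ (δ + S) / 2 * ‖a‖ ^ 2 * ‖c‖ * ‖e‖ := by
    intro a c e
    exact abs_bilin_le (T := fun c e => T a a c e) (fun c e => h34 _ _ _ _)
      (fun c c' e => add3 _ _ _ _ _) (fun r c e => smul3 _ _ _ _ _) (fun c => hom2 a c) c e
  have := abs_bilin_le (T := fun a b => T a b c e) (δ := (δ + S) / 2 * ‖c‖ * ‖e‖)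
    (fun a b => h12 _ _ _ _) (fun a a' b => hadd _ _ _ _ _) (fun r a b => hsmul _ _ _ _ _)
    (fun a => (step a c e).trans (le_of_eq (by ring))) a b
  exact this.trans (le_of_eq (by ring))

/-- Each polarization step halves the excess of the constant over `δ`, so in the limit any a priori
bound `S` improves to the diagonal one. -/
lemma abs_quadrilin_le {T : Euc d → Euc d → Euc d → Euc d → ℝ} {δ S : ℝ} (hδ : 0 ≤ δ)
    (h12 : ∀ a b c e, T a b c e = T b a c e) (h23 : ∀ a b c e, T a b c e = T a c b e)
    (h34 : ∀ a b c e, T a b c e = T a b e c)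
    (hadd : ∀ a a' b c e, T (a + a') b c e = T a b c e + T a' b c e)
    (hsmul : ∀ (r : ℝ) a b c e, T (r • a) b c e = r * T a b c e)
    (hdiag : ∀ a, |T a a a a| ≤ δ * ‖a‖ ^ 4)
    (hS : ∀ a b c e, |T a b c e| ≤ S * ‖a‖ * ‖b‖ * ‖c‖ * ‖e‖) (a b c e : Euc d) :
    |T a b c e| ≤ δ * ‖a‖ * ‖b‖ * ‖c‖ * ‖e‖ := by
  set S' := max S 0 with hS'
  have hS0 : 0 ≤ S' := le_max_right _ _
  have key : ∀ n : ℕ, ∀ a b c e, |T a b c e| ≤ (δ + S' * (1 / 2) ^ n) * ‖a‖ * ‖b‖ * ‖c‖ * ‖e‖ := by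
    intro n
    induction n with
    | zero =>
      intro a b c e
      refine (hS a b c e).trans ?_
      have : S ≤ δ + S' * (1 / 2) ^ 0 := by
        have := le_max_left S 0
        simp only [pow_zero, mul_one]; linarith
      gcongr
    | succ n ih =>
      intro a b c e
      refine (abs_quadrilin_step h12 h23 h34 hadd hsmul hdiag ih
        (by have : 0 ≤ S' * (1 / 2) ^ n := by positivity
            linarith) a b c e).trans (le_of_eq ?_)
      rw [pow_succ]; ring
  have lim : Tendsto (fun n : ℕ => (δ + S' * (1 / 2) ^ n) * ‖a‖ * ‖b‖ * ‖c‖ * ‖e‖) atTop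
      (𝓝 ((δ + S' * 0) * ‖a‖ * ‖b‖ * ‖c‖ * ‖e‖)) := by
    have := tendsto_pow_atTop_nhds_zero_of_lt_one (r := (1 / 2 : ℝ)) (by norm_num) (by norm_num)
    exact (((((this.const_mul S').const_add δ).mul_const _).mul_const _).mul_const _).mul_const _
  simpa using ge_of_tendsto' lim fun n => key n a b c e

end Polarization

end

end SteinCLT

/-! ### Gaussian averages along the Ornstein-Uhlenbeck interpolation. -/

namespace SteinCLT

noncomputable section

open Filter Topology Set
open scoped NNReal RealInnerProductSpace ContDiff

variable {d : ℕ}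

section Average

variable {Θ : Type*} [MeasurableSpace Θ]

/-- A weighted average of `F` over affine images of the argument. -/
def avg (ρ : Measure Θ) (α : Θ → ℝ) (b : Θ → Euc d) (w : Θ → ℝ) (F : Euc d → ℝ) : Euc d → ℝ :=
  fun x => ∫ p, w p * F (α p • x + b p) ∂ρ

variable {ρ : Measure Θ} [IsFiniteMeasure ρ] {α : Θ → ℝ} {b : Θ → Euc d} {w : Θ → ℝ}

lemma avg_bounded {F : Euc d → ℝ} (hw : ∀ᵐ p ∂ρ, |w p| ≤ 1) {C : ℝ} (hC : ∀ x, |F x| ≤ C)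
    (x : Euc d) : |avg ρ α b w F x| ≤ C * ρ.real univ := by
  rw [← Real.norm_eq_abs]
  refine norm_integral_le_of_norm_le_const (hw.mono fun p hp => ?_)
  rw [norm_mul]
  calc ‖w p‖ * ‖F (α p • x + b p)‖ ≤ 1 * C :=
        mul_le_mul hp (hC _) (norm_nonneg _) zero_le_one
    _ = C := one_mul C

lemma integrable_avg (hαm : Measurable α) (hbm : Measurable b) (hwm : Measurable w)
    (hw : ∀ᵐ p ∂ρ, |w p| ≤ 1) {F : Euc d → ℝ} (hF : Continuous F) {C : ℝ}
    (hC : ∀ x, |F x| ≤ C) (x : Euc d) : Integrable (fun p => w p * F (α p • x + b p)) ρ := by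
  refine Integrable.of_bound (C := C) ?_ (hw.mono fun p hp => ?_)
  · exact (hwm.mul (hF.measurable.comp ((hαm.smul_const x).add hbm))).aestronglyMeasurable
  · rw [norm_mul]
    calc ‖w p‖ * ‖F (α p • x + b p)‖ ≤ 1 * C :=
          mul_le_mul hp (hC _) (norm_nonneg _) zero_le_one
      _ = C := one_mul C

lemma avg_continuous (hαm : Measurable α) (hbm : Measurable b) (hwm : Measurable w)
    (hw : ∀ᵐ p ∂ρ, |w p| ≤ 1) {F : Euc d → ℝ} (hF : SB 0 F) : Continuous (avg ρ α b w F) := by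
  obtain ⟨C, hC⟩ := hF.bounded
  refine continuous_of_dominated (bound := fun _ => C)
    (fun x => (integrable_avg hαm hbm hwm hw hF.continuous hC x).aestronglyMeasurable)
    (fun x => hw.mono fun p hp => ?_) (integrable_const C) (ae_of_all _ fun p => ?_)
  · rw [norm_mul]
    calc ‖w p‖ * ‖F (α p • x + b p)‖ ≤ 1 * C :=
          mul_le_mul hp (hC _) (norm_nonneg _) zero_le_one
      _ = C := one_mul C
  · have := hF.continuous
    fun_prop

/-- Differentiation only multiplies the weight by `α`, which is at most one in absolute value, so
derivatives of averages are averages of the same kind. `U`, `T` and `GA` are all instances, and one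
domination argument serves them all. -/
lemma avg_hasFDerivAt (hαm : Measurable α) (hbm : Measurable b) (hwm : Measurable w)
    (hα : ∀ᵐ p ∂ρ, |α p| ≤ 1) (hw : ∀ᵐ p ∂ρ, |w p| ≤ 1) {F : Euc d → ℝ} (hF : SB 1 F)
    (x : Euc d) : DifferentiableAt ℝ (avg ρ α b w F) x ∧
      ∀ u, dd u (avg ρ α b w F) x = avg ρ α b (fun p => w p * α p) (dd u F) x := by
  obtain ⟨C, hC⟩ := hF.bounded
  obtain ⟨C1, hC10, hC1⟩ := hF.fderiv_bounded
  have hm : Measurable fun p => (w p * α p) • fderiv ℝ F (α p • x + b p) :=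
    (hwm.mul hαm).smul (hF.continuous_fderiv.measurable.comp ((hαm.smul_const x).add hbm))
  have hb : ∀ᵐ p ∂ρ, ∀ y ∈ (univ : Set (Euc d)),
      ‖(w p * α p) • fderiv ℝ F (α p • y + b p)‖ ≤ C1 := by
    filter_upwards [hα, hw] with p h1 h2 y _
    rw [norm_smul, norm_mul]
    calc ‖w p‖ * ‖α p‖ * ‖fderiv ℝ F (α p • y + b p)‖ ≤ 1 * 1 * C1 :=
          mul_le_mul (mul_le_mul h2 h1 (norm_nonneg _) zero_le_one) (hC1 _) (norm_nonneg _)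
            (by norm_num)
      _ = C1 := by ring
  have key := hasFDerivAt_integral_of_dominated_of_fderiv_le (μ := ρ) (𝕜 := ℝ) (x₀ := x)
    (F := fun x p => w p * F (α p • x + b p))
    (F' := fun x p => (w p * α p) • fderiv ℝ F (α p • x + b p)) (bound := fun _ => C1)
    (s := univ) univ_mem
    (Eventually.of_forall fun y =>
      (integrable_avg hαm hbm hwm hw hF.continuous hC y).aestronglyMeasurable)
    (integrable_avg hαm hbm hwm hw hF.continuous hC x) hm.aestronglyMeasurable hb
    (integrable_const C1) (ae_of_all _ fun p y _ => by
      have h1 : HasFDerivAt (fun y : Euc d => α p • y + b p)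
          (α p • ContinuousLinearMap.id ℝ (Euc d)) y :=
        ((hasFDerivAt_id y).const_smul (α p)).add_const (b p)
      refine (((hF.1 (α p • y + b p)).hasFDerivAt.comp y h1).const_mul (w p)).congr_fderiv ?_
      ext u
      simp [mul_assoc])
  refine ⟨key.differentiableAt, fun u => ?_⟩
  change fderiv ℝ (fun x => ∫ p, w p * F (α p • x + b p) ∂ρ) x u = _
  rw [key.fderiv, ContinuousLinearMap.integral_apply]
  · simp [avg, dd]
  · exact Integrable.of_bound hm.aestronglyMeasurable C1 (hb.mono fun p hp => hp x (mem_univ _))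

lemma avg_SB (hαm : Measurable α) (hbm : Measurable b)
    (hα : ∀ᵐ p ∂ρ, |α p| ≤ 1) {n : ℕ} {w : Θ → ℝ} (hwm : Measurable w)
    (hw : ∀ᵐ p ∂ρ, |w p| ≤ 1) {F : Euc d → ℝ} (hF : SB n F) : SB n (avg ρ α b w F) := by
  induction n generalizing F w with
  | zero =>
    obtain ⟨C, hC⟩ := hF.bounded
    exact ⟨avg_continuous hαm hbm hwm hw hF, _, avg_bounded hw hC⟩
  | succ n ih =>
    obtain ⟨C, hC⟩ := hF.bounded
    have h1 : SB 1 F := hF.mono (by omega)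
    refine ⟨fun x => (avg_hasFDerivAt hαm hbm hwm hα hw h1 x).1, ⟨_, avg_bounded hw hC⟩,
      fun u => ?_⟩
    have e : dd u (avg ρ α b w F) = avg ρ α b (fun p => w p * α p) (dd u F) := by
      ext x; exact (avg_hasFDerivAt hαm hbm hwm hα hw h1 x).2 u
    rw [e]
    refine ih (hwm.mul hαm) ?_ (hF.dd u)
    filter_upwards [hα, hw] with p h1 h2
    rw [Pi.mul_apply, abs_mul]
    exact mul_le_one₀ h2 (abs_nonneg _) h1

end Average

/-- The Ornstein-Uhlenbeck average of `F`, in the parametrization by the correlation `c`. -/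
def U (c : ℝ) (F : Euc d → ℝ) : Euc d → ℝ := fun x => ∫ z, F (c • x + √(1 - c ^ 2) • z) ∂gd d

lemma U_eq_avg (c : ℝ) (F : Euc d → ℝ) :
    U c F = avg (gd d) (fun _ => c) (fun z => √(1 - c ^ 2) • z) (fun _ => 1) F := by
  ext x; simp [U, avg]

lemma U_SB {n : ℕ} {c : ℝ} (hc : |c| ≤ 1) {F : Euc d → ℝ} (hF : SB n F) : SB n (U c F) := by
  rw [U_eq_avg]
  exact avg_SB measurable_const (by fun_prop) (ae_of_all _ fun _ => hc) measurable_const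
    (ae_of_all _ fun _ => by simp) hF

lemma U_bounded {c : ℝ} {F : Euc d → ℝ} {C : ℝ} (hC : ∀ x, |F x| ≤ C) (x : Euc d) :
    |U c F x| ≤ C := abs_integral_gd_le fun _ => hC _

lemma U_one (F : Euc d → ℝ) : U 1 F = F := by
  ext x; simp [U]

lemma U_zero (F : Euc d → ℝ) (x : Euc d) : U 0 F x = ∫ z, F z ∂gd d := by
  simp [U]

/-- The semigroup law: the correlations multiply and the variances of the independent noises add up
to `1 - (c a)²`. -/
lemma U_U {a c : ℝ} (ha : |a| ≤ 1) (hc : |c| ≤ 1) {F : Euc d → ℝ} (hF : SB 0 F) (x : Euc d) :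
    U a (U c F) x = U (c * a) F x := by
  obtain ⟨C, hC⟩ := hF.bounded
  have ha2 : a ^ 2 ≤ 1 := by rw [← sq_abs]; exact pow_le_one₀ (abs_nonneg _) ha
  have hc2 : c ^ 2 ≤ 1 := by rw [← sq_abs]; exact pow_le_one₀ (abs_nonneg _) hc
  have hca : (c * a) ^ 2 ≤ 1 := by rw [mul_pow]; exact mul_le_one₀ hc2 (sq_nonneg _) ha2
  set g := √(1 - (c * a) ^ 2) with hg
  have hcont := hF.continuous
  -- Without total noise there is nothing to normalize by. In that case both factors have absolute
  -- value one and no noise enters on either side.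
  rcases (Real.sqrt_nonneg (1 - (c * a) ^ 2)).eq_or_lt with h0 | h0
  · have h1 : (c * a) ^ 2 = 1 := by
      have := (Real.sqrt_eq_zero (by linarith : 0 ≤ 1 - (c * a) ^ 2)).1 h0.symm
      linarith
    have h1' : c ^ 2 * a ^ 2 = 1 := by rw [← mul_pow]; exact h1
    have a1 : a ^ 2 = 1 := by nlinarith [sq_nonneg a, sq_nonneg c]
    have c1 : c ^ 2 = 1 := by nlinarith [sq_nonneg a, sq_nonneg c]
    simp [U, h1, a1, c1, smul_smul]
  · have e : (c * √(1 - a ^ 2) / g) ^ 2 + (√(1 - c ^ 2) / g) ^ 2 = 1 := by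
      rw [div_pow, div_pow, mul_pow, Real.sq_sqrt (by linarith), Real.sq_sqrt (by linarith),
        Real.sq_sqrt (by linarith), ← add_div]
      rw [div_eq_one_iff_eq]
      · ring
      · have := Real.sqrt_pos.1 h0; linarith
    simp only [U]
    rw [integral_add_gd e (F := fun z => F ((c * a) • x + g • z)) (by fun_prop) (fun z => hC _)]
    refine integral_congr_ae (ae_of_all _ fun y => integral_congr_ae (ae_of_all _ fun z => ?_))
    have hg0 : g ≠ 0 := h0.ne'
    simp only [smul_add, smul_smul, mul_div_cancel₀ _ hg0, add_assoc]

/-- The average of `U c F` over `c` in `[a, b]` with the weight `c ^ k`. -/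
def T (k : ℕ) (a b : ℝ) (F : Euc d → ℝ) : Euc d → ℝ :=
  avg ((volume.restrict (Icc a b)).prod (gd d)) (fun p => p.1) (fun p => √(1 - p.1 ^ 2) • p.2)
    (fun p => p.1 ^ k) F

section T

variable {k : ℕ} {a b : ℝ}

lemma ae_Icc_prod (ha : 0 ≤ a) (hb : b ≤ 1) :
    ∀ᵐ p ∂((volume.restrict (Icc a b)).prod (gd d)), 0 ≤ p.1 ∧ p.1 ≤ 1 := by
  have h : ∀ᵐ c ∂(volume.restrict (Icc a b)), 0 ≤ c ∧ c ≤ 1 := by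
    filter_upwards [ae_restrict_mem measurableSet_Icc] with c hc
    exact ⟨ha.trans hc.1, hc.2.trans hb⟩
  exact Measure.quasiMeasurePreserving_fst.ae h

lemma ae_abs_pow_le (ha : 0 ≤ a) (hb : b ≤ 1) (k : ℕ) :
    ∀ᵐ p ∂((volume.restrict (Icc a b)).prod (gd d)), |p.1 ^ k| ≤ 1 := by
  filter_upwards [ae_Icc_prod ha hb] with p hp
  rw [abs_pow, abs_of_nonneg hp.1]
  exact pow_le_one₀ hp.1 hp.2

lemma T_SB {n : ℕ} (ha : 0 ≤ a) (hb : b ≤ 1) {F : Euc d → ℝ} (hF : SB n F) :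
    SB n (T k a b F) :=
  avg_SB measurable_fst (by fun_prop) (by simpa using ae_abs_pow_le ha hb 1) (by fun_prop)
    (ae_abs_pow_le ha hb k) hF

/-- Each derivative that passes inside produces a factor `c` by the chain rule, hence the shift of
the exponent. -/
lemma dd_T (ha : 0 ≤ a) (hb : b ≤ 1) {F : Euc d → ℝ} (hF : SB 1 F) (u : Euc d) :
    dd u (T k a b F) = T (k + 1) a b (dd u F) := by
  ext x
  rw [T, (avg_hasFDerivAt measurable_fst (by fun_prop) (by fun_prop)
    (by simpa using ae_abs_pow_le ha hb 1) (ae_abs_pow_le ha hb k) hF x).2 u]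
  simp [T, avg, pow_succ]

lemma integrable_T (ha : 0 ≤ a) (hb : b ≤ 1) {F : Euc d → ℝ} (hF : SB 0 F) (x : Euc d) :
    Integrable (fun p : ℝ × Euc d => p.1 ^ k * F (p.1 • x + √(1 - p.1 ^ 2) • p.2))
      ((volume.restrict (Icc a b)).prod (gd d)) := by
  obtain ⟨C, hC⟩ := hF.bounded
  exact integrable_avg measurable_fst (by fun_prop) (by fun_prop) (ae_abs_pow_le ha hb k)
    hF.continuous hC x

lemma T_eq_integral (ha : 0 ≤ a) (hb : b ≤ 1) (hab : a ≤ b) {F : Euc d → ℝ} (hF : SB 0 F)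
    (x : Euc d) : T k a b F x = ∫ c in a..b, c ^ k * U c F x := by
  rw [T, avg, integral_prod _ (integrable_T ha hb hF x), intervalIntegral.integral_of_le hab,
    integral_Icc_eq_integral_Ioc]
  simp only [integral_const_mul, U]

lemma continuous_U (hF : SB 0 (F : Euc d → ℝ)) : Continuous fun p : ℝ × Euc d => U p.1 F p.2 := by
  obtain ⟨C, hC⟩ := hF.bounded
  have := hF.continuous
  refine continuous_of_dominated (bound := fun _ => C) (fun p => ?_)
    (fun p => ae_of_all _ fun z => hC _) (integrable_const C) (ae_of_all _ fun z => ?_)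
  · fun_prop
  · fun_prop

lemma T_add_adjacent {m : ℝ} (ha : 0 ≤ a) (hb : b ≤ 1) (ham : a ≤ m) (hmb : m ≤ b)
    {F : Euc d → ℝ} (hF : SB 0 F) (x : Euc d) :
    T k a b F x = T k a m F x + T k m b F x := by
  have hc : Continuous fun c : ℝ => c ^ k * U c F x :=
    (continuous_pow k).mul ((continuous_U hF).comp (by fun_prop : Continuous fun c : ℝ => (c, x)))
  rw [T_eq_integral ha hb (ham.trans hmb) hF, T_eq_integral ha (hmb.trans hb) ham hF,
    T_eq_integral (ha.trans ham) hb hmb hF, intervalIntegral.integral_add_adjacent_intervals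
    (hc.intervalIntegrable _ _) (hc.intervalIntegrable _ _)]

/-- A pointwise bound for `T`, from a bound of `U`. -/
lemma abs_T_le (ha : 0 ≤ a) (hb : b ≤ 1) (hab : a ≤ b) {F : Euc d → ℝ} (hF : SB 0 F)
    {g : ℝ → ℝ} (hg : IntervalIntegrable g volume a b) (x : Euc d)
    (h : ∀ c ∈ Ioo a b, c ^ k * |U c F x| ≤ g c) :
    |T k a b F x| ≤ ∫ c in a..b, g c := by
  rw [T_eq_integral ha hb hab hF, ← Real.norm_eq_abs]
  refine intervalIntegral.norm_integral_le_of_norm_le hab ?_ hg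
  -- The right endpoint is discarded because the kernel bounds used for `g` are singular at `c = 1`.
  have : ∀ᵐ c ∂(volume : Measure ℝ), c ≠ b := by simp [ae_iff]
  filter_upwards [this] with c hcb hc
  rw [norm_mul, norm_pow, Real.norm_of_nonneg (ha.trans hc.1.le)]
  exact h c ⟨hc.1, lt_of_le_of_ne hc.2 hcb⟩

/-- The Ornstein-Uhlenbeck average of `T`. -/
lemma U_T (ha : 0 ≤ a) (hb : b ≤ 1) (hab : a ≤ b) {F : Euc d → ℝ} (hF : SB 0 F) {c : ℝ}
    (hc : |c| ≤ 1) (x : Euc d) :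
    U c (T k a b F) x = ∫ t in a..b, t ^ k * U (t * c) F x := by
  obtain ⟨C, hC⟩ := hF.bounded
  have hcont := continuous_U hF
  simp only [U]
  simp_rw [T_eq_integral ha hb hab hF, intervalIntegral.integral_of_le hab]
  rw [integral_integral_swap]
  · refine setIntegral_congr_fun measurableSet_Ioc fun t ht => ?_
    rw [integral_const_mul]
    congr 1
    have := U_U hc (abs_le.2 ⟨by linarith [ht.1], ht.2.trans hb⟩) hF x
    simpa [U] using this
  · refine Integrable.of_bound (C := C) ?_ ?_
    · have : Continuous fun p : Euc d × ℝ => p.2 ^ k * U p.2 F (c • x + √(1 - c ^ 2) • p.1) :=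
        (by fun_prop : Continuous fun p : Euc d × ℝ => p.2 ^ k).mul
          (hcont.comp (by fun_prop : Continuous fun p : Euc d × ℝ =>
            (p.2, c • x + √(1 - c ^ 2) • p.1)))
      exact this.aestronglyMeasurable
    · have h : ∀ᵐ t ∂(volume.restrict (Ioc a b)), 0 ≤ t ∧ t ≤ 1 := by
        filter_upwards [ae_restrict_mem measurableSet_Ioc] with t ht
        exact ⟨ha.trans ht.1.le, ht.2.trans hb⟩
      filter_upwards [Measure.quasiMeasurePreserving_snd.ae h] with p hp
      rw [Function.uncurry, norm_mul, norm_pow, Real.norm_of_nonneg hp.1]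
      calc p.2 ^ k * ‖U p.2 F (c • x + √(1 - c ^ 2) • p.1)‖ ≤ 1 * C :=
            mul_le_mul (pow_le_one₀ hp.1 hp.2) (U_bounded hC _) (norm_nonneg _) zero_le_one
        _ = C := one_mul C

end T

end

end SteinCLT

/-! ### The derivative of the interpolation in its correlation parameter. -/

namespace SteinCLT

noncomputable section

open Filter Topology Set
open scoped NNReal RealInnerProductSpace ContDiff

variable {d : ℕ}

lemma inner_single_one (i : Fin d) (z : Euc d) :
    ⟪(EuclideanSpace.single i (1 : ℝ) : Euc d), z⟫ = z i := by
  simp [EuclideanSpace.inner_single_left]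

lemma hasDerivAt_sqrt_one_sub_sq {c : ℝ} (hc : c ∈ Ioo (0 : ℝ) 1) :
    HasDerivAt (fun c : ℝ => √(1 - c ^ 2)) (-(c / √(1 - c ^ 2))) c := by
  have h : 0 < 1 - c ^ 2 := by nlinarith [hc.1, hc.2]
  refine (((hasDerivAt_pow 2 c).const_sub 1).sqrt h.ne').congr_deriv ?_
  have := Real.sqrt_pos.2 h
  field_simp
  simp

/-- A derivative in the direction of the noise itself becomes a Laplacian, by Gaussian integration
by parts in each coordinate. -/
lemma integral_dd_self_gd {F : Euc d → ℝ} (hF : SB 2 F) (s : ℝ) (x : Euc d) :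
    ∫ z, dd z F (x + s • z) ∂gd d = s * ∑ i, ∫ z,
      dd (EuclideanSpace.single i 1) (dd (EuclideanSpace.single i 1) F) (x + s • z) ∂gd d := by
  rw [show (fun z => dd z F (x + s • z)) = fun z : Euc d => ∑ i, z i *
    dd (EuclideanSpace.single i 1) F (x + s • z) from funext fun z => dd_eq_sum _ _ _]
  rw [integral_finsetSum, Finset.mul_sum]
  · refine Finset.sum_congr rfl fun i _ => ?_
    rw [← integral_inner_mul_gd (hF.dd _)]
    simp only [inner_single_one]
  · intro i _
    obtain ⟨C, hC⟩ := (hF.dd (EuclideanSpace.single i 1)).bounded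
    have := (hF.dd (EuclideanSpace.single i 1)).continuous
    refine (integrable_norm_gd.mul_const C).mono' (by fun_prop) (ae_of_all _ fun z => ?_)
    rw [norm_mul]
    exact mul_le_mul (PiLp.norm_apply_le z i) (hC _) (norm_nonneg _) (norm_nonneg _)

lemma hasDerivAt_U {F : Euc d → ℝ} (hF : SB 2 F) {c : ℝ} (hc : c ∈ Ioo (0 : ℝ) 1) (x : Euc d) :
    HasDerivAt (fun c => U c F x) (U c (dd x F) x - ∑ i,
      c * U c (dd (EuclideanSpace.single i 1) (dd (EuclideanSpace.single i 1) F)) x) c := by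
  obtain ⟨C, hC⟩ := hF.bounded
  obtain ⟨C1, hC10, hC1⟩ := hF.fderiv_bounded
  have hcont := hF.continuous
  have hcf := hF.continuous_fderiv
  -- Staying below some `r < 1` keeps the factor `t / √(1 - t²)` bounded, as the domination
  -- requires.
  obtain ⟨r, hcr, hr1⟩ := exists_between hc.2
  have hr0 : 0 < r := hc.1.trans hcr
  have hr2 : 0 < 1 - r ^ 2 := by nlinarith
  have hs : Ioo 0 r ∈ 𝓝 c := Ioo_mem_nhds hc.1 hcr
  have hderiv : ∀ z : Euc d, ∀ t ∈ Ioo 0 r,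
      HasDerivAt (fun t : ℝ => F (t • x + √(1 - t ^ 2) • z))
        (fderiv ℝ F (t • x + √(1 - t ^ 2) • z) (x - (t / √(1 - t ^ 2)) • z)) t := by
    intro z t ht
    have h1 : HasDerivAt (fun t : ℝ => t • x + √(1 - t ^ 2) • z)
        (x - (t / √(1 - t ^ 2)) • z) t := by
      have := ((hasDerivAt_id' t).smul_const x).fun_add
        ((hasDerivAt_sqrt_one_sub_sq ⟨ht.1, ht.2.trans hr1⟩).smul_const z)
      simpa [sub_eq_add_neg] using this
    exact (hF.1 _).hasFDerivAt.comp_hasDerivAt t h1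
  have hb : ∀ z : Euc d, ∀ t ∈ Ioo 0 r,
      ‖fderiv ℝ F (t • x + √(1 - t ^ 2) • z) (x - (t / √(1 - t ^ 2)) • z)‖ ≤
        C1 * (‖x‖ + (1 / √(1 - r ^ 2)) * ‖z‖) := by
    intro z t ht
    refine (ContinuousLinearMap.le_opNorm _ _).trans (mul_le_mul (hC1 _) ?_ (norm_nonneg _) hC10)
    refine (norm_sub_le _ _).trans (add_le_add le_rfl ?_)
    rw [norm_smul, Real.norm_of_nonneg (div_nonneg ht.1.le (Real.sqrt_nonneg _))]
    have : √(1 - r ^ 2) ≤ √(1 - t ^ 2) := Real.sqrt_le_sqrt (by nlinarith [ht.1, ht.2])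
    have h0 := Real.sqrt_pos.2 hr2
    gcongr
    linarith [ht.2]
  have key := (hasDerivAt_integral_of_dominated_loc_of_deriv_le (μ := gd d) (x₀ := c)
    (F := fun t z => F (t • x + √(1 - t ^ 2) • z))
    (F' := fun t z => fderiv ℝ F (t • x + √(1 - t ^ 2) • z) (x - (t / √(1 - t ^ 2)) • z))
    (bound := fun z => C1 * (‖x‖ + (1 / √(1 - r ^ 2)) * ‖z‖)) hs
    (Eventually.of_forall fun t => by fun_prop)
    (integrable_bdd_gd hcont hC _ _) (by fun_prop) (ae_of_all _ hb)
    (((integrable_const _).add (integrable_norm_gd.const_mul _)).const_mul _)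
    (ae_of_all _ hderiv)).2
  refine key.congr_deriv ?_
  have hs0 : 0 < √(1 - c ^ 2) := Real.sqrt_pos.2 (by nlinarith [hc.1, hc.2])
  have e : ∀ z, fderiv ℝ F (c • x + √(1 - c ^ 2) • z) (x - (c / √(1 - c ^ 2)) • z) =
      dd x F (c • x + √(1 - c ^ 2) • z) - (c / √(1 - c ^ 2)) * dd z F (c • x + √(1 - c ^ 2) • z) := by
    intro z
    simp [dd]
  simp only [e]
  obtain ⟨D, hD⟩ := (hF.dd x).bounded
  rw [integral_sub (integrable_bdd_gd (hF.dd x).continuous hD _ _), integral_const_mul,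
    integral_dd_self_gd hF, ← mul_assoc, div_mul_cancel₀ _ hs0.ne', ← Finset.mul_sum]
  · rfl
  · refine Integrable.const_mul ?_ _
    refine (integrable_norm_gd.const_mul C1).mono' ?_ (ae_of_all _ fun z => ?_)
    · exact (by simp only [dd]; fun_prop :
        Continuous fun z => dd z F (c • x + √(1 - c ^ 2) • z)).aestronglyMeasurable
    · exact (ContinuousLinearMap.le_opNorm _ _).trans
        (mul_le_mul_of_nonneg_right (hC1 _) (norm_nonneg _))

lemma continuous_U_left {F : Euc d → ℝ} (hF : SB 0 F) (x : Euc d) :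
    Continuous fun c : ℝ => U c F x :=
  (continuous_U hF).comp (by fun_prop : Continuous fun c : ℝ => (c, x))

/-- Integration of the Ornstein-Uhlenbeck generator along the correlation parameter. -/
lemma U_sub_integral_gd {F : Euc d → ℝ} (hF : SB 2 F) {c : ℝ} (h0 : 0 ≤ c) (h1 : c ≤ 1)
    (x : Euc d) : U c F x - ∫ z, F z ∂gd d = T 0 0 c (dd x F) x - ∑ i,
      T 1 0 c (dd (EuclideanSpace.single i 1) (dd (EuclideanSpace.single i 1) F)) x := by
  have hc1 : ∀ t ∈ Ioo 0 c, t ∈ Ioo (0 : ℝ) 1 := fun t ht => ⟨ht.1, ht.2.trans_le h1⟩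
  have i1 := (continuous_U_left (hF.dd x).pred x).intervalIntegrable (μ := volume) 0 c
  have i2 : ∀ i : Fin d, IntervalIntegrable (fun t => t *
      U t (dd (EuclideanSpace.single i 1) (dd (EuclideanSpace.single i 1) F)) x) volume 0 c :=
    fun i => (continuous_id'.mul
      (continuous_U_left ((hF.dd _).dd _) x)).intervalIntegrable _ _
  have i3 : IntervalIntegrable (fun t => ∑ i, t *
      U t (dd (EuclideanSpace.single i 1) (dd (EuclideanSpace.single i 1) F)) x) volume 0 c :=
    (continuous_finsetSum _ fun i _ => continuous_id'.mul
      (continuous_U_left ((hF.dd _).dd _) x)).intervalIntegrable _ _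
  have key := intervalIntegral.integral_eq_sub_of_hasDerivAt_of_le h0
    (continuous_U_left (hF.mono (Nat.zero_le _)) x).continuousOn
    (fun t ht => hasDerivAt_U hF (hc1 t ht) x)
    (i1.sub i3)
  rw [← U_zero F x, ← key, T_eq_integral le_rfl h1 h0 (hF.dd x).pred,
    intervalIntegral.integral_sub i1 i3,
    intervalIntegral.integral_finsetSum fun i _ => i2 i]
  simp_rw [T_eq_integral le_rfl h1 h0 ((hF.dd _).dd _)]
  simp

end

end SteinCLT

/-! ### Integration against vector measures, and a smooth substitute for the norm. -/

namespace SteinCLT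

noncomputable section

open Filter Topology Set
open scoped NNReal RealInnerProductSpace ContDiff

variable {d : ℕ}

section VectorMeasureFacts

variable {Ξ : Type*} [MeasurableSpace Ξ]

/-- A vector measure with values in a Euclidean space has finite variation. -/
instance isFiniteMeasure_variation (μ : VectorMeasure Ξ (Euc d)) :
    IsFiniteMeasure μ.variation := by
  set m : Fin d → SignedMeasure Ξ := fun i =>
    μ.mapRange (EuclideanSpace.proj i : Euc d →L[ℝ] ℝ).toLinearMap.toAddMonoidHom
      (EuclideanSpace.proj i : Euc d →L[ℝ] ℝ).continuous with hm
  have hle : μ.variation ≤ ∑ i, (m i).totalVariation := by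
    refine VectorMeasure.variation_le_of_forall_enorm_le fun E hE => ?_
    calc ‖μ E‖ₑ = ‖∑ i, (μ E) i • (EuclideanSpace.single i (1 : ℝ) : Euc d)‖ₑ := by
          rw [sum_smul_basis]
      _ ≤ ∑ i, ‖(μ E) i • (EuclideanSpace.single i (1 : ℝ) : Euc d)‖ₑ := enorm_sum_le _ _
      _ = ∑ i, ‖m i E‖ₑ := by
          refine Finset.sum_congr rfl fun i _ => ?_
          rw [enorm_smul]
          have : ‖(EuclideanSpace.single i (1 : ℝ) : Euc d)‖ₑ = 1 := by
            rw [← ofReal_norm]; simp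
          rw [this, mul_one]
          rfl
      _ ≤ ∑ i, (m i).totalVariation E := by
          refine Finset.sum_le_sum fun i _ => ?_
          rw [SignedMeasure.totalVariation_eq_variation]
          exact VectorMeasure.enorm_measure_le_variation _ _
      _ = _ := by simp
  have : ∀ i, (m i).totalVariation univ ≠ ⊤ := fun i => measure_ne_top _ _
  refine ⟨(hle univ).trans_lt ?_⟩
  rw [Measure.finsetSum_apply]
  exact ENNReal.sum_lt_top.2 fun i _ => (this i).lt_top

/-- Both sides are continuous in `g` for the `L¹` norm and agree on indicators. The lemma links the
scalar integral of the size-bias identity with the scalar product pairing, in which the final norm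
bound is sharp. -/
lemma integral_smul_innerSL (μ : VectorMeasure Ξ (Euc d)) (e : Euc d) {g : Ξ → ℝ}
    (hg : Integrable g μ.variation) :
    ∫ᵛ ξ, g ξ • e ∂[innerSL ℝ; μ] = ⟪e, ∫ᵛ ξ, g ξ ∂•μ⟫ := by
  refine Integrable.induction (μ := μ.variation)
    (fun g : Ξ → ℝ => ∫ᵛ ξ, g ξ • e ∂[innerSL ℝ; μ] = ⟪e, ∫ᵛ ξ, g ξ ∂•μ⟫) ?_ ?_ ?_ ?_ hg
  · intro c s hs hsf
    have e1 : (fun ξ => s.indicator (fun _ => c) ξ • e) = s.indicator fun _ => c • e := by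
      ext1 ξ
      by_cases h : ξ ∈ s <;> simp [h]
    have h1 : ∫ᵛ ξ, s.indicator (fun _ => c) ξ • e ∂[innerSL ℝ; μ] = ⟪c • e, μ s⟫ := by
      rw [e1]
      exact setToFun_indicator_const _ hs hsf.ne _
    have h2 : ∫ᵛ ξ, s.indicator (fun _ => c) ξ ∂•μ = c • μ s :=
      setToFun_indicator_const _ hs hsf.ne _
    rw [h1, h2, inner_smul_left, inner_smul_right]
    simp
  · intro f g _ hf hg h1 h2
    have hf' : μ.Integrable fun ξ => f ξ • e := hf.smul_const e
    have hg' : μ.Integrable fun ξ => g ξ • e := hg.smul_const e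
    simp only [Pi.add_apply, add_smul]
    rw [VectorMeasure.integral_fun_add hf' hg', VectorMeasure.integral_fun_add hf hg, h1, h2,
      inner_add_right]
  · refine isClosed_eq ?_ ?_
    · rw [continuous_iff_continuousAt]
      intro f
      have m1 : AEStronglyMeasurable (fun ξ => f ξ • e) μ.variation :=
        (Lp.aestronglyMeasurable f).smul_const e
      have m2 : ∀ g : Ξ →₁[μ.variation] ℝ, μ.Integrable fun ξ => g ξ • e :=
        fun g => (L1.integrable_coeFn g).smul_const e
      have m3 : Tendsto (fun g : Ξ →₁[μ.variation] ℝ =>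
          ∫⁻ ξ, ‖g ξ • e - f ξ • e‖ₑ ∂μ.variation) (𝓝 f) (𝓝 0) := by
        have h : ∀ g : Ξ →₁[μ.variation] ℝ, ∫⁻ ξ, ‖g ξ • e - f ξ • e‖ₑ ∂μ.variation =
            edist g f * ‖e‖ₑ := by
          intro g
          rw [L1.edist_def, ← lintegral_mul_const'' _
            ((Lp.aestronglyMeasurable g).aemeasurable.edist
              (Lp.aestronglyMeasurable f).aemeasurable)]
          simp_rw [← sub_smul, enorm_smul, edist_eq_enorm_sub]
        simp_rw [h]
        have h2 : Tendsto (fun g : Ξ →₁[μ.variation] ℝ => edist g f) (𝓝 f) (𝓝 0) := by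
          have := (continuous_id.edist (continuous_const (y := f))).tendsto f
          simpa using this
        simpa using ENNReal.Tendsto.mul_const h2 (Or.inr (enorm_ne_top (x := e)))
      exact VectorMeasure.tendsto_integral_of_L1 _ m1 (Eventually.of_forall m2) m3
    · exact continuous_const.inner VectorMeasure.continuous_integral
  · intro f g hfg _ h
    have h2 : (fun ξ => f ξ • e) =ᵐ[μ.variation] fun ξ => g ξ • e :=
      hfg.mono fun ξ hξ => by simp only [hξ]
    rw [← VectorMeasure.integral_congr_ae hfg, ← VectorMeasure.integral_congr_ae h2, h]

lemma enorm_integral_innerSL_le (μ : VectorMeasure Ξ (Euc d)) (g : Ξ → Euc d) :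
    ‖∫ᵛ ξ, g ξ ∂[innerSL ℝ; μ]‖ₑ ≤ ∫⁻ ξ, ‖g ξ‖ₑ ∂μ.variation := by
  refine VectorMeasure.enorm_integral_le_lintegral_enorm.trans ?_
  calc _ ≤ 1 * ∫⁻ ξ, ‖g ξ‖ₑ ∂μ.variation := by
        gcongr
        rw [← ofReal_norm, ← ENNReal.ofReal_one]
        exact ENNReal.ofReal_le_ofReal (norm_innerSL_le ℝ)
    _ = _ := one_mul _

end VectorMeasureFacts

section JapaneseBracket

/-- The smooth function `x ↦ √(1 + |x|²)`. -/
def bracket (x : Euc d) : ℝ := √(1 + ‖x‖ ^ 2)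

lemma one_le_bracket (x : Euc d) : 1 ≤ bracket x := by
  rw [bracket, Real.one_le_sqrt]
  nlinarith [sq_nonneg ‖x‖]

lemma norm_le_bracket (x : Euc d) : ‖x‖ ≤ bracket x :=
  Real.le_sqrt_of_sq_le (by linarith)

lemma bracket_le (x : Euc d) : bracket x ≤ 1 + ‖x‖ := by
  rw [bracket, Real.sqrt_le_left (by positivity)]
  nlinarith [norm_nonneg x]

lemma contDiff_bracket {n : WithTop ℕ∞} : ContDiff ℝ n (bracket : Euc d → ℝ) :=
  ContDiff.sqrt (contDiff_const.add (contDiff_norm_sq ℝ)) fun x => by positivity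

lemma hasFDerivAt_bracket (x : Euc d) :
    HasFDerivAt bracket ((1 / (2 * bracket x)) • (2 • innerSL ℝ x)) x := by
  have h := ((hasStrictFDerivAt_norm_sq x).hasFDerivAt.const_add 1).sqrt
    (by positivity : (1 + ‖x‖ ^ 2 : ℝ) ≠ 0)
  exact h

lemma norm_fderiv_bracket_le (x : Euc d) : ‖fderiv ℝ bracket x‖ ≤ 1 := by
  have h0 : 0 < bracket x := zero_lt_one.trans_le (one_le_bracket x)
  rw [(hasFDerivAt_bracket x).fderiv]
  refine ContinuousLinearMap.opNorm_le_bound _ zero_le_one fun y => ?_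
  have : ((1 / (2 * bracket x)) • (2 • innerSL ℝ x)) y = ⟪x, y⟫ / bracket x := by
    simp
    field_simp
  rw [this, norm_div, Real.norm_of_nonneg h0.le, one_mul, div_le_iff₀ h0, mul_comm]
  exact (norm_inner_le_norm x y).trans
    (mul_le_mul_of_nonneg_right (norm_le_bracket x) (norm_nonneg y))

end JapaneseBracket

end

end SteinCLT

/-! ### First moments of the family `V`, and the size-bias identity under linear growth. -/

namespace SteinCLT

noncomputable section

open Filter Topology Set
open scoped NNReal RealInnerProductSpace

variable {d : ℕ}

lemma gradient_sub_inner {φ : Euc d → ℝ} {x : Euc d} (h : DifferentiableAt ℝ φ x) (m : Euc d) :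
    gradient (fun x => φ x - ⟪m, x⟫) x = gradient φ x - m := by
  refine ext_inner_right ℝ fun u => ?_
  have h1 : HasFDerivAt (fun x => φ x - ⟪m, x⟫) (fderiv ℝ φ x - innerSL ℝ m) x :=
    h.hasFDerivAt.sub (innerSL ℝ m).hasFDerivAt
  rw [← dd_eq_inner_gradient, inner_sub_left, ← dd_eq_inner_gradient, dd, h1.fderiv]
  simp [dd]

lemma enorm_le_of_forall_abs_inner_le {y : Euc d} {r : ℝ≥0∞}
    (h : ∀ w : Euc d, ‖w‖ = 1 → ENNReal.ofReal |⟪y, w⟫| ≤ r) : ‖y‖ₑ ≤ r := by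
  rcases eq_or_ne y 0 with rfl | hy
  · simp
  have := h (‖y‖⁻¹ • y) (norm_smul_inv_norm hy)
  rw [inner_smul_right, real_inner_self_eq_norm_sq, pow_two, inv_mul_cancel_left₀
    (norm_ne_zero_iff.2 hy), abs_norm, ofReal_norm] at this
  exact this

section Setting

set_option linter.unusedSectionVars false

variable {Ω : Type*} [MeasurableSpace Ω] {P : Measure Ω} [IsProbabilityMeasure P]
  {W : Ω → Euc d} {Ξ : Type*} [MeasurableSpace Ξ]
  {Ω' : Ξ → Type*} [∀ ξ, MeasurableSpace (Ω' ξ)]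
  {Q : ∀ ξ, Measure (Ω' ξ)} [∀ ξ, IsProbabilityMeasure (Q ξ)]
  {V : ∀ ξ, Ω' ξ → Euc d}
  {μ : VectorMeasure Ξ (Euc d)} {ν : Ξ → VectorMeasure Ξ (Euc d)}

lemma stronglyMeasurable_integral_family (hV : MeasurableFamily Q V) {φ : Euc d → ℝ}
    (hφ : Continuous φ) : StronglyMeasurable fun ξ => ∫ ω, φ (V ξ ω) ∂(Q ξ) := by
  let κ : Kernel Ξ (Euc d) := ⟨fun ξ => (Q ξ).map (V ξ), by
    refine Measure.measurable_of_measurable_coe _ fun A hA => ?_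
    simp_rw [Measure.map_apply (hV.measurable _) hA]
    exact hV.measurable_law A hA⟩
  have h := hφ.stronglyMeasurable.integral_kernel (κ := κ)
  convert h using 1
  ext ξ
  exact (integral_map (hV.measurable ξ).aemeasurable hφ.aestronglyMeasurable).symm

lemma integrable_norm_sq (hSt : Standardized P W) : Integrable (fun ω => ‖W ω‖ ^ 2) P :=
  hSt.memLp.integrable_norm_pow (by norm_num)

lemma integrable_W (hSt : Standardized P W) : Integrable W P :=
  hSt.memLp.integrable (by norm_num)

lemma integrable_growth_mul (hW : Measurable W) (hSt : Standardized P W) {φ ψ : Euc d → ℝ}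
    (hφ : Continuous φ) (hψ : Continuous ψ) {C D : ℝ} (hC : ∀ x, |φ x| ≤ C * (1 + ‖x‖))
    (hD : ∀ x, |ψ x| ≤ D * (1 + ‖x‖)) : Integrable (fun ω => φ (W ω) * ψ (W ω)) P := by
  have hC0 : 0 ≤ C := by simpa using (abs_nonneg _).trans (hC 0)
  have hD0 : 0 ≤ D := by simpa using (abs_nonneg _).trans (hD 0)
  have hi : Integrable (fun ω => C * D * (2 + 2 * ‖W ω‖ ^ 2)) P :=
    ((integrable_const _).add ((integrable_norm_sq hSt).const_mul 2)).const_mul _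
  refine hi.mono' ((hφ.mul hψ).measurable.comp hW).aestronglyMeasurable (ae_of_all _ fun ω => ?_)
  rw [norm_mul]
  have hw := norm_nonneg (W ω)
  calc ‖φ (W ω)‖ * ‖ψ (W ω)‖ ≤ (C * (1 + ‖W ω‖)) * (D * (1 + ‖W ω‖)) :=
        mul_le_mul (hC _) (hD _) (norm_nonneg _) (by positivity)
    _ = C * D * (1 + ‖W ω‖) ^ 2 := by ring
    _ ≤ _ := by
        refine mul_le_mul_of_nonneg_left ?_ (by positivity)
        nlinarith [sq_nonneg (1 - ‖W ω‖)]

lemma integrable_growth (hW : Measurable W) (hSt : Standardized P W) {φ : Euc d → ℝ}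
    (hφ : Continuous φ) {C : ℝ} (hC : ∀ x, |φ x| ≤ C * (1 + ‖x‖)) :
    Integrable (fun ω => φ (W ω)) P := by
  simpa using integrable_growth_mul hW hSt hφ continuous_const (ψ := fun _ => 1) (D := 1) hC
    (fun x => by simp)

lemma integrable_bdd_W (hW : Measurable W) {φ : Euc d → ℝ}
    (hφ : Continuous φ) {C : ℝ} (hC : ∀ x, |φ x| ≤ C) :
    Integrable (fun ω => φ (W ω)) P :=
  Integrable.of_bound (hφ.measurable.comp hW).aestronglyMeasurable C (ae_of_all _ fun _ => hC _)

lemma integrable_growth_family (hV : MeasurableFamily Q V) (hPx : Proximity P W Q V ν)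
    {φ : Euc d → ℝ} (hφ : Continuous φ) {C : ℝ} (hC : ∀ x, |φ x| ≤ C * (1 + ‖x‖)) (ξ : Ξ) :
    Integrable (fun ω => φ (V ξ ω)) (Q ξ) := by
  have hi : Integrable (fun ω => C * (1 + ‖V ξ ω‖)) (Q ξ) :=
    ((integrable_const _).add (hPx.integrable_family ξ).norm).const_mul _
  exact hi.mono' (hφ.measurable.comp (hV.measurable ξ)).aestronglyMeasurable
    (ae_of_all _ fun ω => hC _)

lemma integral_apply_mul_apply (hSt : Standardized P W) (i j : Fin d) :
    ∫ ω, W ω i * W ω j ∂P = if i = j then 1 else 0 := by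
  have hm : ∀ i : Fin d, ∫ ω, W ω i ∂P = 0 := by
    intro i
    have := (EuclideanSpace.proj i : Euc d →L[ℝ] ℝ).integral_comp_comm (integrable_W hSt)
    rw [hSt.mean] at this
    simpa using this
  have hc := hSt.cov i j
  rw [covariance, hm, hm] at hc
  simpa using hc

lemma integral_inner_mul_apply (hW : Measurable W) (hSt : Standardized P W) (m : Euc d)
    (i : Fin d) : ∫ ω, ⟪m, W ω⟫ * W ω i ∂P = m i := by
  have e : ∀ ω, ⟪m, W ω⟫ * W ω i = ∑ j, m j * (W ω j * W ω i) := by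
    intro ω
    rw [PiLp.inner_apply, Finset.sum_mul]
    refine Finset.sum_congr rfl fun j _ => ?_
    simp
    ring
  simp_rw [e]
  rw [integral_finsetSum]
  · simp_rw [integral_const_mul, integral_apply_mul_apply hSt]
    simp
  · intro j _
    refine Integrable.const_mul ?_ _
    refine integrable_growth_mul hW hSt (φ := fun x => x j) (ψ := fun x => x i) (by fun_prop)
      (by fun_prop) (C := 1) (D := 1) (fun x => ?_) (fun x => ?_)
    · have := PiLp.norm_apply_le x j; rw [Real.norm_eq_abs] at this; linarith
    · have := PiLp.norm_apply_le x i; rw [Real.norm_eq_abs] at this; linarith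

/-- The size-bias identity for the constant function one. It is what allows constants to be
subtracted under `μ`. -/
lemma apply_univ_eq_zero (hSt : Standardized P W) (hS : SizeBias P W Q V μ) : μ univ = 0 := by
  have h := hS.identity (fun _ => 1) measurable_const ⟨1, by simp⟩
  simp [hSt.mean] at h
  exact h.symm

lemma enorm_sub_le_lintegral (hPx : Proximity P W Q V ν) {f : Euc d → ℝ} (hf : ContDiff ℝ 1 f)
    (hb : ∃ C, ∀ x, ‖fderiv ℝ f x‖ ≤ C) (ξ : Ξ) :
    ‖∫ ω, f (W ω) ∂P - ∫ ω, f (V ξ ω) ∂(Q ξ)‖ₑ ≤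
      ∫⁻ η, ‖∫ ω, gradient f (V η ω) ∂(Q η)‖ₑ ∂(ν ξ).variation := by
  rw [hPx.identity ξ f hf hb]
  exact enorm_integral_innerSL_le _ _

/-- `bracket` dominates the norm and is an admissible function in the proximity identity, with
gradient at most one. -/
lemma integral_norm_family_le (hV : MeasurableFamily Q V)
    (hPx : Proximity P W Q V ν) (ξ : Ξ) :
    ENNReal.ofReal (∫ ω, ‖V ξ ω‖ ∂(Q ξ)) ≤
      ENNReal.ofReal (∫ ω, bracket (W ω) ∂P) + betaXi1 ν ξ := by
  have h := enorm_sub_le_lintegral hPx (f := bracket) contDiff_bracket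
    ⟨1, norm_fderiv_bracket_le⟩ ξ
  have h2 : ∫⁻ η, ‖∫ ω, gradient bracket (V η ω) ∂(Q η)‖ₑ ∂(ν ξ).variation ≤ betaXi1 ν ξ := by
    rw [betaXi1, ← lintegral_one]
    refine lintegral_mono fun η => ?_
    rw [← ofReal_norm, ← ENNReal.ofReal_one]
    refine ENNReal.ofReal_le_ofReal ?_
    have := norm_integral_le_of_norm_le_const (μ := Q η) (f := fun ω => gradient bracket (V η ω))
      (C := 1) (ae_of_all _ fun ω => by rw [norm_gradient]; exact norm_fderiv_bracket_le _)
    simpa using this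
  have h3 : ∫ ω, ‖V ξ ω‖ ∂(Q ξ) ≤ ∫ ω, bracket (V ξ ω) ∂(Q ξ) := by
    refine integral_mono (hPx.integrable_family ξ).norm
      (integrable_growth_family hV hPx (contDiff_bracket (n := 0)).continuous (C := 1)
        (fun x => ?_) ξ) fun ω => norm_le_bracket _
    rw [abs_of_nonneg (zero_le_one.trans (one_le_bracket x)), one_mul]
    exact bracket_le x
  calc ENNReal.ofReal (∫ ω, ‖V ξ ω‖ ∂(Q ξ)) ≤ ENNReal.ofReal (∫ ω, bracket (W ω) ∂P +
        |∫ ω, bracket (W ω) ∂P - ∫ ω, bracket (V ξ ω) ∂(Q ξ)|) := by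
        refine ENNReal.ofReal_le_ofReal (h3.trans ?_)
        have := neg_abs_le (∫ ω, bracket (W ω) ∂P - ∫ ω, bracket (V ξ ω) ∂(Q ξ))
        linarith
    _ = ENNReal.ofReal (∫ ω, bracket (W ω) ∂P) +
        ‖∫ ω, bracket (W ω) ∂P - ∫ ω, bracket (V ξ ω) ∂(Q ξ)‖ₑ := by
        rw [ENNReal.ofReal_add (integral_nonneg fun ω =>
          zero_le_one.trans (one_le_bracket _)) (abs_nonneg _), Real.enorm_eq_ofReal_abs]
    _ ≤ _ := by gcongr; exact h.trans h2

/-- Here the finiteness of `β_2` enters, together with that of the total variation of `μ`. -/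
lemma integrable_integral_norm_family (hV : MeasurableFamily Q V) (hPx : Proximity P W Q V ν)
    (hβ : beta2 μ ν < ⊤) : Integrable (fun ξ => ∫ ω, ‖V ξ ω‖ ∂(Q ξ)) μ.variation := by
  refine ⟨(stronglyMeasurable_integral_family hV continuous_norm).aestronglyMeasurable, ?_⟩
  rw [HasFiniteIntegral]
  calc ∫⁻ ξ, ‖∫ ω, ‖V ξ ω‖ ∂(Q ξ)‖ₑ ∂μ.variation
      ≤ ∫⁻ ξ, (ENNReal.ofReal (∫ ω, bracket (W ω) ∂P) + betaXi1 ν ξ) ∂μ.variation := by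
        refine lintegral_mono fun ξ => ?_
        rw [Real.enorm_of_nonneg (integral_nonneg fun ω => norm_nonneg _)]
        exact integral_norm_family_le hV hPx ξ
    _ = ENNReal.ofReal (∫ ω, bracket (W ω) ∂P) * μ.variation univ + beta2 μ ν := by
        rw [lintegral_add_left measurable_const, lintegral_const, beta2]
    _ < ⊤ := ENNReal.add_lt_top.2 ⟨ENNReal.mul_lt_top ENNReal.ofReal_lt_top (measure_lt_top _ _), hβ⟩

lemma integrable_integral_family (hV : MeasurableFamily Q V) (hPx : Proximity P W Q V ν)
    (hβ : beta2 μ ν < ⊤) {φ : Euc d → ℝ} (hφ : Continuous φ) {C : ℝ}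
    (hC : ∀ x, |φ x| ≤ C * (1 + ‖x‖)) :
    Integrable (fun ξ => ∫ ω, φ (V ξ ω) ∂(Q ξ)) μ.variation := by
  have hi : Integrable (fun ξ => C * (1 + ∫ ω, ‖V ξ ω‖ ∂(Q ξ))) μ.variation :=
    ((integrable_const _).add (integrable_integral_norm_family hV hPx hβ)).const_mul _
  refine hi.mono' (stronglyMeasurable_integral_family hV hφ).aestronglyMeasurable
    (ae_of_all _ fun ξ => ?_)
  calc ‖∫ ω, φ (V ξ ω) ∂(Q ξ)‖ ≤ ∫ ω, C * (1 + ‖V ξ ω‖) ∂(Q ξ) :=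
        norm_integral_le_of_norm_le
          (((integrable_const _).add (hPx.integrable_family ξ).norm).const_mul _)
          (ae_of_all _ fun ω => hC _)
    _ = _ := by
        rw [integral_const_mul, integral_add (integrable_const _) (hPx.integrable_family ξ).norm]
        simp

/-- The truncation of `t` at the level `n`. -/
def clamp (n : ℕ) (t : ℝ) : ℝ := max (-(n : ℝ)) (min n t)

lemma continuous_clamp (n : ℕ) : Continuous (clamp n) := by unfold clamp; fun_prop

lemma abs_clamp_le (n : ℕ) (t : ℝ) : |clamp n t| ≤ |t| := by
  have hn : (0 : ℝ) ≤ n := Nat.cast_nonneg n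
  unfold clamp
  rcases abs_cases t with h | h <;> rw [abs_le] <;> constructor <;>
    simp only [le_max_iff, max_le_iff, le_min_iff, min_le_iff] <;>
    grind

lemma abs_clamp_le' (n : ℕ) (t : ℝ) : |clamp n t| ≤ n := by
  have hn : (0 : ℝ) ≤ n := Nat.cast_nonneg n
  unfold clamp
  rw [abs_le]
  exact ⟨le_max_left _ _, max_le (by linarith) (min_le_left _ _)⟩

lemma tendsto_clamp (t : ℝ) : Tendsto (fun n => clamp n t) atTop (𝓝 t) := by
  refine tendsto_const_nhds.congr' ?_
  filter_upwards [eventually_ge_atTop ⌈|t|⌉₊] with n hn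
  have h : |t| ≤ n := (Nat.le_ceil _).trans (by exact_mod_cast hn)
  rw [abs_le] at h
  rw [clamp, min_eq_right h.2, max_eq_right h.1]

/-- The size-bias identity for functions of linear growth. -/
lemma sizeBias_growth (hW : Measurable W) (hSt : Standardized P W) (hV : MeasurableFamily Q V)
    (hS : SizeBias P W Q V μ) (hPx : Proximity P W Q V ν) (hβ : beta2 μ ν < ⊤)
    {φ : Euc d → ℝ} (hφ : Continuous φ) {C : ℝ} (hC : ∀ x, |φ x| ≤ C * (1 + ‖x‖)) :
    ∫ ω, φ (W ω) • W ω ∂P = ∫ᵛ ξ, (∫ ω, φ (V ξ ω) ∂(Q ξ)) ∂•μ := by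
  have hcl : ∀ n x, |clamp n (φ x)| ≤ C * (1 + ‖x‖) := fun n x => (abs_clamp_le _ _).trans (hC x)
  have hcc : ∀ n, Continuous fun x => clamp n (φ x) := fun n => (continuous_clamp n).comp hφ
  have h1 : Tendsto (fun n => ∫ ω, clamp n (φ (W ω)) • W ω ∂P) atTop
      (𝓝 (∫ ω, φ (W ω) • W ω ∂P)) := by
    refine tendsto_integral_of_dominated_convergence (fun ω => (C * (1 + ‖W ω‖)) * ‖W ω‖)
      (fun n => ?_) ?_ (fun n => ae_of_all _ fun ω => ?_)
      (ae_of_all _ fun ω => (tendsto_clamp _).smul_const _)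
    · exact (((hcc n).measurable.comp hW).smul hW).aestronglyMeasurable
    · refine integrable_growth_mul hW hSt (φ := fun x => C * (1 + ‖x‖)) (ψ := fun x => ‖x‖)
        (by fun_prop) (by fun_prop) (C := |C|) (D := 1) (fun x => ?_) (fun x => ?_)
      · rw [abs_mul, abs_of_nonneg (by positivity : 0 ≤ 1 + ‖x‖)]
      · rw [abs_norm]; linarith [norm_nonneg x]
    · rw [norm_smul]
      exact mul_le_mul_of_nonneg_right (hcl n _) (norm_nonneg _)
  have h2 : Tendsto (fun n => ∫ᵛ ξ, (∫ ω, clamp n (φ (V ξ ω)) ∂(Q ξ)) ∂•μ) atTop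
      (𝓝 (∫ᵛ ξ, (∫ ω, φ (V ξ ω) ∂(Q ξ)) ∂•μ)) := by
    refine VectorMeasure.tendsto_integral_of_dominated_convergence
      (fun ξ => C * (1 + ∫ ω, ‖V ξ ω‖ ∂(Q ξ))) (fun n => ?_) ?_ (fun n => ae_of_all _ fun ξ => ?_)
      (ae_of_all _ fun ξ => ?_)
    · exact (stronglyMeasurable_integral_family hV (hcc n)).aestronglyMeasurable
    · exact ((integrable_const _).add (integrable_integral_norm_family hV hPx hβ)).const_mul _
    · calc ‖∫ ω, clamp n (φ (V ξ ω)) ∂(Q ξ)‖ ≤ ∫ ω, C * (1 + ‖V ξ ω‖) ∂(Q ξ) :=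
            norm_integral_le_of_norm_le
              (((integrable_const _).add (hPx.integrable_family ξ).norm).const_mul _)
              (ae_of_all _ fun ω => hcl n _)
        _ = _ := by
            rw [integral_const_mul, integral_add (integrable_const _)
              (hPx.integrable_family ξ).norm]
            simp
    · refine tendsto_integral_of_dominated_convergence (fun ω => C * (1 + ‖V ξ ω‖))
        (fun n => ((hcc n).measurable.comp (hV.measurable ξ)).aestronglyMeasurable)
        (((integrable_const _).add (hPx.integrable_family ξ).norm).const_mul _)
        (fun n => ae_of_all _ fun ω => hcl n _) (ae_of_all _ fun ω => tendsto_clamp _)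
  refine tendsto_nhds_unique h1 (h2.congr fun n => ?_)
  exact (hS.identity (fun x => clamp n (φ x)) (hcc n).measurable
    ⟨n, fun x => abs_clamp_le' n _⟩).symm

end Setting

end

end SteinCLT

/-! ### The Stein identity and the resulting double integral bound. -/

namespace SteinCLT

noncomputable section

open Filter Topology Set
open scoped NNReal RealInnerProductSpace

variable {d : ℕ}

lemma T_sum {ι : Type*} (s : Finset ι) {k : ℕ} {a b : ℝ} (ha : 0 ≤ a) (hb : b ≤ 1) (r : ι → ℝ)
    {F : ι → Euc d → ℝ} (hF : ∀ i, SB 0 (F i)) (x : Euc d) :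
    T k a b (fun y => ∑ i ∈ s, r i * F i y) x = ∑ i ∈ s, r i * T k a b (F i) x := by
  simp only [T, avg, Finset.mul_sum]
  rw [integral_finsetSum]
  · refine Finset.sum_congr rfl fun i _ => ?_
    rw [← integral_const_mul]
    congr 1
    ext p
    ring
  · intro i _
    refine ((integrable_T (k := k) ha hb (hF i) x).const_mul (r i)).congr (ae_of_all _ fun p => ?_)
    simp only
    ring

lemma dd_sum {ι : Type*} (s : Finset ι) (r : ι → ℝ) {F : ι → Euc d → ℝ}
    (hF : ∀ i, Differentiable ℝ (F i)) (u : Euc d) (x : Euc d) :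
    dd u (fun y => ∑ i ∈ s, r i * F i y) x = ∑ i ∈ s, r i * dd u (F i) x := by
  have h : HasFDerivAt (fun y => ∑ i ∈ s, r i * F i y) (∑ i ∈ s, r i • fderiv ℝ (F i) x) x :=
    HasFDerivAt.fun_sum fun i _ => ((hF i x).hasFDerivAt.const_mul (r i))
  rw [dd, h.fderiv]
  simp [dd]

section Setting

set_option linter.unusedSectionVars false

variable {Ω : Type*} [MeasurableSpace Ω] {P : Measure Ω} [IsProbabilityMeasure P]
  {W : Ω → Euc d} {Ξ : Type*} [MeasurableSpace Ξ]
  {Ω' : Ξ → Type*} [∀ ξ, MeasurableSpace (Ω' ξ)]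
  {Q : ∀ ξ, Measure (Ω' ξ)} [∀ ξ, IsProbabilityMeasure (Q ξ)]
  {V : ∀ ξ, Ω' ξ → Euc d}
  {μ : VectorMeasure Ξ (Euc d)} {ν : Ξ → VectorMeasure Ξ (Euc d)}

/-- Stein's method: the error of the normal approximation of a smoothed test function is bounded
by a double integral over the size-bias and the proximity measures. -/
theorem enorm_integral_U_sub_le (hW : Measurable W) (hSt : Standardized P W)
    (hV : MeasurableFamily Q V) (hS : SizeBias P W Q V μ) (hPx : Proximity P W Q V ν)
    (hβ : beta2 μ ν < ⊤) {h : Euc d → ℝ} (hh : SB 2 h) {c : ℝ} (hc0 : 0 ≤ c) (hc1 : c ≤ 1)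
    {Ψ : Ξ → ℝ≥0∞} (hΨ : ∀ η u w, ENNReal.ofReal |∫ ω, T 1 0 c (dd w (dd u h)) (W ω) ∂P -
      ∫ ω, T 1 0 c (dd w (dd u h)) (V η ω) ∂(Q η)| ≤ Ψ η * ‖u‖ₑ * ‖w‖ₑ) :
    ‖∫ ω, U c h (W ω) ∂P - ∫ z, h z ∂gd d‖ₑ ≤
      ∫⁻ ξ, ∫⁻ η, Ψ η ∂(ν ξ).variation ∂μ.variation := by
  set e : Fin d → Euc d := fun i => EuclideanSpace.single i (1 : ℝ) with he
  -- The family is linear in the direction `u`. Coordinates carry the identities, whereas general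
  -- unit vectors `u` give estimates free of the dimension.
  set φ : Euc d → Euc d → ℝ := fun u => T 0 0 c (dd u h) with hφ
  have hφS : ∀ u, SB 1 (φ u) := fun u => T_SB le_rfl hc1 (hh.dd u)
  have hφd : ∀ u w, dd w (φ u) = T 1 0 c (dd w (dd u h)) := fun u w =>
    dd_T le_rfl hc1 (hh.dd u) w
  have hφl : ∀ u x, φ u x = ∑ i, u i * φ (e i) x := by
    intro u x
    rw [hφ]
    simp only
    rw [← T_sum Finset.univ le_rfl hc1 (fun i => u i) (fun i => (hh.dd (e i)).pred)]
    congr 1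
    ext y
    exact dd_eq_sum u h y
  have hφdl : ∀ u w x, dd w (φ u) x = ∑ i, u i * dd w (φ (e i)) x := by
    intro u w x
    rw [← dd_sum Finset.univ (fun i => u i) (fun i => (hφS (e i)).differentiable)]
    congr 1
    ext y
    exact hφl u y
  set m : Euc d → Euc d := fun u => ∫ ω, gradient (φ u) (W ω) ∂P with hm
  have hgi : ∀ u, Integrable (fun ω => gradient (φ u) (W ω)) P := by
    intro u
    obtain ⟨C, -, hC⟩ := (hφS u).fderiv_bounded
    exact Integrable.of_bound ((hφS u).continuous_gradient.measurable.comp hW).aestronglyMeasurable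
      C (ae_of_all _ fun ω => by rw [norm_gradient]; exact hC _)
  have hgiV : ∀ u η, Integrable (fun ω => gradient (φ u) (V η ω)) (Q η) := by
    intro u η
    obtain ⟨C, -, hC⟩ := (hφS u).fderiv_bounded
    exact Integrable.of_bound
      ((hφS u).continuous_gradient.measurable.comp (hV.measurable η)).aestronglyMeasurable
      C (ae_of_all _ fun ω => by rw [norm_gradient]; exact hC _)
  have hmi : ∀ u x, ⟪m u, x⟫ = ∫ ω, dd x (φ u) (W ω) ∂P := by
    intro u x
    rw [hm, real_inner_comm, ← integral_inner (hgi u)]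
    simp_rw [dd_eq_inner_gradient, real_inner_comm]
  have hml : ∀ u x, ⟪m u, x⟫ = ∑ i, u i * ⟪m (e i), x⟫ := by
    intro u x
    simp_rw [hmi, ← integral_const_mul]
    rw [← integral_finsetSum]
    · simp_rw [hφdl u x]
    · intro i _
      obtain ⟨C, hC⟩ := ((hφS (e i)).dd x).bounded
      exact (integrable_bdd_W hW ((hφS (e i)).dd x).continuous hC).const_mul _
  -- The gradient of `g u` is centred under `W`, so its mean at `V η` is exactly the discrepancy
  -- controlled by `Ψ`. The removed linear part, tested against `W`, reproduces the mean of the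
  -- derivative of `φ` because the covariance is the identity.
  set g : Euc d → Euc d → ℝ := fun u x => φ u x - ⟪m u, x⟫ with hg
  have hgl : ∀ u x, g u x = ∑ i, u i * g (e i) x := by
    intro u x
    simp only [hg]
    rw [hφl, hml]
    simp_rw [mul_sub]
    rw [Finset.sum_sub_distrib]
  have hgc : ∀ u, Continuous (g u) := fun u => (hφS u).continuous.sub (by fun_prop)
  have hgb : ∀ u, ∃ C, ∀ x, |g u x| ≤ C * (1 + ‖x‖) := by
    intro u
    obtain ⟨C, hC⟩ := (hφS u).bounded
    refine ⟨C + ‖m u‖, fun x => ?_⟩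
    have hC0 : 0 ≤ C := (abs_nonneg _).trans (hC 0)
    have h1 : |⟪m u, x⟫| ≤ ‖m u‖ * ‖x‖ := norm_inner_le_norm (𝕜 := ℝ) _ _
    calc |g u x| ≤ |φ u x| + |⟪m u, x⟫| := abs_sub _ _
      _ ≤ C + ‖m u‖ * ‖x‖ := add_le_add (hC x) h1
      _ ≤ _ := by nlinarith [norm_nonneg x, norm_nonneg (m u), mul_nonneg hC0 (norm_nonneg x)]
  have hgg : ∀ u x, gradient (g u) x = gradient (φ u) x - m u := fun u x =>
    gradient_sub_inner ((hφS u).differentiable x) (m u)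
  -- Centring at the mean under `W` is free since `μ` has total mass zero, and it brings the
  -- expression into the form of the proximity identity.
  set q : Euc d → Ξ → ℝ := fun u ξ => ∫ ω, g u (V ξ ω) ∂(Q ξ) - ∫ ω, g u (W ω) ∂P with hq
  have hql : ∀ u ξ, q u ξ = ∑ i, u i * q (e i) ξ := by
    intro u ξ
    simp only [hq]
    simp_rw [hgl u, mul_sub]
    rw [integral_finsetSum, integral_finsetSum, Finset.sum_sub_distrib]
    · simp_rw [integral_const_mul]
    · intro i _
      obtain ⟨C, hC⟩ := hgb (e i)
      exact (integrable_growth hW hSt (hgc _) hC).const_mul _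
    · intro i _
      obtain ⟨C, hC⟩ := hgb (e i)
      exact (integrable_growth_family hV hPx (hgc _) hC ξ).const_mul _
  have hqb : ∀ u ξ, ‖u‖ = 1 → ‖q u ξ‖ₑ ≤ ∫⁻ η, Ψ η ∂(ν ξ).variation := by
    intro u ξ hu
    have hu' : ‖u‖ₑ = 1 := by rw [← ofReal_norm, hu, ENNReal.ofReal_one]
    have hcd : ContDiff ℝ 1 (g u) :=
      (hφS u).contDiff_one.sub (contDiff_const.inner ℝ contDiff_id)
    obtain ⟨C, -, hC⟩ := (hφS u).fderiv_bounded
    have hfb : ∃ C, ∀ x, ‖fderiv ℝ (g u) x‖ ≤ C := by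
      refine ⟨C + ‖m u‖, fun x => ?_⟩
      rw [← norm_gradient, hgg]
      refine (norm_sub_le _ _).trans ?_
      rw [norm_gradient]
      exact add_le_add (hC x) le_rfl
    have := enorm_sub_le_lintegral hPx hcd hfb ξ
    rw [hq]
    simp only
    rw [enorm_sub_rev]
    refine this.trans (lintegral_mono fun η => ?_)
    refine enorm_le_of_forall_abs_inner_le fun w hw => ?_
    have hw' : ‖w‖ₑ = 1 := by rw [← ofReal_norm, hw, ENNReal.ofReal_one]
    have h1 : ⟪∫ ω, gradient (g u) (V η ω) ∂(Q η), w⟫ =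
        ∫ ω, T 1 0 c (dd w (dd u h)) (V η ω) ∂(Q η) -
          ∫ ω, T 1 0 c (dd w (dd u h)) (W ω) ∂P := by
      simp_rw [hgg]
      rw [integral_sub (hgiV u η) (integrable_const _), inner_sub_left]
      congr 1
      · rw [real_inner_comm, ← integral_inner (hgiV u η), ← hφd]
        simp_rw [dd_eq_inner_gradient, real_inner_comm]
      · simp only [integral_const, probReal_univ, one_smul]
        rw [hmi, hφd]
    rw [h1, abs_sub_comm]
    simpa [hu', hw'] using hΨ η u w
  -- Collecting the coordinates in one vector gives a bound by the Euclidean norm, rather than by a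
  -- sum over `d` coordinates.
  set qv : Ξ → Euc d := fun ξ => ∑ i, q (e i) ξ • e i with hqv
  have hqvi : ∀ ξ u, ⟪qv ξ, u⟫ = q u ξ := by
    intro ξ u
    rw [hqv, hql u]
    simp only [sum_inner, inner_smul_left, he, inner_single_one, conj_trivial, mul_comm]
  have hqvb : ∀ ξ, ‖qv ξ‖ₑ ≤ ∫⁻ η, Ψ η ∂(ν ξ).variation := by
    intro ξ
    refine enorm_le_of_forall_abs_inner_le fun w hw => ?_
    rw [hqvi, ← Real.enorm_eq_ofReal_abs]
    exact hqb w ξ hw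
  have hqi : ∀ i, Integrable (q (e i)) μ.variation := by
    intro i
    obtain ⟨C, hC⟩ := hgb (e i)
    exact (integrable_integral_family hV hPx hβ (hgc _) hC).sub (integrable_const _)
  have hmain : ∫ ω, U c h (W ω) ∂P - ∫ z, h z ∂gd d = ∫ᵛ ξ, qv ξ ∂[innerSL ℝ; μ] := by
    have h1 : ∀ i, ∫ᵛ ξ, q (e i) ξ • e i ∂[innerSL ℝ; μ] =
        ∫ ω, (W ω i * φ (e i) (W ω) - dd (e i) (φ (e i)) (W ω)) ∂P := by
      intro i
      obtain ⟨C, hC⟩ := hgb (e i)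
      obtain ⟨C1, hC1⟩ := (hφS (e i)).bounded
      obtain ⟨C2, hC2⟩ := ((hφS (e i)).dd (e i)).bounded
      rw [integral_smul_innerSL μ _ (hqi i)]
      -- The size-bias identity is read from right to left, the constant in `q` being annihilated by
      -- `μ`.
      have h2 : ∫ᵛ ξ, q (e i) ξ ∂•μ = ∫ ω, g (e i) (W ω) • W ω ∂P := by
        have hi1 : μ.Integrable fun ξ => ∫ ω, g (e i) (V ξ ω) ∂(Q ξ) :=
          integrable_integral_family hV hPx hβ (hgc _) hC
        have hi2 : μ.Integrable fun _ : Ξ => ∫ ω, g (e i) (W ω) ∂P := integrable_const _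
        rw [hq]
        simp only
        rw [VectorMeasure.integral_fun_sub hi1 hi2, sizeBias_growth hW hSt hV hS hPx hβ (hgc _) hC,
          VectorMeasure.integral_const, apply_univ_eq_zero hSt hS]
        simp
      have hx : ∀ x : Euc d, |x i| ≤ 1 * (1 + ‖x‖) := fun x => by
        have := PiLp.norm_apply_le x i; rw [Real.norm_eq_abs] at this; linarith
      have hgW : Integrable (fun ω => g (e i) (W ω) • W ω) P := by
        refine (integrable_growth_mul hW hSt (φ := fun x => g (e i) x) (ψ := fun x => ‖x‖)
          (hgc _) (by fun_prop) (D := 1) hC (fun x => ?_)).mono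
          (((hgc _).measurable.comp hW).smul hW).aestronglyMeasurable
          (ae_of_all _ fun ω => ?_)
        · rw [abs_norm]; linarith [norm_nonneg x]
        · rw [norm_smul, norm_mul, norm_norm]
      rw [h2, ← integral_inner hgW]
      have h3 : ∀ ω, ⟪e i, g (e i) (W ω) • W ω⟫ =
          W ω i * φ (e i) (W ω) - ⟪m (e i), W ω⟫ * W ω i := by
        intro ω
        rw [inner_smul_right, he]
        simp only [inner_single_one, hg]
        ring
      simp_rw [h3]
      have hB : ∀ x, |φ (e i) x| ≤ C1 * (1 + ‖x‖) := fun x => by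
        have := hC1 x
        have h0 : 0 ≤ C1 := (abs_nonneg _).trans this
        nlinarith [norm_nonneg x, mul_nonneg h0 (norm_nonneg x)]
      have j1 : Integrable (fun ω => W ω i * φ (e i) (W ω)) P :=
        integrable_growth_mul hW hSt (φ := fun x => x i) (by fun_prop) (hφS (e i)).continuous hx hB
      have j2 : Integrable (fun ω => ⟪m (e i), W ω⟫ * W ω i) P :=
        integrable_growth_mul hW hSt (φ := fun x => ⟪m (e i), x⟫) (ψ := fun x => x i)
          (by fun_prop) (by fun_prop) (C := ‖m (e i)‖) (fun x => by
            have : |⟪m (e i), x⟫| ≤ ‖m (e i)‖ * ‖x‖ := norm_inner_le_norm (𝕜 := ℝ) _ _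
            nlinarith [norm_nonneg (m (e i))]) hx
      rw [integral_sub j1 j2, integral_sub j1 (integrable_bdd_W hW
        ((hφS (e i)).dd (e i)).continuous hC2), integral_inner_mul_apply hW hSt, ← hmi]
      rw [real_inner_comm, he]
      simp only [inner_single_one]
    have h4 : ∫ᵛ ξ, qv ξ ∂[innerSL ℝ; μ] = ∑ i, ∫ᵛ ξ, q (e i) ξ • e i ∂[innerSL ℝ; μ] := by
      rw [hqv]
      exact VectorMeasure.integral_finsetSum _ fun i _ => (hqi i).smul_const (e i)
    rw [h4]
    simp_rw [h1]
    obtain ⟨C, hC⟩ := hh.bounded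
    have hU : Integrable (fun ω => U c h (W ω)) P :=
      integrable_bdd_W hW (U_SB (abs_le.2 ⟨by linarith, hc1⟩) hh).continuous (U_bounded hC)
    rw [← integral_finsetSum]
    · have : ∫ z, h z ∂gd d = ∫ _ω, (∫ z, h z ∂gd d) ∂P := by simp
      rw [this, ← integral_sub hU (integrable_const _)]
      refine integral_congr_ae (ae_of_all _ fun ω => ?_)
      simp only
      rw [U_sub_integral_gd hh hc0 hc1, Finset.sum_sub_distrib]
      congr 1
      · exact hφl (W ω) (W ω)
      · refine Finset.sum_congr rfl fun i _ => ?_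
        rw [hφd]
    · intro i _
      obtain ⟨C1, hC1⟩ := (hφS (e i)).bounded
      obtain ⟨C2, hC2⟩ := ((hφS (e i)).dd (e i)).bounded
      refine Integrable.sub ?_ (integrable_bdd_W hW ((hφS (e i)).dd (e i)).continuous hC2)
      refine integrable_growth_mul hW hSt (φ := fun x => x i) (C := 1) (D := C1) (by fun_prop)
        (hφS (e i)).continuous (fun x => ?_) (fun x => ?_)
      · have := PiLp.norm_apply_le x i; rw [Real.norm_eq_abs] at this; linarith
      · have := hC1 x
        have h0 : 0 ≤ C1 := (abs_nonneg _).trans this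
        nlinarith [norm_nonneg x, mul_nonneg h0 (norm_nonneg x)]
  rw [hmain]
  exact (enorm_integral_innerSL_le _ _).trans (lintegral_mono hqvb)

/-- Proximity for functions with bounded gradient. -/
lemma proximity_one (hV : MeasurableFamily Q V) (hPx : Proximity P W Q V ν) {φ : Euc d → ℝ}
    (hφ : SB 1 φ) {K : ℝ≥0∞} (hK : ∀ x u, ENNReal.ofReal |dd u φ x| ≤ K * ‖u‖ₑ) (η : Ξ) :
    ENNReal.ofReal |∫ ω, φ (W ω) ∂P - ∫ ω, φ (V η ω) ∂(Q η)| ≤ K * betaXi1 ν η := by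
  obtain ⟨C, -, hC⟩ := hφ.fderiv_bounded
  have h := enorm_sub_le_lintegral hPx hφ.contDiff_one ⟨C, hC⟩ η
  rw [Real.enorm_eq_ofReal_abs] at h
  refine h.trans ?_
  rw [betaXi1, ← lintegral_const]
  refine lintegral_mono fun ζ => ?_
  refine enorm_le_of_forall_abs_inner_le fun w hw => ?_
  have hw' : ‖w‖ₑ = 1 := by rw [← ofReal_norm, hw, ENNReal.ofReal_one]
  have hi : Integrable (fun ω => gradient φ (V ζ ω)) (Q ζ) :=
    Integrable.of_bound (hφ.continuous_gradient.measurable.comp (hV.measurable ζ)).aestronglyMeasurable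
      C (ae_of_all _ fun ω => by rw [norm_gradient]; exact hC _)
  rw [real_inner_comm, ← integral_inner hi, ← Real.enorm_eq_ofReal_abs]
  refine (enorm_integral_le_lintegral_enorm _).trans ?_
  calc _ ≤ ∫⁻ _ω, K ∂(Q ζ) := by
        refine lintegral_mono fun ω => ?_
        simp only
        rw [real_inner_comm, ← dd_eq_inner_gradient, Real.enorm_eq_ofReal_abs]
        simpa [hw'] using hK (V ζ ω) w
    _ = K := by simp

/-- Proximity for functions whose gradient has a controlled mean, and a bounded Hessian. -/
lemma proximity_two (hV : MeasurableFamily Q V) (hPx : Proximity P W Q V ν)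
    {φ : Euc d → ℝ} (hφ : SB 2 φ) {L K : ℝ≥0∞} (hKt : K ≠ ⊤)
    (hL : ∀ u, ENNReal.ofReal |∫ ω, dd u φ (W ω) ∂P| ≤ L * ‖u‖ₑ)
    (hK : ∀ x u w, ENNReal.ofReal |dd w (dd u φ) x| ≤ K * ‖u‖ₑ * ‖w‖ₑ) (η : Ξ) :
    ENNReal.ofReal |∫ ω, φ (W ω) ∂P - ∫ ω, φ (V η ω) ∂(Q η)| ≤
      L * betaXi1 ν η + K * betaXi2 ν η := by
  obtain ⟨C, -, hC⟩ := hφ.fderiv_bounded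
  have h := enorm_sub_le_lintegral hPx hφ.contDiff_one ⟨C, hC⟩ η
  rw [Real.enorm_eq_ofReal_abs] at h
  refine h.trans ?_
  rw [betaXi1, betaXi2, ← lintegral_const]
  rw [← lintegral_const_mul' _ _ hKt, ← lintegral_add_left measurable_const]
  refine lintegral_mono fun ζ => ?_
  refine enorm_le_of_forall_abs_inner_le fun w hw => ?_
  have hw' : ‖w‖ₑ = 1 := by rw [← ofReal_norm, hw, ENNReal.ofReal_one]
  have hi : Integrable (fun ω => gradient φ (V ζ ω)) (Q ζ) :=
    Integrable.of_bound (hφ.continuous_gradient.measurable.comp (hV.measurable ζ)).aestronglyMeasurable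
      C (ae_of_all _ fun ω => by rw [norm_gradient]; exact hC _)
  have e1 : ⟪∫ ω, gradient φ (V ζ ω) ∂(Q ζ), w⟫ = ∫ ω, dd w φ (V ζ ω) ∂(Q ζ) := by
    rw [real_inner_comm, ← integral_inner hi]
    simp_rw [dd_eq_inner_gradient, real_inner_comm]
  have h1 := hL w
  -- The mean gradient at `V ζ` is compared with the one at `W` by a second use of proximity. The
  -- first contributes `L`, the difference contributes `K` times `β_1^{(ζ)}`.
  have h2 := proximity_one hV hPx (hφ.dd w) (K := K) (fun x u => by
    have := hK x w u
    rwa [hw', mul_one] at this) ζ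
  rw [hw', mul_one] at h1
  rw [e1]
  calc ENNReal.ofReal |∫ ω, dd w φ (V ζ ω) ∂(Q ζ)|
      ≤ ENNReal.ofReal (|∫ ω, dd w φ (W ω) ∂P| +
          |∫ ω, dd w φ (W ω) ∂P - ∫ ω, dd w φ (V ζ ω) ∂(Q ζ)|) := by
        refine ENNReal.ofReal_le_ofReal ?_
        have := abs_sub_abs_le_abs_sub (∫ ω, dd w φ (V ζ ω) ∂(Q ζ)) (∫ ω, dd w φ (W ω) ∂P)
        rw [abs_sub_comm] at this
        linarith
    _ ≤ _ := by
        rw [ENNReal.ofReal_add (abs_nonneg _) (abs_nonneg _)]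
        exact add_le_add h1 h2

end Setting

end

end SteinCLT

/-! ### Gaussian convolutions of high derivatives of Lipschitz test functions. -/

namespace SteinCLT

noncomputable section

open Filter Topology Set
open scoped NNReal RealInnerProductSpace ContDiff

variable {d : ℕ}

/-- Smooth functions with compact support. -/
def IsTest (f : Euc d → ℝ) : Prop := ContDiff ℝ ∞ f ∧ HasCompactSupport f

lemma IsTest.SB {f : Euc d → ℝ} (hf : IsTest f) (n : ℕ) : SB n f := .of_compactSupport hf.1 hf.2 n

lemma IsTest.dd {f : Euc d → ℝ} (hf : IsTest f) (u : Euc d) : IsTest (dd u f) :=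
  ⟨contDiff_dd hf.1 u, hasCompactSupport_dd hf.2 u⟩

lemma IsTest.comm {f : Euc d → ℝ} (hf : IsTest f) (u v : Euc d) :
    SteinCLT.dd u (SteinCLT.dd v f) = SteinCLT.dd v (SteinCLT.dd u f) := dd_comm hf.1 u v

/-- Convolution with a centred Gaussian distribution. -/
def GA (s : ℝ) (F : Euc d → ℝ) : Euc d → ℝ := fun x => ∫ z, F (x + s • z) ∂gd d

lemma GA_eq_avg (s : ℝ) (F : Euc d → ℝ) :
    GA s F = avg (gd d) (fun _ => 1) (fun z => s • z) (fun _ => 1) F := by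
  ext x; simp [GA, avg]

lemma GA_SB {n : ℕ} {s : ℝ} {F : Euc d → ℝ} (hF : SB n F) : SB n (GA s F) := by
  rw [GA_eq_avg]
  exact avg_SB measurable_const (by fun_prop) (ae_of_all _ fun _ => by simp) measurable_const
    (ae_of_all _ fun _ => by simp) hF

lemma dd_GA {s : ℝ} {F : Euc d → ℝ} (hF : SB 1 F) (u : Euc d) :
    dd u (GA s F) = GA s (dd u F) := by
  ext x
  rw [GA_eq_avg, (avg_hasFDerivAt measurable_const (by fun_prop) measurable_const
    (ae_of_all _ fun _ => by simp) (ae_of_all _ fun _ => by simp) hF x).2 u, GA_eq_avg]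
  simp

lemma U_eq_GA (c : ℝ) (F : Euc d → ℝ) (x : Euc d) : U c F x = GA (√(1 - c ^ 2)) F (c • x) := rfl

lemma GA_add {s : ℝ} {F G : Euc d → ℝ} (hF : SB 0 F) (hG : SB 0 G) (x : Euc d) :
    GA s (fun y => F y + G y) x = GA s F x + GA s G x := by
  obtain ⟨C, hC⟩ := hF.bounded
  obtain ⟨D, hD⟩ := hG.bounded
  exact integral_add (integrable_bdd_gd hF.continuous hC s x)
    (integrable_bdd_gd hG.continuous hD s x)

lemma GA_const_mul (s r : ℝ) (F : Euc d → ℝ) (x : Euc d) :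
    GA s (fun y => r * F y) x = r * GA s F x := integral_const_mul _ _

lemma GA_GA {s t r : ℝ} (h : s ^ 2 + t ^ 2 = r ^ 2) {F : Euc d → ℝ} (hF : SB 0 F)
    (x : Euc d) : GA s (GA t F) x = GA r F x := by
  obtain ⟨C, hC⟩ := hF.bounded
  have hc := hF.continuous
  rcases eq_or_ne r 0 with rfl | hr
  · have hs : s = 0 := by nlinarith [sq_nonneg s, sq_nonneg t]
    have ht : t = 0 := by nlinarith [sq_nonneg s, sq_nonneg t]
    simp [GA, hs, ht]
  · have e : (s / r) ^ 2 + (t / r) ^ 2 = 1 := by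
      rw [div_pow, div_pow, ← add_div, h, div_self (pow_ne_zero 2 hr)]
    simp only [GA]
    rw [integral_add_gd e (F := fun z => F (x + r • z)) (by fun_prop) (fun z => hC _)]
    simp only [smul_add, smul_smul, mul_div_cancel₀ _ hr, add_assoc]

lemma IsTest.dd_add_dir {f : Euc d → ℝ} (u v : Euc d) :
    SteinCLT.dd (u + v) f = fun x => SteinCLT.dd u f x + SteinCLT.dd v f x := by
  ext x; exact SteinCLT.dd_add_dir u v f x

lemma IsTest.dd_smul_dir {f : Euc d → ℝ} (r : ℝ) (u : Euc d) :
    SteinCLT.dd (r • u) f = fun x => r * SteinCLT.dd u f x := by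
  ext x; exact SteinCLT.dd_smul_dir r u f x

section Bounds

variable {s : ℝ} {f : Euc d → ℝ}

lemma abs_GA_dd_dd_le (hf : IsTest f) {B : ℝ} (hB : ∀ x, |f x| ≤ B) (hs : 0 < s)
    (u v x : Euc d) : |GA s (dd u (dd v f)) x| ≤ e2 / s ^ 2 * B * ‖u‖ * ‖v‖ := by
  refine abs_bilin_le (T := fun u v => GA s (dd u (dd v f)) x) (fun a b => by rw [hf.comm])
    (fun a a' b => ?_) (fun r a b => ?_) (fun a => ?_) u v
  · rw [IsTest.dd_add_dir, GA_add (((hf.dd b).dd a).SB 0) (((hf.dd b).dd a').SB 0)]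
  · rw [IsTest.dd_smul_dir, GA_const_mul]
  · exact abs_integral_dd_two_le (hf.SB 2) hB hs a x

/-- Two derivatives can be absorbed by half of the Gaussian noise. -/
lemma abs_GA_dd_dd_le_of_GA (hf : IsTest f) {B : ℝ} (hs : 0 < s) (hB : ∀ x, |GA s f x| ≤ B)
    (u v x : Euc d) : |GA (√2 * s) (dd u (dd v f)) x| ≤ e2 / s ^ 2 * B * ‖u‖ * ‖v‖ := by
  have e : s ^ 2 + s ^ 2 = (√2 * s) ^ 2 := by
    rw [mul_pow, Real.sq_sqrt (by norm_num)]; ring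
  refine abs_bilin_le (T := fun u v => GA (√2 * s) (dd u (dd v f)) x)
    (fun a b => by rw [hf.comm]) (fun a a' b => ?_) (fun r a b => ?_) (fun a => ?_) u v
  · rw [IsTest.dd_add_dir, GA_add (((hf.dd b).dd a).SB 0) (((hf.dd b).dd a').SB 0)]
  · rw [IsTest.dd_smul_dir, GA_const_mul]
  · rw [← GA_GA e (((hf.dd a).dd a).SB 0), ← dd_GA ((hf.dd a).SB 1), ← dd_GA (hf.SB 1)]
    exact abs_integral_dd_two_le (GA_SB (hf.SB 2)) hB hs a x

variable {M : ℝ}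

section Lipschitz

variable (hf : IsTest f) (hM0 : 0 ≤ M) (hM : ∀ x u, |dd u f x| ≤ M * ‖u‖) (hs : 0 < s)
include hf hM hs

lemma abs_GA_two_le (u v x : Euc d) :
    |GA s (dd u (dd v f)) x| ≤ M * (e1 / s) * ‖u‖ * ‖v‖ :=
  (abs_integral_dd_le ((hf.dd v).SB 1) (fun x => hM x v) hs u x).trans (le_of_eq (by ring))

lemma abs_GA_three_le (u v w x : Euc d) :
    |GA s (dd u (dd v (dd w f))) x| ≤ M * (e2 / s ^ 2) * ‖u‖ * ‖v‖ * ‖w‖ :=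
  (abs_GA_dd_dd_le (hf.dd w) (fun x => hM x w) hs u v x).trans (le_of_eq (by ring))

include hM0

/-- On the diagonal, three derivatives go to the kernel and the fourth is borne by the Lipschitz
function. Polarization keeps the constant `e3`. The a priori constant `S` comes from splitting the
noise into two halves. -/
lemma abs_GA_four_le (a b c e x : Euc d) :
    |GA s (dd a (dd b (dd c (dd e f)))) x| ≤ M * (e3 / s ^ 3) * ‖a‖ * ‖b‖ * ‖c‖ * ‖e‖ := by
  have hs2 : 0 < s / √2 := by positivity
  have e0 : √2 * (s / √2) = s := mul_div_cancel₀ _ (by positivity)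
  refine abs_quadrilin_le (T := fun a b c e => GA s (dd a (dd b (dd c (dd e f)))) x)
    (S := e2 / (s / √2) ^ 2 * (M * (e1 / (s / √2)))) ?_
    (fun a b c e => by rw [((hf.dd e).dd c).comm]) (fun a b c e => by rw [(hf.dd e).comm])
    (fun a b c e => by rw [hf.comm]) (fun a a' b c e => ?_) (fun r a b c e => ?_) (fun a => ?_)
    (fun a b c e => ?_) a b c e
  · unfold e3; positivity
  · rw [IsTest.dd_add_dir, GA_add ((((hf.dd e).dd c).dd b).dd a |>.SB 0)
      ((((hf.dd e).dd c).dd b).dd a' |>.SB 0)]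
  · rw [IsTest.dd_smul_dir, GA_const_mul]
  · exact (abs_integral_dd_three_le ((hf.dd a).SB 3) (fun x => hM x a) hs a x).trans
      (le_of_eq (by ring))
  · have := abs_GA_dd_dd_le_of_GA ((hf.dd e).dd c) hs2 (abs_GA_two_le hf hM hs2 c e) a b x
    rw [e0] at this
    exact this.trans (le_of_eq (by ring))

/-- Each half of the noise, of variance `s² / 2`, absorbs two derivatives at the price `2 e2 / s²`,
and `(2 · 0.968)²` is about `3.748`. -/
lemma abs_GA_five_le (a b c e u x : Euc d) :
    |GA s (dd a (dd b (dd c (dd e (dd u f))))) x| ≤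
      M * (3.75 / s ^ 4) * ‖a‖ * ‖b‖ * ‖c‖ * ‖e‖ * ‖u‖ := by
  have hs2 : 0 < s / √2 := by positivity
  have e0 : √2 * (s / √2) = s := mul_div_cancel₀ _ (by positivity)
  have h := abs_GA_dd_dd_le_of_GA (((hf.dd u).dd e).dd c) hs2 (abs_GA_three_le hf hM hs2 c e u)
    a b x
  rw [e0] at h
  have e1 : (s / √2) ^ 2 = s ^ 2 / 2 := by rw [div_pow, Real.sq_sqrt (by norm_num)]
  have e2' : e2 / (s / √2) ^ 2 * (e2 / (s / √2) ^ 2) = 3.748096 / s ^ 4 := by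
    rw [e1, e2]; field_simp; norm_num
  calc _ ≤ _ := h
    _ = M * (e2 / (s / √2) ^ 2 * (e2 / (s / √2) ^ 2)) * ‖a‖ * ‖b‖ * ‖c‖ * ‖e‖ * ‖u‖ := by ring
    _ ≤ _ := by
      rw [e2']
      gcongr
      norm_num

/-- One half of the noise absorbs two derivatives and the other three: `2 · 0.968 · 2√2 · 1.8` is
about `9.86`. -/
lemma abs_GA_six_le (a b c e u v x : Euc d) :
    |GA s (dd a (dd b (dd c (dd e (dd u (dd v f)))))) x| ≤
      M * (9.9 / s ^ 5) * ‖a‖ * ‖b‖ * ‖c‖ * ‖e‖ * ‖u‖ * ‖v‖ := by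
  have hs2 : 0 < s / √2 := by positivity
  have e0 : √2 * (s / √2) = s := mul_div_cancel₀ _ (by positivity)
  have h := abs_GA_dd_dd_le_of_GA ((((hf.dd v).dd u).dd e).dd c) hs2
    (abs_GA_four_le hf hM0 hM hs2 c e u v) a b x
  rw [e0] at h
  have hr : √2 ^ 2 = (2 : ℝ) := Real.sq_sqrt (by norm_num)
  have e2' : e2 / (s / √2) ^ 2 * (e3 / (s / √2) ^ 3) = 6.9696 * √2 / s ^ 5 := by
    rw [e2, e3]
    have h5 : √2 ^ 5 = (4 : ℝ) * √2 := by
      rw [show √2 ^ 5 = (√2 ^ 2) ^ 2 * √2 by ring, hr]; norm_num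
    have : (0.968 : ℝ) / (s / √2) ^ 2 * (1.8 / (s / √2) ^ 3) = 0.968 * 1.8 * √2 ^ 5 / s ^ 5 := by
      field_simp
    rw [this, h5]; ring
  calc _ ≤ _ := h
    _ = M * (e2 / (s / √2) ^ 2 * (e3 / (s / √2) ^ 3)) * ‖a‖ * ‖b‖ * ‖c‖ * ‖e‖ * ‖u‖ * ‖v‖ := by
      ring
    _ ≤ _ := by
      rw [e2']
      have : √2 ≤ (1.42 : ℝ) := by rw [Real.sqrt_le_left (by norm_num)]; norm_num
      gcongr
      linarith

end Lipschitz

end Bounds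

end

end SteinCLT

/-! ### Elementary integrals over the correlation parameter. -/

namespace SteinCLT

noncomputable section

open Filter Topology Set
open scoped NNReal RealInnerProductSpace

variable {d : ℕ}

lemma one_sub_sq_pos {c : ℝ} (h0 : 0 ≤ c) (h1 : c < 1) : 0 < 1 - c ^ 2 := by nlinarith

section Calculus

variable {a b : ℝ}

lemma integral_div_sqrt (ha : 0 ≤ a) (hab : a ≤ b) (hb : b < 1) :
    IntervalIntegrable (fun c => c / √(1 - c ^ 2)) volume a b ∧
    ∫ c in a..b, c / √(1 - c ^ 2) = √(1 - a ^ 2) - √(1 - b ^ 2) := by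
  have hs : ∀ c ∈ uIcc a b, 0 < 1 - c ^ 2 := by
    intro c hc
    rw [uIcc_of_le hab] at hc
    exact one_sub_sq_pos (ha.trans hc.1) (hc.2.trans_lt hb)
  have hi : IntervalIntegrable (fun c => c / √(1 - c ^ 2)) volume a b := by
    refine ContinuousOn.intervalIntegrable fun c hc => ?_
    have := (Real.sqrt_pos.2 (hs c hc)).ne'
    exact (by fun_prop (disch := assumption) : ContinuousAt _ c).continuousWithinAt
  refine ⟨hi, ?_⟩
  rw [intervalIntegral.integral_eq_sub_of_hasDerivAt (f := fun c => -√(1 - c ^ 2)) _ hi]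
  · ring
  · intro c hc
    have h := hs c hc
    refine (((hasDerivAt_pow 2 c).const_sub 1).sqrt h.ne').neg.congr_deriv ?_
    have := Real.sqrt_pos.2 h
    field_simp
    simp

lemma integral_div_sqrt_cube (ha : 0 ≤ a) (hab : a ≤ b) (hb : b < 1) :
    IntervalIntegrable (fun c => c / √(1 - c ^ 2) ^ 3) volume a b ∧
    ∫ c in a..b, c / √(1 - c ^ 2) ^ 3 = 1 / √(1 - b ^ 2) - 1 / √(1 - a ^ 2) := by
  have hs : ∀ c ∈ uIcc a b, 0 < 1 - c ^ 2 := by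
    intro c hc
    rw [uIcc_of_le hab] at hc
    exact one_sub_sq_pos (ha.trans hc.1) (hc.2.trans_lt hb)
  have hi : IntervalIntegrable (fun c => c / √(1 - c ^ 2) ^ 3) volume a b := by
    refine ContinuousOn.intervalIntegrable fun c hc => ?_
    have := (pow_pos (Real.sqrt_pos.2 (hs c hc)) 3).ne'
    exact (by fun_prop (disch := assumption) : ContinuousAt _ c).continuousWithinAt
  refine ⟨hi, ?_⟩
  rw [intervalIntegral.integral_eq_sub_of_hasDerivAt (f := fun c => (√(1 - c ^ 2))⁻¹) _ hi]
  · simp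
  · intro c hc
    have h := hs c hc
    have h2 := Real.sqrt_pos.2 h
    refine ((((hasDerivAt_pow 2 c).const_sub 1).sqrt h.ne').fun_inv h2.ne').congr_deriv ?_
    field_simp
    simp

lemma integral_div_one_sub_sq (ha : 0 ≤ a) (hab : a ≤ b) (hb : b < 1) :
    IntervalIntegrable (fun c => c / √(1 - c ^ 2) ^ 2) volume a b ∧
    ∫ c in a..b, c / √(1 - c ^ 2) ^ 2 = Real.log (√(1 - a ^ 2)) - Real.log (√(1 - b ^ 2)) := by
  have hs : ∀ c ∈ uIcc a b, 0 < 1 - c ^ 2 := by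
    intro c hc
    rw [uIcc_of_le hab] at hc
    exact one_sub_sq_pos (ha.trans hc.1) (hc.2.trans_lt hb)
  have hi : IntervalIntegrable (fun c => c / √(1 - c ^ 2) ^ 2) volume a b := by
    refine ContinuousOn.intervalIntegrable fun c hc => ?_
    have := (pow_pos (Real.sqrt_pos.2 (hs c hc)) 2).ne'
    exact (by fun_prop (disch := assumption) : ContinuousAt _ c).continuousWithinAt
  refine ⟨hi, ?_⟩
  rw [intervalIntegral.integral_eq_sub_of_hasDerivAt (f := fun c => -Real.log (√(1 - c ^ 2))) _ hi]
  · ring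
  · intro c hc
    have h := hs c hc
    have h2 := Real.sqrt_pos.2 h
    refine ((((hasDerivAt_pow 2 c).const_sub 1).sqrt h.ne').log h2.ne').neg.congr_deriv ?_
    field_simp
    simp

lemma integral_cube_div_one_sub_sq (hb0 : 0 ≤ b) (hb : b < 1) :
    IntervalIntegrable (fun c => c ^ 3 / (1 - c ^ 2)) volume 0 b ∧
    ∫ c in (0 : ℝ)..b, c ^ 3 / (1 - c ^ 2) =
      -Real.log (√(1 - b ^ 2)) - 1 / 2 + √(1 - b ^ 2) ^ 2 / 2 := by
  have hs : ∀ c ∈ uIcc 0 b, 0 < 1 - c ^ 2 := by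
    intro c hc
    rw [uIcc_of_le hb0] at hc
    exact one_sub_sq_pos hc.1 (hc.2.trans_lt hb)
  have hi : IntervalIntegrable (fun c => c ^ 3 / (1 - c ^ 2)) volume 0 b := by
    refine ContinuousOn.intervalIntegrable fun c hc => ?_
    have := (hs c hc).ne'
    exact (by fun_prop (disch := assumption) : ContinuousAt _ c).continuousWithinAt
  refine ⟨hi, ?_⟩
  rw [intervalIntegral.integral_eq_sub_of_hasDerivAt
    (f := fun c => -(Real.log (1 - c ^ 2) / 2) - c ^ 2 / 2) _ hi]
  · rw [Real.log_sqrt (one_sub_sq_pos hb0 hb).le, Real.sq_sqrt (one_sub_sq_pos hb0 hb).le]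
    simp
    ring
  · intro c hc
    have h := hs c hc
    refine (((((hasDerivAt_pow 2 c).const_sub 1).log h.ne').div_const 2).neg.sub
      ((hasDerivAt_pow 2 c).div_const 2)).congr_deriv ?_
    field_simp
    simp
    ring

lemma one_sub_mul_sq_pos {c t : ℝ} (hc0 : 0 ≤ c) (hc : c < 1) (ht : t ∈ Icc (0 : ℝ) 1) :
    0 < 1 - (t * c) ^ 2 :=
  one_sub_sq_pos (mul_nonneg ht.1 hc0)
    ((mul_le_of_le_one_left hc0 ht.2).trans_lt hc)

/-- This and the next integral are the inner ones in compositions of two averages, where the noise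
belongs to the product `t c` of the correlations. -/
lemma integral_div_four {c : ℝ} (hc0 : 0 ≤ c) (hc : c < 1) :
    IntervalIntegrable (fun t => t / √(1 - (t * c) ^ 2) ^ 4) volume 0 1 ∧
    ∫ t in (0 : ℝ)..1, t / √(1 - (t * c) ^ 2) ^ 4 = 1 / (2 * (1 - c ^ 2)) := by
  have hs : ∀ t ∈ uIcc (0 : ℝ) 1, 0 < 1 - (t * c) ^ 2 := by
    intro t ht
    rw [uIcc_of_le zero_le_one] at ht
    exact one_sub_mul_sq_pos hc0 hc ht
  have hi : IntervalIntegrable (fun t => t / √(1 - (t * c) ^ 2) ^ 4) volume 0 1 := by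
    refine ContinuousOn.intervalIntegrable fun t ht => ?_
    have := (pow_pos (Real.sqrt_pos.2 (hs t ht)) 4).ne'
    exact (by fun_prop (disch := assumption) : ContinuousAt _ t).continuousWithinAt
  refine ⟨hi, ?_⟩
  rw [intervalIntegral.integral_eq_sub_of_hasDerivAt
    (f := fun t => t ^ 2 / (2 * (1 - (t * c) ^ 2))) _ hi]
  · simp
  · intro t ht
    have h := hs t ht
    have e : √(1 - (t * c) ^ 2) ^ 4 = (1 - (t * c) ^ 2) ^ 2 := by
      rw [show √(1 - (t * c) ^ 2) ^ 4 = (√(1 - (t * c) ^ 2) ^ 2) ^ 2 by ring, Real.sq_sqrt h.le]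
    rw [e]
    have h1 : HasDerivAt (fun t : ℝ => 2 * (1 - (t * c) ^ 2)) (2 * (-(2 * (t * c) * c))) t := by
      have := ((((hasDerivAt_id' t).mul_const c).fun_pow 2).const_sub 1).const_mul 2
      simpa using this
    refine ((hasDerivAt_pow 2 t).fun_div h1 (by positivity)).congr_deriv ?_
    field_simp
    simp
    ring

lemma integral_sq_div_five {c : ℝ} (hc0 : 0 ≤ c) (hc : c < 1) :
    IntervalIntegrable (fun t => t ^ 2 / √(1 - (t * c) ^ 2) ^ 5) volume 0 1 ∧
    ∫ t in (0 : ℝ)..1, t ^ 2 / √(1 - (t * c) ^ 2) ^ 5 = 1 / (3 * √(1 - c ^ 2) ^ 3) := by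
  have hs : ∀ t ∈ uIcc (0 : ℝ) 1, 0 < 1 - (t * c) ^ 2 := by
    intro t ht
    rw [uIcc_of_le zero_le_one] at ht
    exact one_sub_mul_sq_pos hc0 hc ht
  have hi : IntervalIntegrable (fun t => t ^ 2 / √(1 - (t * c) ^ 2) ^ 5) volume 0 1 := by
    refine ContinuousOn.intervalIntegrable fun t ht => ?_
    have := (pow_pos (Real.sqrt_pos.2 (hs t ht)) 5).ne'
    exact (by fun_prop (disch := assumption) : ContinuousAt _ t).continuousWithinAt
  refine ⟨hi, ?_⟩
  rw [intervalIntegral.integral_eq_sub_of_hasDerivAt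
    (f := fun t => t ^ 3 / (3 * √(1 - (t * c) ^ 2) ^ 3)) _ hi]
  · simp
  · intro t ht
    have h := hs t ht
    have h2 := Real.sqrt_pos.2 h
    have hq := Real.sq_sqrt h.le
    have h0 : HasDerivAt (fun t : ℝ => 1 - (t * c) ^ 2) (-(2 * (t * c) * c)) t := by
      have := (((hasDerivAt_id' t).mul_const c).fun_pow 2).const_sub 1
      simpa using this
    have h1 := ((h0.sqrt h.ne').fun_pow 3).const_mul 3
    refine ((hasDerivAt_pow 3 t).fun_div h1 (by positivity)).congr_deriv ?_
    set r := √(1 - (t * c) ^ 2) with hr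
    field_simp
    simp
    have : r ^ 2 = 1 - t ^ 2 * c ^ 2 := by rw [hq]; ring
    linear_combination (3 * t ^ 2 * r ^ 2) * this

/-- The integrand is singular at `1`. It is integrable as the nonnegative derivative of a function
continuous up to the endpoint. -/
lemma integral_sq_div_sqrt :
    IntervalIntegrable (fun c => c ^ 2 / √(1 - c ^ 2)) volume 0 1 ∧
    ∫ c in (0 : ℝ)..1, c ^ 2 / √(1 - c ^ 2) = Real.pi / 4 := by
  have hcont : ContinuousOn (fun c : ℝ => (Real.arcsin c - c * √(1 - c ^ 2)) / 2) (uIcc 0 1) := by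
    exact (by have := Real.continuous_arcsin; fun_prop : Continuous _).continuousOn
  have hder : ∀ c ∈ Ioo (0 : ℝ) 1, HasDerivAt
      (fun c : ℝ => (Real.arcsin c - c * √(1 - c ^ 2)) / 2) (c ^ 2 / √(1 - c ^ 2)) c := by
    intro c hc
    have h := one_sub_sq_pos hc.1.le hc.2
    have h2 := Real.sqrt_pos.2 h
    have hq := Real.sq_sqrt h.le
    refine (((Real.hasDerivAt_arcsin (by linarith [hc.1]) hc.2.ne).fun_sub
      ((hasDerivAt_id' c).fun_mul (hasDerivAt_sqrt_one_sub_sq hc))).div_const 2).congr_deriv ?_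
    field_simp
    rw [hq]; ring
  have hi : IntervalIntegrable (fun c => c ^ 2 / √(1 - c ^ 2)) volume 0 1 := by
    refine intervalIntegral.intervalIntegrable_deriv_of_nonneg hcont ?_ ?_
    · simpa using hder
    · intro c _
      positivity
  refine ⟨hi, ?_⟩
  rw [intervalIntegral.integral_eq_sub_of_hasDerivAt_of_le zero_le_one
    (by simpa using hcont) hder hi]
  simp
  ring

end Calculus

end

end SteinCLT

/-! ### Averaged derivatives of test functions. -/

namespace SteinCLT

noncomputable section

open Filter Topology Set
open scoped NNReal RealInnerProductSpace

variable {d : ℕ}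

section Bounds

variable {f : Euc d → ℝ} {M a b : ℝ}

lemma sqrt_pos_of_mem {c : ℝ} (h0 : 0 ≤ c) (h1 : c < 1) : 0 < √(1 - c ^ 2) :=
  Real.sqrt_pos.2 (one_sub_sq_pos h0 h1)

lemma abs_T_one_le_of_two (hf : IsTest f) (hM : ∀ x u v, |dd u (dd v f) x| ≤ M * ‖u‖ * ‖v‖)
    (u v x : Euc d) : |T 1 0 1 (dd u (dd v f)) x| ≤ M / 2 * ‖u‖ * ‖v‖ := by
  refine (abs_T_le (g := fun c => c * (M * ‖u‖ * ‖v‖)) le_rfl le_rfl zero_le_one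
    (((hf.dd v).dd u).SB 0) (Continuous.intervalIntegrable (by fun_prop) _ _) x
    fun c hc => ?_).trans (le_of_eq ?_)
  · rw [pow_one]
    exact mul_le_mul_of_nonneg_left (U_bounded (fun x => hM x u v) _) hc.1.le
  · rw [intervalIntegral.integral_mul_const, integral_id]
    ring

lemma abs_T_two_le_of_three (hf : IsTest f)
    (hM : ∀ x u v w, |dd u (dd v (dd w f)) x| ≤ M * ‖u‖ * ‖v‖ * ‖w‖)
    (u v w x : Euc d) : |T 2 0 1 (dd u (dd v (dd w f))) x| ≤ M / 3 * ‖u‖ * ‖v‖ * ‖w‖ := by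
  refine (abs_T_le (g := fun c => c ^ 2 * (M * ‖u‖ * ‖v‖ * ‖w‖)) le_rfl le_rfl zero_le_one
    ((((hf.dd w).dd v).dd u).SB 0) (Continuous.intervalIntegrable (by fun_prop) _ _) x
    fun c hc => ?_).trans (le_of_eq ?_)
  · exact mul_le_mul_of_nonneg_left (U_bounded (fun x => hM x u v w) _) (by positivity)
  · rw [intervalIntegral.integral_mul_const, integral_pow]
    ring

/-- Only one derivative goes to the kernel, and its price `e1 / √(1 - c²)` is integrable up to `c =
1`; no smoothing is needed. -/
lemma abs_T_two_le_of_two (hf : IsTest f) (hM : ∀ x u v, |dd u (dd v f) x| ≤ M * ‖u‖ * ‖v‖)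
    (u v w x : Euc d) :
    |T 2 0 1 (dd u (dd v (dd w f))) x| ≤ M * (e1 * Real.pi / 4) * ‖u‖ * ‖v‖ * ‖w‖ := by
  obtain ⟨hi, he⟩ := integral_sq_div_sqrt
  refine (abs_T_le (g := fun c => c ^ 2 / √(1 - c ^ 2) * (M * e1 * ‖u‖ * ‖v‖ * ‖w‖)) le_rfl le_rfl
    zero_le_one ((((hf.dd w).dd v).dd u).SB 0) (hi.mul_const _) x
    fun c hc => ?_).trans (le_of_eq ?_)
  · have := abs_integral_dd_le (((hf.dd w).dd v).SB 1) (fun x => hM x v w)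
      (sqrt_pos_of_mem hc.1.le hc.2) u (c • x)
    rw [div_mul_eq_mul_div]
    have h2 : |U c (dd u (dd v (dd w f))) x| ≤ _ := this
    calc _ ≤ c ^ 2 * _ := mul_le_mul_of_nonneg_left h2 (by positivity)
      _ = _ := by ring
  · rw [intervalIntegral.integral_mul_const, he]
    ring

section Lipschitz

variable (hf : IsTest f) (hM0 : 0 ≤ M) (hM : ∀ x u, |dd u f x| ≤ M * ‖u‖)
include hf hM

/-- For a Lipschitz function the kernel takes all derivatives but one. With two derivatives the
integral over `c` still converges at `1`; with three it grows like the logarithm of the noise level,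
with four like its inverse. -/
lemma abs_T_one_le (ha : 0 ≤ a) (hab : a ≤ b) (hb : b < 1) (u v x : Euc d) :
    |T 1 a b (dd u (dd v f)) x| ≤ M * (e1 * (√(1 - a ^ 2) - √(1 - b ^ 2))) * ‖u‖ * ‖v‖ := by
  obtain ⟨hi, he⟩ := integral_div_sqrt ha hab hb
  refine (abs_T_le (g := fun c => c / √(1 - c ^ 2) * (M * e1 * ‖u‖ * ‖v‖)) ha hb.le hab
    (((hf.dd v).dd u).SB 0) (hi.mul_const _) x fun c hc => ?_).trans (le_of_eq ?_)
  · have hc0 : 0 ≤ c := ha.trans hc.1.le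
    have h2 : |U c (dd u (dd v f)) x| ≤ _ :=
      abs_GA_two_le hf hM (sqrt_pos_of_mem hc0 (hc.2.trans hb)) u v (c • x)
    calc _ ≤ c ^ 1 * _ := mul_le_mul_of_nonneg_left h2 (by positivity)
      _ = _ := by ring
  · rw [intervalIntegral.integral_mul_const, he]
    ring

include hM0

lemma abs_T_two_le (ha : 0 ≤ a) (hab : a ≤ b) (hb : b < 1) (u v w x : Euc d) :
    |T 2 a b (dd u (dd v (dd w f))) x| ≤
      M * (e2 * (Real.log (√(1 - a ^ 2)) - Real.log (√(1 - b ^ 2)))) * ‖u‖ * ‖v‖ * ‖w‖ := by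
  obtain ⟨hi, he⟩ := integral_div_one_sub_sq ha hab hb
  refine (abs_T_le (g := fun c => c / √(1 - c ^ 2) ^ 2 * (M * e2 * ‖u‖ * ‖v‖ * ‖w‖)) ha hb.le hab
    ((((hf.dd w).dd v).dd u).SB 0) (hi.mul_const _) x fun c hc => ?_).trans (le_of_eq ?_)
  · have hc0 : 0 ≤ c := ha.trans hc.1.le
    have hc1 : c ≤ 1 := (hc.2.trans hb).le
    have hs := sqrt_pos_of_mem hc0 (hc.2.trans hb)
    have h2 : |U c (dd u (dd v (dd w f))) x| ≤ _ := abs_GA_three_le hf hM hs u v w (c • x)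
    have h3 : 0 ≤ M * (e2 / √(1 - c ^ 2) ^ 2) * ‖u‖ * ‖v‖ * ‖w‖ := by unfold e2; positivity
    calc _ ≤ c ^ 2 * _ := mul_le_mul_of_nonneg_left h2 (by positivity)
      -- The weight `c²` is weakened to `c`, which matches the elementary antiderivative.
      _ ≤ c * _ := mul_le_mul_of_nonneg_right (by nlinarith) h3
      _ = _ := by ring
  · rw [intervalIntegral.integral_mul_const, he]
    ring

lemma abs_T_three_le (hb0 : 0 ≤ b) (hb : b < 1) (u v w y x : Euc d) :
    |T 3 0 b (dd u (dd v (dd w (dd y f)))) x| ≤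
      M * (e3 / √(1 - b ^ 2)) * ‖u‖ * ‖v‖ * ‖w‖ * ‖y‖ := by
  obtain ⟨hi, he⟩ := integral_div_sqrt_cube le_rfl hb0 hb
  refine (abs_T_le (g := fun c => c / √(1 - c ^ 2) ^ 3 * (M * e3 * ‖u‖ * ‖v‖ * ‖w‖ * ‖y‖)) le_rfl
    hb.le hb0 (((((hf.dd y).dd w).dd v).dd u).SB 0) (hi.mul_const _) x fun c hc => ?_).trans ?_
  · have hc0 : 0 ≤ c := hc.1.le
    have hc1 : c ≤ 1 := (hc.2.trans hb).le
    have hs := sqrt_pos_of_mem hc0 (hc.2.trans hb)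
    have h2 : |U c (dd u (dd v (dd w (dd y f)))) x| ≤ _ :=
      abs_GA_four_le hf hM0 hM hs u v w y (c • x)
    have h3 : 0 ≤ M * (e3 / √(1 - c ^ 2) ^ 3) * ‖u‖ * ‖v‖ * ‖w‖ * ‖y‖ := by unfold e3; positivity
    calc _ ≤ c ^ 3 * _ := mul_le_mul_of_nonneg_left h2 (by positivity)
      _ ≤ c * _ := mul_le_mul_of_nonneg_right (by
          have : c ^ 3 = c * c ^ 2 := by ring
          nlinarith [pow_le_one₀ hc0 hc1 (n := 2)]) h3
      _ = _ := by ring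
  · rw [intervalIntegral.integral_mul_const, he]
    have : 0 ≤ M * e3 * ‖u‖ * ‖v‖ * ‖w‖ * ‖y‖ := by unfold e3; positivity
    calc _ ≤ (1 / √(1 - b ^ 2)) * (M * e3 * ‖u‖ * ‖v‖ * ‖w‖ * ‖y‖) :=
          mul_le_mul_of_nonneg_right (by simp) this
      _ = _ := by ring

end Lipschitz

/-- The composition of two averages, in the other order. -/
lemma T_T {j k : ℕ} (hb0 : 0 ≤ b) (hb : b ≤ 1) {F : Euc d → ℝ} (hF : SB 0 F) (x : Euc d) :
    T j 0 1 (T k 0 b F) x =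
      ∫ c in (0 : ℝ)..b, c ^ k * ∫ t in (0 : ℝ)..1, t ^ j * U (t * c) F x := by
  obtain ⟨C, hC⟩ := hF.bounded
  have hcont := continuous_U hF
  rw [T_eq_integral le_rfl le_rfl zero_le_one (T_SB le_rfl hb hF)]
  have h1 : ∀ t ∈ uIcc (0 : ℝ) 1, t ^ j * U t (T k 0 b F) x =
      ∫ c in (0 : ℝ)..b, c ^ k * (t ^ j * U (t * c) F x) := by
    intro t ht
    rw [uIcc_of_le zero_le_one] at ht
    rw [U_T le_rfl hb hb0 hF (abs_le.2 ⟨by linarith [ht.1], ht.2⟩), ← intervalIntegral.integral_const_mul]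
    congr 1
    ext c
    rw [mul_comm c t]
    ring
  rw [intervalIntegral.integral_congr h1]
  simp_rw [← intervalIntegral.integral_const_mul]
  simp_rw [intervalIntegral.integral_of_le hb0, intervalIntegral.integral_of_le zero_le_one]
  rw [integral_integral_swap]
  refine Integrable.of_bound (C := C) ?_ ?_
  · have : Continuous fun p : ℝ × ℝ => p.2 ^ k * (p.1 ^ j * U (p.1 * p.2) F x) :=
      (by fun_prop : Continuous fun p : ℝ × ℝ => p.2 ^ k).mul
        ((by fun_prop : Continuous fun p : ℝ × ℝ => p.1 ^ j).mul
        (hcont.comp (by fun_prop : Continuous fun p : ℝ × ℝ => (p.1 * p.2, x))))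
    exact this.aestronglyMeasurable
  · have h : ∀ᵐ t ∂(volume.restrict (Ioc (0 : ℝ) b)), 0 ≤ t ∧ t ≤ 1 := by
      filter_upwards [ae_restrict_mem measurableSet_Ioc] with t ht
      exact ⟨ht.1.le, ht.2.trans hb⟩
    have h' : ∀ᵐ t ∂(volume.restrict (Ioc (0 : ℝ) 1)), 0 ≤ t ∧ t ≤ 1 := by
      filter_upwards [ae_restrict_mem measurableSet_Ioc] with t ht
      exact ⟨ht.1.le, ht.2⟩
    filter_upwards [Measure.quasiMeasurePreserving_snd.ae h,
      Measure.quasiMeasurePreserving_fst.ae h'] with p hp hp'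
    rw [Function.uncurry, norm_mul, norm_mul, norm_pow, norm_pow, Real.norm_of_nonneg hp.1,
      Real.norm_of_nonneg hp'.1]
    calc p.2 ^ k * (p.1 ^ j * ‖U (p.1 * p.2) F x‖) ≤ 1 * (1 * C) :=
          mul_le_mul (pow_le_one₀ hp.1 hp.2)
            (mul_le_mul (pow_le_one₀ hp'.1 hp'.2) (U_bounded hC _) (norm_nonneg _) zero_le_one)
            (mul_nonneg (pow_nonneg hp'.1 _) (norm_nonneg _)) zero_le_one
      _ = C := by ring

/-- A bound for the composition of two averages. -/
lemma abs_T_T_le {j k : ℕ} (hb0 : 0 ≤ b) (hb : b ≤ 1) {F : Euc d → ℝ} (hF : SB 0 F) (x : Euc d)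
    {g : ℝ → ℝ → ℝ} {G H : ℝ → ℝ} (hg : ∀ c ∈ Ioo 0 b, IntervalIntegrable (g c) volume 0 1 ∧
      ∫ t in (0 : ℝ)..1, g c t = G c)
    (hU : ∀ c ∈ Ioo 0 b, ∀ t ∈ Ioo (0 : ℝ) 1, t ^ j * |U (t * c) F x| ≤ g c t)
    (hH : IntervalIntegrable H volume 0 b) (hGH : ∀ c ∈ Ioo 0 b, c ^ k * G c ≤ H c) :
    |T j 0 1 (T k 0 b F) x| ≤ ∫ c in (0 : ℝ)..b, H c := by
  have hne : ∀ r : ℝ, ∀ᵐ c ∂(volume : Measure ℝ), c ≠ r := fun r => by simp [ae_iff]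
  rw [T_T hb0 hb hF, ← Real.norm_eq_abs]
  refine intervalIntegral.norm_integral_le_of_norm_le hb0 ?_ hH
  filter_upwards [hne b] with c hcb hc
  have hc' : c ∈ Ioo 0 b := ⟨hc.1, lt_of_le_of_ne hc.2 hcb⟩
  rw [norm_mul, norm_pow, Real.norm_of_nonneg hc.1.le]
  refine (mul_le_mul_of_nonneg_left ?_ (pow_nonneg hc.1.le _)).trans (hGH c hc')
  obtain ⟨h1, h2⟩ := hg c hc'
  rw [← h2]
  refine intervalIntegral.norm_integral_le_of_norm_le zero_le_one ?_ h1
  filter_upwards [hne 1] with t ht1 ht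
  rw [norm_mul, norm_pow, Real.norm_of_nonneg ht.1.le]
  exact hU c hc' t ⟨ht.1, lt_of_le_of_ne ht.2 ht1⟩

section Lipschitz

variable (hf : IsTest f) (hM0 : 0 ≤ M) (hM : ∀ x u, |dd u f x| ≤ M * ‖u‖)
include hf hM0 hM

/-- The exponent `4` is that of two further derivatives of `T 2 0 b`. The inner integral turns the
fourth power of the noise level into half its square, whence `3.75 / 2`, and what remains is
logarithmic. -/
lemma abs_T_T_five_le (hb0 : 0 ≤ b) (hb : b < 1) (u v w y z x : Euc d) :
    |T 1 0 1 (T 4 0 b (dd u (dd v (dd w (dd y (dd z f)))))) x| ≤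
      M * (3.75 / 2 * (-Real.log (√(1 - b ^ 2)) - 1 / 2 + √(1 - b ^ 2) ^ 2 / 2)) *
        ‖u‖ * ‖v‖ * ‖w‖ * ‖y‖ * ‖z‖ := by
  obtain ⟨hi, he⟩ := integral_cube_div_one_sub_sq hb0 hb
  set K := M * 3.75 * ‖u‖ * ‖v‖ * ‖w‖ * ‖y‖ * ‖z‖ with hK
  have hK0 : 0 ≤ K := by positivity
  refine (abs_T_T_le hb0 hb.le ((((((hf.dd z).dd y).dd w).dd v).dd u).SB 0) x
    (g := fun c t => t / √(1 - (t * c) ^ 2) ^ 4 * K) (G := fun c => 1 / (2 * (1 - c ^ 2)) * K)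
    (H := fun c => c ^ 3 / (1 - c ^ 2) * (K / 2)) (fun c hc => ?_) (fun c hc t ht => ?_)
    (hi.mul_const _) (fun c hc => ?_)).trans (le_of_eq ?_)
  · obtain ⟨h1, h2⟩ := integral_div_four hc.1.le (hc.2.trans hb)
    exact ⟨h1.mul_const _, by rw [intervalIntegral.integral_mul_const, h2]⟩
  · have hs := Real.sqrt_pos.2 (one_sub_mul_sq_pos hc.1.le (hc.2.trans hb) ⟨ht.1.le, ht.2.le⟩)
    have h2 : |U (t * c) (dd u (dd v (dd w (dd y (dd z f))))) x| ≤ _ :=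
      abs_GA_five_le hf hM0 hM hs u v w y z ((t * c) • x)
    calc _ ≤ t ^ 1 * _ := mul_le_mul_of_nonneg_left h2 (by have := ht.1; positivity)
      _ = _ := by rw [hK]; ring
  · have h := one_sub_sq_pos hc.1.le (hc.2.trans hb)
    have h4 : c ^ 4 ≤ c ^ 3 :=
      pow_le_pow_of_le_one hc.1.le (hc.2.trans hb).le (by norm_num)
    calc c ^ 4 * (1 / (2 * (1 - c ^ 2)) * K) ≤ c ^ 3 * (1 / (2 * (1 - c ^ 2)) * K) :=
          mul_le_mul_of_nonneg_right h4 (by positivity)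
      _ = _ := by field_simp
  · rw [intervalIntegral.integral_mul_const, he, hK]
    ring

/-- As for five derivatives, with three derivatives of `T 2 0 b`. The inner integral contributes
`1/3`, whence `9.9 / 3 = 3.3`. -/
lemma abs_T_T_six_le (hb0 : 0 ≤ b) (hb : b < 1) (r u v w y z x : Euc d) :
    |T 2 0 1 (T 5 0 b (dd r (dd u (dd v (dd w (dd y (dd z f))))))) x| ≤
      M * (3.3 * (1 / √(1 - b ^ 2) - 1)) * ‖r‖ * ‖u‖ * ‖v‖ * ‖w‖ * ‖y‖ * ‖z‖ := by
  obtain ⟨hi, he⟩ := integral_div_sqrt_cube le_rfl hb0 hb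
  set K := M * 9.9 * ‖r‖ * ‖u‖ * ‖v‖ * ‖w‖ * ‖y‖ * ‖z‖ with hK
  have hK0 : 0 ≤ K := by positivity
  refine (abs_T_T_le hb0 hb.le (((((((hf.dd z).dd y).dd w).dd v).dd u).dd r).SB 0) x
    (g := fun c t => t ^ 2 / √(1 - (t * c) ^ 2) ^ 5 * K)
    (G := fun c => 1 / (3 * √(1 - c ^ 2) ^ 3) * K)
    (H := fun c => c / √(1 - c ^ 2) ^ 3 * (K / 3)) (fun c hc => ?_) (fun c hc t ht => ?_)
    (hi.mul_const _) (fun c hc => ?_)).trans (le_of_eq ?_)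
  · obtain ⟨h1, h2⟩ := integral_sq_div_five hc.1.le (hc.2.trans hb)
    exact ⟨h1.mul_const _, by rw [intervalIntegral.integral_mul_const, h2]⟩
  · have hs := Real.sqrt_pos.2 (one_sub_mul_sq_pos hc.1.le (hc.2.trans hb) ⟨ht.1.le, ht.2.le⟩)
    have h2 : |U (t * c) (dd r (dd u (dd v (dd w (dd y (dd z f)))))) x| ≤ _ :=
      abs_GA_six_le hf hM0 hM hs r u v w y z ((t * c) • x)
    calc _ ≤ t ^ 2 * _ := mul_le_mul_of_nonneg_left h2 (by have := ht.1; positivity)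
      _ = _ := by rw [hK]; ring
  · have h := sqrt_pos_of_mem hc.1.le (hc.2.trans hb)
    have h4 : c ^ 5 ≤ c ^ 1 :=
      pow_le_pow_of_le_one hc.1.le (hc.2.trans hb).le (by norm_num)
    calc c ^ 5 * (1 / (3 * √(1 - c ^ 2) ^ 3) * K) ≤ c ^ 1 * (1 / (3 * √(1 - c ^ 2) ^ 3) * K) :=
          mul_le_mul_of_nonneg_right h4 (by positivity)
      _ = _ := by field_simp
  · rw [intervalIntegral.integral_mul_const, he, hK]
    simp
    ring

end Lipschitz

end Bounds

end

end SteinCLT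

/-! ### Comparison for test functions with bounded third or second derivatives. -/

namespace SteinCLT

noncomputable section

open Filter Topology Set
open scoped NNReal RealInnerProductSpace

variable {d : ℕ}

lemma ofReal_abs_le_two {r K : ℝ} {u v : Euc d} (hK : 0 ≤ K) (h : |r| ≤ K * ‖u‖ * ‖v‖) :
    ENNReal.ofReal |r| ≤ ENNReal.ofReal K * ‖u‖ₑ * ‖v‖ₑ := by
  refine (ENNReal.ofReal_le_ofReal h).trans (le_of_eq ?_)
  rw [ENNReal.ofReal_mul (by positivity), ENNReal.ofReal_mul hK, ofReal_norm, ofReal_norm]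

section Setting

set_option linter.unusedSectionVars false

variable {Ω : Type*} [MeasurableSpace Ω] {P : Measure Ω} [IsProbabilityMeasure P]
  {W : Ω → Euc d} {Ξ : Type*} [MeasurableSpace Ξ]
  {Ω' : Ξ → Type*} [∀ ξ, MeasurableSpace (Ω' ξ)]
  {Q : ∀ ξ, Measure (Ω' ξ)} [∀ ξ, IsProbabilityMeasure (Q ξ)]
  {V : ∀ ξ, Ω' ξ → Euc d}
  {μ : VectorMeasure Ξ (Euc d)} {ν : Ξ → VectorMeasure Ξ (Euc d)}

lemma abs_integral_le_of_bdd {Θ : Type*} [MeasurableSpace Θ] {ρ : Measure Θ}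
    [IsProbabilityMeasure ρ] {F : Θ → ℝ} {C : ℝ} (h : ∀ x, |F x| ≤ C) : |∫ x, F x ∂ρ| ≤ C := by
  have := norm_integral_le_of_norm_le_const (μ := ρ) (f := F) (C := C)
    (ae_of_all _ fun y => (by simpa using h y))
  simpa using this

variable (hW : Measurable W) (hSt : Standardized P W)
  (hV : MeasurableFamily Q V) (hS : SizeBias P W Q V μ) (hPx : Proximity P W Q V ν)
  (hβ : beta2 μ ν < ⊤)
include hW hSt hV hS hPx hβ

/-- No smoothing takes place, `c` being `1`. One use of proximity differentiates the averaged
Hessian, and the `1/3` is the integral of `c²`. -/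
lemma enorm_sub_le_beta3_of_test {f : Euc d → ℝ} (hf : IsTest f) {M : ℝ} (hM0 : 0 ≤ M)
    (hM : ∀ x u v w, |dd u (dd v (dd w f)) x| ≤ M * ‖u‖ * ‖v‖ * ‖w‖) :
    ‖∫ ω, f (W ω) ∂P - ∫ z, f z ∂gd d‖ₑ ≤ beta3 μ ν / 3 * ENNReal.ofReal M := by
  have key := enorm_integral_U_sub_le hW hSt hV hS hPx hβ (hf.SB 2) zero_le_one le_rfl
    (Ψ := fun η => ENNReal.ofReal (M / 3) * betaXi1 ν η) (fun η u w => by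
      have h1 := proximity_one hV hPx (φ := T 1 0 1 (dd w (dd u f)))
        (T_SB le_rfl le_rfl (((hf.dd u).dd w).SB 1)) (K := ENNReal.ofReal (M / 3) * ‖u‖ₑ * ‖w‖ₑ)
        (fun x y => by
          rw [dd_T le_rfl le_rfl (((hf.dd u).dd w).SB 1)]
          have h2 := abs_T_two_le_of_three hf hM y w u x
          refine (ENNReal.ofReal_le_ofReal h2).trans (le_of_eq ?_)
          rw [ENNReal.ofReal_mul (by positivity), ENNReal.ofReal_mul (by positivity),
            ENNReal.ofReal_mul (by positivity), ofReal_norm, ofReal_norm, ofReal_norm]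
          ring) η
      exact h1.trans (le_of_eq (by ring)))
  rw [U_one] at key
  refine key.trans (le_of_eq ?_)
  have h3 : ENNReal.ofReal (M / 3) ≠ ⊤ := ENNReal.ofReal_ne_top
  simp_rw [lintegral_const_mul' _ _ h3]
  change ENNReal.ofReal (M / 3) * beta3 μ ν = _
  rw [ENNReal.ofReal_div_of_pos (by norm_num)]
  simp [ENNReal.div_eq_inv_mul, mul_comm, mul_assoc]

/-- The comparison for functions with controlled second and third order averages. -/
lemma enorm_sub_le_lintegral_min {h : Euc d → ℝ} (hh : SB 3 h) {a b : ℝ} (ha : 0 ≤ a) (hb : 0 ≤ b)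
    (h2 : ∀ x u v, |T 1 0 1 (dd u (dd v h)) x| ≤ a * ‖u‖ * ‖v‖)
    (h3 : ∀ x u v w, |T 2 0 1 (dd u (dd v (dd w h))) x| ≤ b * ‖u‖ * ‖v‖ * ‖w‖) :
    ‖∫ ω, h (W ω) ∂P - ∫ z, h z ∂gd d‖ₑ ≤ ∫⁻ ξ, ∫⁻ η, min (ENNReal.ofReal (2 * a))
      (ENNReal.ofReal b * betaXi1 ν η) ∂(ν ξ).variation ∂μ.variation := by
  have key := enorm_integral_U_sub_le hW hSt hV hS hPx hβ (hh.mono (by norm_num : 2 ≤ 3))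
    zero_le_one le_rfl (Ψ := fun η => min (ENNReal.ofReal (2 * a))
      (ENNReal.ofReal b * betaXi1 ν η)) (fun η u w => by
      have h1 := proximity_one hV hPx (φ := T 1 0 1 (dd w (dd u h)))
        (T_SB le_rfl le_rfl ((hh.dd u).dd w)) (K := ENNReal.ofReal b * ‖u‖ₑ * ‖w‖ₑ)
        (fun x y => by
          rw [dd_T le_rfl le_rfl ((hh.dd u).dd w)]
          have h2 := h3 x y w u
          refine (ENNReal.ofReal_le_ofReal h2).trans (le_of_eq ?_)
          rw [ENNReal.ofReal_mul (by positivity), ENNReal.ofReal_mul (by positivity),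
            ENNReal.ofReal_mul (by positivity), ofReal_norm, ofReal_norm, ofReal_norm]
          ring) η
      have h4 : |∫ ω, T 1 0 1 (dd w (dd u h)) (W ω) ∂P -
          ∫ ω, T 1 0 1 (dd w (dd u h)) (V η ω) ∂(Q η)| ≤ 2 * a * ‖u‖ * ‖w‖ := by
        refine (abs_sub _ _).trans ?_
        have i1 := abs_integral_le_of_bdd (ρ := P) (fun ω => h2 (W ω) w u)
        have i2 := abs_integral_le_of_bdd (ρ := Q η) (fun ω => h2 (V η ω) w u)
        linarith
      have h5 := ofReal_abs_le_two (by positivity) h4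
      rw [mul_assoc, mul_comm, mul_min]
      refine le_min (h5.trans (le_of_eq (by ring))) (h1.trans (le_of_eq (by ring))))
  rwa [U_one] at key

/-- The supremum of the averaged Hessian is `M / 2`, from the integral of `c`, and is counted twice.
The other constant is the first absolute Gaussian moment times `π / 4`. -/
lemma enorm_sub_le_beta23_of_test {f : Euc d → ℝ} (hf : IsTest f) {M : ℝ} (hM0 : 0 ≤ M)
    (hM : ∀ x u v, |dd u (dd v f) x| ≤ M * ‖u‖ * ‖v‖) :
    ‖∫ ω, f (W ω) ∂P - ∫ z, f z ∂gd d‖ₑ ≤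
      beta23 μ ν 1 (ENNReal.ofReal (√(2 * Real.pi) / 4)) * ENNReal.ofReal M := by
  have he : e1 * Real.pi / 4 = √(2 * Real.pi) / 4 := by
    rw [e1, Real.sqrt_div (by norm_num), Real.sqrt_mul (by norm_num)]
    have hp : 0 < √Real.pi := Real.sqrt_pos.2 Real.pi_pos
    have := Real.mul_self_sqrt Real.pi_pos.le
    field_simp
    nlinarith
  have hb0 : 0 ≤ √(2 * Real.pi) / 4 := by positivity
  have key := enorm_sub_le_lintegral_min hW hSt hV hS hPx hβ (hf.SB 3) (a := M / 2)
    (b := M * (√(2 * Real.pi) / 4)) (by positivity) (by positivity)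
    (fun x u v => abs_T_one_le_of_two hf hM u v x)
    (fun x u v w => by rw [← he]; exact abs_T_two_le_of_two hf hM u v w x)
  refine key.trans (le_of_eq ?_)
  have e : ∀ η, min (ENNReal.ofReal (2 * (M / 2)))
      (ENNReal.ofReal (M * (√(2 * Real.pi) / 4)) * betaXi1 ν η) =
      ENNReal.ofReal M * min 1 (ENNReal.ofReal (√(2 * Real.pi) / 4) * betaXi1 ν η) := by
    intro η
    rw [mul_min, ENNReal.ofReal_mul hM0, mul_one, mul_assoc, mul_div_cancel₀ _ (by norm_num)]
  simp_rw [e, lintegral_const_mul' _ _ ENNReal.ofReal_ne_top]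
  rw [mul_comm]
  rfl

end Setting

end

end SteinCLT

/-! ### The mean of averaged third derivatives under `W`, by bootstrapping. -/

namespace SteinCLT

noncomputable section

open Filter Topology Set
open scoped NNReal RealInnerProductSpace

variable {d : ℕ}

/-- The logarithm is bounded by its tangents, in the form `-log s ≤ 1/(x s) - 1 + log x`, sharp at
`s = 1/x`. The critical region is near `s = 1/4`, so `x = 4` is used there and gives `3.75 / 4 <
0.94`. Up to the threshold `0.4768` the remaining coefficient of `s` is not positive. -/
lemma mul_neg_log_bound {s : ℝ} (hs : 0 < s) (hs1 : s ≤ 1) :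
    3.75 * (-Real.log s - 1 / 2 + s ^ 2 / 2) ≤ 0.94 / s := by
  have key : ∀ x : ℝ, 0 < x → -Real.log s ≤ 1 / (x * s) - 1 + Real.log x := by
    intro x hx
    have h := Real.log_le_sub_one_of_pos (by positivity : 0 < 1 / (x * s))
    rw [one_div, Real.log_inv, Real.log_mul hx.ne' hs.ne'] at h
    rw [one_div]
    linarith
  have hl2 := Real.log_two_lt_d9
  rw [le_div_iff₀ hs]
  have mul : ∀ x : ℝ, 0 < x → -Real.log s * s ≤ 1 / x + (Real.log x - 1) * s := by
    intro x hx
    have := mul_le_mul_of_nonneg_right (key x hx) hs.le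
    have e : (1 / (x * s) - 1 + Real.log x) * s = 1 / x + (Real.log x - 1) * s := by
      field_simp
      ring
    linarith
  rcases le_total s 0.4768 with h | h
  · have h4 : Real.log 4 = 2 * Real.log 2 := by
      rw [show (4 : ℝ) = 2 ^ 2 by norm_num, Real.log_pow]; norm_num
    have := mul 4 (by norm_num)
    rw [h4] at this
    have h5 : s ^ 2 ≤ 0.2274 := by nlinarith
    nlinarith [mul_le_mul_of_nonneg_right h5 hs.le]
  · have := mul 2 (by norm_num)
    have h6 : 0 ≤ (s - 0.4768) * (1 - s) := mul_nonneg (by linarith) (by linarith)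
    nlinarith [mul_nonneg h6 hs.le]

lemma sqrt_one_sub_sqrt {s : ℝ} (hs0 : 0 ≤ s) (hs1 : s ≤ 1) :
    √(1 - √(1 - s ^ 2) ^ 2) = s := by
  rw [Real.sq_sqrt (by nlinarith), sub_sub_cancel, Real.sqrt_sq hs0]

lemma T_self (k : ℕ) {a : ℝ} (ha : 0 ≤ a) (ha1 : a ≤ 1) {F : Euc d → ℝ} (hF : SB 0 F)
    (x : Euc d) : T k a a F x = 0 := by
  rw [T_eq_integral ha ha1 le_rfl hF, intervalIntegral.integral_same]

/-- Under the Gaussian law every `U t` preserves the mean, so the average contributes only the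
integral of `t²`, and the third derivative is taken at full noise, where nothing is singular. -/
lemma abs_integral_T_two_gd_le {f : Euc d → ℝ} {M : ℝ} (hf : IsTest f)
    (hM : ∀ x u, |dd u f x| ≤ M * ‖u‖) {b : ℝ} (hb0 : 0 ≤ b) (hb : b ≤ 1) (u v w : Euc d) :
    |∫ z, T 2 0 b (dd u (dd v (dd w f))) z ∂gd d| ≤ M * (e2 / 3) * ‖u‖ * ‖v‖ * ‖w‖ := by
  have hF := (((hf.dd w).dd v).dd u).SB 0
  rw [← U_zero _ 0, U_T le_rfl hb hb0 hF (by simp)]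
  simp only [mul_zero]
  rw [intervalIntegral.integral_mul_const, integral_pow, abs_mul]
  have h := abs_GA_three_le hf hM (s := 1) one_pos u v w 0
  have h' : |U 0 (dd u (dd v (dd w f))) 0| ≤ M * (e2 / 1 ^ 2) * ‖u‖ * ‖v‖ * ‖w‖ := by
    rw [U_eq_GA]; simpa using h
  have hb3 : |(b ^ (2 + 1) - 0 ^ (2 + 1)) / ((2 : ℕ) + 1 : ℝ)| ≤ 1 / 3 := by
    have h1 : b ^ 3 ≤ 1 := pow_le_one₀ hb0 hb
    have h0 : 0 ≤ b ^ 3 := by positivity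
    have e : (b ^ (2 + 1) - 0 ^ (2 + 1)) / ((2 : ℕ) + 1 : ℝ) = b ^ 3 / 3 := by norm_num
    rw [e, abs_of_nonneg (by positivity)]
    linarith
  calc _ ≤ 1 / 3 * (M * (e2 / 1 ^ 2) * ‖u‖ * ‖v‖ * ‖w‖) :=
        mul_le_mul hb3 h' (abs_nonneg _) (by norm_num)
    _ = _ := by ring

section Setting

set_option linter.unusedSectionVars false

variable {Ω : Type*} [MeasurableSpace Ω] {P : Measure Ω} [IsProbabilityMeasure P]
  {W : Ω → Euc d} {Ξ : Type*} [MeasurableSpace Ξ]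
  {Ω' : Ξ → Type*} [∀ ξ, MeasurableSpace (Ω' ξ)]
  {Q : ∀ ξ, Measure (Ω' ξ)} [∀ ξ, IsProbabilityMeasure (Q ξ)]
  {V : ∀ ξ, Ω' ξ → Euc d}
  {μ : VectorMeasure Ξ (Euc d)} {ν : Ξ → VectorMeasure Ξ (Euc d)}

/-- The quantity controlling the smoothing parameter. -/
def cutoff (μ : VectorMeasure Ξ (Euc d)) (ν : Ξ → VectorMeasure Ξ (Euc d)) : ℝ≥0∞ :=
  beta23 μ ν 1 (ENNReal.ofReal 3.52)

lemma cutoff_lt_top (hβ : beta2 μ ν < ⊤) : cutoff μ ν < ⊤ := by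
  refine lt_of_le_of_lt ?_ hβ
  refine lintegral_mono fun ξ => ?_
  rw [betaXi1, ← lintegral_one]
  exact lintegral_mono fun η => min_le_left _ _

variable (hW : Measurable W) (hSt : Standardized P W)
  (hV : MeasurableFamily Q V) (hS : SizeBias P W Q V μ) (hPx : Proximity P W Q V ν)
  (hβ : beta2 μ ν < ⊤)
include hW hSt hV hS hPx hβ

section Third

variable {f : Euc d → ℝ} {M : ℝ} (hf : IsTest f) (hM0 : 0 ≤ M) (hM : ∀ x u, |dd u f x| ≤ M * ‖u‖)
include hf hM0 hM

/-- The third-order average is itself smooth enough to serve as the test function in the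
second-order comparison. By `hp` its mean under `W` differs from the Gaussian mean by at most `M
e2`, and the Gaussian mean adds a third of that. -/
lemma abs_integral_T_two_le_of_le {b : ℝ} (hb0 : 0 ≤ b) (hb : b < 1)
    (hp : 0.94 * (cutoff μ ν).toReal ≤ e2 * √(1 - b ^ 2)) (u v w : Euc d) :
    |∫ ω, T 2 0 b (dd u (dd v (dd w f))) (W ω) ∂P| ≤ M * (e2 * (4 / 3)) * ‖u‖ * ‖v‖ * ‖w‖ := by
  set s := √(1 - b ^ 2) with hs
  have hs0 : 0 < s := sqrt_pos_of_mem hb0 hb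
  have hs1 : s ≤ 1 := by
    rw [hs, Real.sqrt_le_left zero_le_one]; nlinarith [sq_nonneg b]
  have hF : IsTest (dd u (dd v (dd w f))) := ((hf.dd w).dd v).dd u
  set K := M * ‖u‖ * ‖v‖ * ‖w‖ with hK
  have hK0 : 0 ≤ K := by positivity
  have hA := mul_neg_log_bound hs0 hs1
  have hdd : ∀ x y, dd x (dd y (T 2 0 b (dd u (dd v (dd w f))))) =
      T 4 0 b (dd x (dd y (dd u (dd v (dd w f))))) := fun x y => by
    rw [dd_T le_rfl hb.le (hF.SB 1), dd_T le_rfl hb.le ((hF.dd y).SB 1)]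
  have hddd : ∀ x y z, dd x (dd y (dd z (T 2 0 b (dd u (dd v (dd w f)))))) =
      T 5 0 b (dd x (dd y (dd z (dd u (dd v (dd w f)))))) := fun x y z => by
    rw [hdd, dd_T le_rfl hb.le (((hF.dd z).dd y).SB 1)]
  have h1s : 0 ≤ 1 / s - 1 := by rw [sub_nonneg, le_div_iff₀ hs0]; linarith
  -- Both constants are multiples of `0.94 / s`, since `3.3 ≤ 3.52 · 0.94`. Factoring it out leaves
  -- precisely the minimum that defines `cutoff`.
  have key := enorm_sub_le_lintegral_min hW hSt hV hS hPx hβ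
    (T_SB (k := 2) le_rfl hb.le (hF.SB 3)) (a := K * (0.94 / s) / 2) (b := 3.52 * (K * (0.94 / s)))
    (by positivity) (by positivity)
    (fun x y z => by
      rw [hdd]
      refine (abs_T_T_five_le hf hM0 hM hb0 hb y z u v w x).trans ?_
      calc _ = 3.75 * (-Real.log s - 1 / 2 + s ^ 2 / 2) * (K / 2 * ‖y‖ * ‖z‖) := by
            rw [hK]; ring
        _ ≤ (0.94 / s) * (K / 2 * ‖y‖ * ‖z‖) :=
            mul_le_mul_of_nonneg_right hA (by positivity)
        _ = _ := by ring)
    (fun x y z t => by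
      rw [hddd]
      refine (abs_T_T_six_le hf hM0 hM hb0 hb y z t u v w x).trans ?_
      calc _ = 3.3 * (1 / s - 1) * (K * ‖y‖ * ‖z‖ * ‖t‖) := by
            rw [hK]; ring
        _ ≤ 3.52 * (0.94 / s) * (K * ‖y‖ * ‖z‖ * ‖t‖) := by
            refine mul_le_mul_of_nonneg_right ?_ (by positivity)
            have : (0.94 : ℝ) / s = 0.94 * (1 / s) := by ring
            rw [this]
            have : 0 ≤ 1 / s := by positivity
            linarith
        _ = _ := by ring)
  have e : ∀ η, min (ENNReal.ofReal (2 * (K * (0.94 / s) / 2)))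
      (ENNReal.ofReal (3.52 * (K * (0.94 / s))) * betaXi1 ν η) =
      ENNReal.ofReal (K * (0.94 / s)) * min 1 (ENNReal.ofReal 3.52 * betaXi1 ν η) := by
    intro η
    rw [mul_min, mul_one, ENNReal.ofReal_mul (by norm_num : (0 : ℝ) ≤ 3.52),
      mul_div_cancel₀ _ (by norm_num : (2 : ℝ) ≠ 0)]
    congr 1
    ring
  simp_rw [e, lintegral_const_mul' _ _ ENNReal.ofReal_ne_top] at key
  have key2 : ‖∫ ω, T 2 0 b (dd u (dd v (dd w f))) (W ω) ∂P -
      ∫ z, T 2 0 b (dd u (dd v (dd w f))) z ∂gd d‖ₑ ≤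
      ENNReal.ofReal (K * (0.94 / s)) * cutoff μ ν := key
  rw [← ENNReal.ofReal_toReal (cutoff_lt_top hβ).ne, ← ENNReal.ofReal_mul (by positivity),
    Real.enorm_eq_ofReal_abs, ENNReal.ofReal_le_ofReal_iff (by positivity)] at key2
  have h1 := abs_integral_T_two_gd_le hf hM hb0 hb.le u v w
  have h2 : K * (0.94 / s) * (cutoff μ ν).toReal ≤ K * e2 := by
    rw [mul_assoc]
    refine mul_le_mul_of_nonneg_left ?_ hK0
    rw [div_mul_eq_mul_div, div_le_iff₀ hs0]
    exact hp
  have h3 := abs_sub_abs_le_abs_sub (∫ ω, T 2 0 b (dd u (dd v (dd w f))) (W ω) ∂P)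
    (∫ z, T 2 0 b (dd u (dd v (dd w f))) z ∂gd d)
  have h4 : M * (e2 / 3) * ‖u‖ * ‖v‖ * ‖w‖ = K * (e2 / 3) := by rw [hK]; ring
  have h5 : M * (e2 * (4 / 3)) * ‖u‖ * ‖v‖ * ‖w‖ = K * e2 + K * (e2 / 3) := by rw [hK]; ring
  rw [h4] at h1
  rw [h5]
  linarith

/-- Noise levels above `(0.94 / e2) p` are handled by the bootstrap, those below by the supremum,
which contributes the logarithm of a ratio of levels. As `s0` is only a lower bound for the noise,
the same `ℓ` serves every smaller correlation. -/
lemma abs_integral_T_two_le {b s0 ℓ : ℝ} (hb0 : 0 ≤ b) (hb : b < 1) (hs0 : 0 < s0)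
    (hsb : s0 ≤ √(1 - b ^ 2)) (hℓ : 0 ≤ ℓ) (hp0 : 0 < (cutoff μ ν).toReal)
    (hℓs : Real.log (0.94 / e2 * (cutoff μ ν).toReal) - Real.log s0 ≤ ℓ) (u v w : Euc d) :
    |∫ ω, T 2 0 b (dd u (dd v (dd w f))) (W ω) ∂P| ≤
      M * (e2 * (4 / 3 + ℓ)) * ‖u‖ * ‖v‖ * ‖w‖ := by
  set p := (cutoff μ ν).toReal with hp
  have he2 : (0 : ℝ) < e2 := by unfold e2; norm_num
  have hF : IsTest (dd u (dd v (dd w f))) := ((hf.dd w).dd v).dd u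
  set K := ‖u‖ * ‖v‖ * ‖w‖ with hK
  have hK0 : 0 ≤ K := by positivity
  have hlast : M * (e2 * (4 / 3)) * ‖u‖ * ‖v‖ * ‖w‖ ≤ M * (e2 * (4 / 3 + ℓ)) * ‖u‖ * ‖v‖ * ‖w‖ := by
    gcongr; linarith
  rcases le_total (0.94 / e2 * p) (√(1 - b ^ 2)) with h | h
  · refine (abs_integral_T_two_le_of_le hW hSt hV hS hPx hβ hf hM0 hM hb0 hb ?_ u v w).trans hlast
    rw [div_mul_eq_mul_div, div_le_iff₀ he2] at h
    linarith
  · have hsb1 : √(1 - b ^ 2) ≤ 1 := by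
      rw [Real.sqrt_le_left zero_le_one]; nlinarith [sq_nonneg b]
    -- The noise level at which the bootstrap ceases to apply, capped by the largest possible one.
    -- If the cap is active, the part to be bootstrapped is empty.
    set s1 := min 1 (0.94 / e2 * p) with hs1
    have hs10 : 0 < s1 := lt_min one_pos (by positivity)
    have hs11 : s1 ≤ 1 := min_le_left _ _
    have hbs1 : √(1 - b ^ 2) ≤ s1 := le_min hsb1 h
    set c := √(1 - s1 ^ 2) with hc
    have hcs : √(1 - c ^ 2) = s1 := sqrt_one_sub_sqrt hs10.le hs11
    have hc0 : 0 ≤ c := Real.sqrt_nonneg _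
    have hcb : c ≤ b := by
      rw [hc, Real.sqrt_le_left hb0]
      have := pow_le_pow_left₀ (Real.sqrt_nonneg _) hbs1 2
      rw [Real.sq_sqrt (one_sub_sq_pos hb0 hb).le] at this
      linarith
    have hc1 : c < 1 := hcb.trans_lt hb
    have hsplit : ∫ ω, T 2 0 b (dd u (dd v (dd w f))) (W ω) ∂P =
        ∫ ω, T 2 0 c (dd u (dd v (dd w f))) (W ω) ∂P +
          ∫ ω, T 2 c b (dd u (dd v (dd w f))) (W ω) ∂P := by
      obtain ⟨C1, hC1⟩ := (T_SB (k := 2) le_rfl hc1.le (hF.SB 0)).bounded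
      obtain ⟨C2, hC2⟩ := (T_SB (k := 2) hc0 hb.le (hF.SB 0)).bounded
      rw [← integral_add (integrable_bdd_W hW (T_SB le_rfl hc1.le (hF.SB 0)).continuous hC1)
        (integrable_bdd_W hW (T_SB hc0 hb.le (hF.SB 0)).continuous hC2)]
      refine integral_congr_ae (ae_of_all _ fun ω => ?_)
      exact T_add_adjacent le_rfl hb.le hc0 hcb (hF.SB 0) _
    have h1 : |∫ ω, T 2 0 c (dd u (dd v (dd w f))) (W ω) ∂P| ≤ M * (e2 * (4 / 3)) * K := by
      rcases le_total 1 (0.94 / e2 * p) with h1 | h1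
      · have : c = 0 := by rw [hc, hs1, min_eq_left h1]; simp
        simp only [this, T_self 2 le_rfl zero_le_one (hF.SB 0), integral_zero, abs_zero]
        positivity
      · refine (abs_integral_T_two_le_of_le hW hSt hV hS hPx hβ hf hM0 hM hc0 hc1 ?_ u v w).trans
          (le_of_eq (by rw [hK]; ring))
        rw [hcs, hs1, min_eq_right h1, ← mul_assoc, mul_div_cancel₀ _ he2.ne']
    have h2 : |∫ ω, T 2 c b (dd u (dd v (dd w f))) (W ω) ∂P| ≤ M * (e2 * ℓ) * K := by
      refine (abs_integral_le_of_bdd fun ω =>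
        abs_T_two_le hf hM0 hM hc0 hcb hb u v w (W ω)).trans ?_
      rw [hcs]
      have l1 : Real.log s1 ≤ Real.log (0.94 / e2 * p) :=
        Real.log_le_log hs10 (min_le_right _ _)
      have l2 : Real.log s0 ≤ Real.log (√(1 - b ^ 2)) := Real.log_le_log hs0 hsb
      calc _ = M * (e2 * (Real.log s1 - Real.log (√(1 - b ^ 2)))) * K := by rw [hK]; ring
        _ ≤ _ := by
          gcongr
          linarith
    rw [hsplit]
    refine (abs_add_le _ _).trans ((add_le_add h1 h2).trans (le_of_eq ?_))
    rw [hK]; ring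

end Third

end Setting

end

end SteinCLT

/-! ### Smoothing, and the comparison for Lipschitz test functions. -/

namespace SteinCLT

noncomputable section

open Filter Topology Set
open scoped NNReal RealInnerProductSpace

variable {d : ℕ}

lemma integral_norm_sq_gd : ∫ z, ‖z‖ ^ 2 ∂gd d = d := by
  have h1 : ∀ i : Fin d, ∫ z : Euc d, z i ^ 2 ∂gd d = 1 := by
    intro i
    have h := variance_dual_stdGaussian (E := Euc d)
      (innerSL ℝ (EuclideanSpace.single i (1 : ℝ)))
    have hm := integral_strongDual_stdGaussian (E := Euc d)
      (innerSL ℝ (EuclideanSpace.single i (1 : ℝ)))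
    have e : ∀ z : Euc d, innerSL ℝ (EuclideanSpace.single i (1 : ℝ)) z = z i := fun z => by
      simp [EuclideanSpace.inner_single_left]
    rw [variance_eq_integral (by fun_prop), hm, innerSL_apply_norm] at h
    simp_rw [e] at h
    simpa using h
  have hi : ∀ i : Fin d, Integrable (fun z : Euc d => z i ^ 2) (gd d) := fun i => by
    refine integrable_norm_sq_gd.mono' (by fun_prop) (ae_of_all _ fun z => ?_)
    rw [norm_pow]
    exact pow_le_pow_left₀ (norm_nonneg _) (PiLp.norm_apply_le z i) 2
  simp_rw [EuclideanSpace.real_norm_sq_eq]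
  rw [integral_finsetSum _ fun i _ => hi i]
  simp [h1]

lemma ofReal_mul_norm_mul_norm {K : ℝ} (hK : 0 ≤ K) (u v : Euc d) :
    ENNReal.ofReal (K * ‖u‖ * ‖v‖) = ENNReal.ofReal K * ‖u‖ₑ * ‖v‖ₑ := by
  rw [ENNReal.ofReal_mul (by positivity), ENNReal.ofReal_mul hK, ofReal_norm, ofReal_norm]

lemma integral_T_split {Θ : Type*} [MeasurableSpace Θ] (ρ : Measure Θ) [IsProbabilityMeasure ρ]
    {X : Θ → Euc d} (hX : Measurable X) {k : ℕ} {b c : ℝ} (hb0 : 0 ≤ b) (hbc : b ≤ c) (hc : c ≤ 1)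
    {F : Euc d → ℝ} (hF : SB 0 F) : ∫ ω, T k 0 c F (X ω) ∂ρ =
      ∫ ω, T k 0 b F (X ω) ∂ρ + ∫ ω, T k b c F (X ω) ∂ρ := by
  obtain ⟨C1, hC1⟩ := (T_SB (k := k) le_rfl (hbc.trans hc) hF).bounded
  obtain ⟨C2, hC2⟩ := (T_SB (k := k) hb0 hc hF).bounded
  have h1 : Integrable (fun ω => T k 0 b F (X ω)) ρ :=
    Integrable.of_bound ((T_SB (k := k) le_rfl (hbc.trans hc) hF).continuous.measurable.comp
      hX).aestronglyMeasurable C1 (ae_of_all _ fun _ => hC1 _)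
  have h2 : Integrable (fun ω => T k b c F (X ω)) ρ :=
    Integrable.of_bound ((T_SB (k := k) hb0 hc hF).continuous.measurable.comp
      hX).aestronglyMeasurable C2 (ae_of_all _ fun _ => hC2 _)
  rw [← integral_add h1 h2]
  exact integral_congr_ae (ae_of_all _ fun ω => T_add_adjacent le_rfl hc hb0 hbc hF _)

lemma abs_sub_le_of_abs_dd_le {f : Euc d → ℝ} (hf : Differentiable ℝ f) {C : ℝ} (hC0 : 0 ≤ C)
    (hC : ∀ x u, |dd u f x| ≤ C * ‖u‖) (x y : Euc d) : |f x - f y| ≤ C * ‖x - y‖ := by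
  have := Convex.norm_image_sub_le_of_norm_fderiv_le (f := f) (C := C) (s := univ)
    (fun x _ => hf x) (fun x _ => ContinuousLinearMap.opNorm_le_bound _ hC0 fun u => hC x u)
    convex_univ (mem_univ y) (mem_univ x)
  simpa using this

lemma IsTest.exists_hessian_bound {f : Euc d → ℝ} (hf : IsTest f) :
    ∃ C, 0 ≤ C ∧ ∀ x u v, |SteinCLT.dd u (SteinCLT.dd v f) x| ≤ C * ‖u‖ * ‖v‖ := by
  choose C hC0 hC using fun i =>
    ((hf.dd (EuclideanSpace.single i (1 : ℝ))).SB 1).fderiv_bounded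
  refine ⟨∑ i, C i, Finset.sum_nonneg fun i _ => hC0 i, fun x u v => ?_⟩
  have e : SteinCLT.dd v f = fun x => ∑ i, v i * SteinCLT.dd (EuclideanSpace.single i 1) f x := by
    ext x
    exact dd_eq_sum v f x
  rw [e, dd_sum _ _ fun i => ((hf.dd _).SB 1).differentiable, Finset.sum_mul, Finset.sum_mul]
  refine (Finset.abs_sum_le_sum_abs _ _).trans (Finset.sum_le_sum fun i _ => ?_)
  rw [abs_mul, mul_comm]
  refine mul_le_mul ?_ (PiLp.norm_apply_le v i) (abs_nonneg _)
    (mul_nonneg (hC0 i) (norm_nonneg _))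
  exact ((fderiv ℝ (SteinCLT.dd _ f) x).le_opNorm u).trans
    (mul_le_mul_of_nonneg_right (hC i x) (norm_nonneg _))

section Setting

set_option linter.unusedSectionVars false

variable {Ω : Type*} [MeasurableSpace Ω] {P : Measure Ω} [IsProbabilityMeasure P]
  {W : Ω → Euc d} {Ξ : Type*} [MeasurableSpace Ξ]
  {Ω' : Ξ → Type*} [∀ ξ, MeasurableSpace (Ω' ξ)]
  {Q : ∀ ξ, Measure (Ω' ξ)} [∀ ξ, IsProbabilityMeasure (Q ξ)]
  {V : ∀ ξ, Ω' ξ → Euc d}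
  {μ : VectorMeasure Ξ (Euc d)} {ν : Ξ → VectorMeasure Ξ (Euc d)}

lemma integral_norm_sq_W (hSt : Standardized P W) (hW : Measurable W) :
    ∫ ω, ‖W ω‖ ^ 2 ∂P = d := by
  have hi : ∀ i : Fin d, Integrable (fun ω => W ω i * W ω i) P := fun i => by
    refine (integrable_norm_sq hSt).mono' (by fun_prop) (ae_of_all _ fun ω => ?_)
    rw [← pow_two, norm_pow]
    exact pow_le_pow_left₀ (norm_nonneg _) (PiLp.norm_apply_le (W ω) i) 2
  simp_rw [EuclideanSpace.real_norm_sq_eq, pow_two]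
  rw [integral_finsetSum _ fun i _ => hi i]
  simp_rw [integral_apply_mul_apply hSt]
  simp

/-- The cost of smoothing. -/
lemma abs_integral_sub_U_le (hd : 1 ≤ d) (hW : Measurable W) (hSt : Standardized P W)
    {f : Euc d → ℝ} (hf : IsTest f) {M : ℝ} (hM0 : 0 ≤ M)
    (hM : ∀ x u, |dd u f x| ≤ M * ‖u‖) {c : ℝ} (hc0 : 0 ≤ c) (hc : c ≤ 1) :
    |∫ ω, f (W ω) ∂P - ∫ ω, U c f (W ω) ∂P| ≤ M * √(2 * (1 - c) * d) := by
  rcases hc.eq_or_lt with rfl | hc1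
  · simp [U_one]
  -- The root mean square of `(1 - c) W - s Z`. Using `y ≤ (y²/t + t)/2` with this `t` replaces the
  -- Cauchy-Schwarz inequality and needs second moments only.
  set t := √(2 * (1 - c) * d) with ht
  have hd0 : (0 : ℝ) < d := by exact_mod_cast hd
  have hpos : 0 < 2 * (1 - c) * d := by have : 0 < 1 - c := by linarith
                                        positivity
  have ht0 : 0 < t := Real.sqrt_pos.2 hpos
  have ht2 : t ^ 2 = 2 * (1 - c) * d := Real.sq_sqrt hpos.le
  set s := √(1 - c ^ 2) with hs
  have hs2 : s ^ 2 = 1 - c ^ 2 := Real.sq_sqrt (one_sub_sq_pos hc0 hc1).le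
  have hfc := (hf.SB 0).continuous
  obtain ⟨C, hC⟩ := (hf.SB 0).bounded
  have hUc : Continuous (U c f) := (U_SB (by rw [abs_of_nonneg hc0]; exact hc) (hf.SB 0)).continuous
  have hpt : ∀ w : Euc d, |f w - U c f w| ≤
      M / 2 * (((1 - c) ^ 2 * ‖w‖ ^ 2 + s ^ 2 * d) / t + t) := by
    intro w
    have hi : Integrable (fun z => f (c • w + s • z)) (gd d) := integrable_bdd_gd hfc hC s _
    have e : f w - U c f w = ∫ z, (f w - f (c • w + s • z)) ∂gd d := by
      rw [integral_sub (integrable_const _) hi]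
      simp [U, hs]
    have hb : ∀ z : Euc d, |f w - f (c • w + s • z)| ≤
        M / 2 * (((1 - c) ^ 2 * ‖w‖ ^ 2 + s ^ 2 * ‖z‖ ^ 2 - 2 * (1 - c) * s * ⟪w, z⟫) / t + t) := by
      intro z
      refine (abs_sub_le_of_abs_dd_le (hf.SB 1).differentiable hM0 hM _ _).trans ?_
      have e1 : w - (c • w + s • z) = (1 - c) • w - s • z := by module
      have e2 : ‖(1 - c) • w - s • z‖ ^ 2 =
          (1 - c) ^ 2 * ‖w‖ ^ 2 + s ^ 2 * ‖z‖ ^ 2 - 2 * (1 - c) * s * ⟪w, z⟫ := by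
        rw [norm_sub_sq_real, norm_smul, norm_smul, inner_smul_left, inner_smul_right, mul_pow,
          mul_pow, Real.norm_eq_abs, Real.norm_eq_abs, sq_abs, sq_abs]
        simp
        ring
      rw [e1, ← e2]
      set y := ‖(1 - c) • w - s • z‖
      have : y ≤ (y ^ 2 / t + t) / 2 := by
        have h : 0 ≤ (y - t) ^ 2 / t := by positivity
        have h2 : (y - t) ^ 2 / t = y ^ 2 / t + t - 2 * y := by field_simp; ring
        linarith
      calc M * y ≤ M * ((y ^ 2 / t + t) / 2) := by gcongr
        _ = _ := by ring
    have hin : Integrable (fun z : Euc d => ⟪w, z⟫) (gd d) := by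
      refine (integrable_norm_gd.const_mul ‖w‖).mono' (by fun_prop) (ae_of_all _ fun z => ?_)
      exact norm_inner_le_norm w z
    have hin0 : ∫ z : Euc d, ⟪w, z⟫ ∂gd d = 0 :=
      integral_strongDual_stdGaussian (E := Euc d) (innerSL ℝ w)
    have hA : Integrable (fun z : Euc d => (1 - c) ^ 2 * ‖w‖ ^ 2 + s ^ 2 * ‖z‖ ^ 2) (gd d) :=
      (integrable_const _).add (integrable_norm_sq_gd.const_mul _)
    have hB : Integrable (fun z : Euc d => 2 * (1 - c) * s * ⟪w, z⟫) (gd d) := hin.const_mul _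
    have hAB : Integrable (fun z : Euc d => (1 - c) ^ 2 * ‖w‖ ^ 2 + s ^ 2 * ‖z‖ ^ 2 -
      2 * (1 - c) * s * ⟪w, z⟫) (gd d) := hA.sub hB
    rw [e]
    refine abs_integral_le_integral_abs.trans
      ((integral_mono_of_nonneg (ae_of_all _ fun z => abs_nonneg _)
        (((hAB.div_const t).add (integrable_const t)).const_mul _)
        (ae_of_all _ hb)).trans (le_of_eq ?_))
    simp only [Pi.add_apply]
    rw [integral_const_mul, integral_add (hAB.div_const t) (integrable_const t),
      integral_div, integral_sub hA hB, integral_add (integrable_const _)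
      (integrable_norm_sq_gd.const_mul _), integral_const_mul, integral_const_mul, integral_const_mul,
      hin0, integral_norm_sq_gd]
    simp
  obtain hib := integrable_bdd_W (P := P) hW hfc hC
  have hiU := integrable_bdd_W (P := P) hW hUc (U_bounded hC)
  rw [← integral_sub hib hiU]
  have hA : Integrable (fun ω => (1 - c) ^ 2 * ‖W ω‖ ^ 2 + s ^ 2 * d) P :=
    ((integrable_norm_sq hSt).const_mul _).add (integrable_const _)
  refine abs_integral_le_integral_abs.trans
    ((integral_mono_of_nonneg (ae_of_all _ fun z => abs_nonneg _)
      (((hA.div_const t).add (integrable_const t)).const_mul _)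
      (ae_of_all _ fun ω => hpt (W ω))).trans (le_of_eq ?_))
  simp only [Pi.add_apply]
  rw [integral_const_mul, integral_add (hA.div_const t) (integrable_const t),
    integral_div, integral_add ((integrable_norm_sq hSt).const_mul _) (integrable_const _),
    integral_const_mul, integral_norm_sq_W hSt hW, hs2]
  simp only [integral_const, probReal_univ, smul_eq_mul, one_mul]
  have : (1 - c) ^ 2 * d + (1 - c ^ 2) * d = t ^ 2 := by rw [ht2]; ring
  rw [this]
  field_simp
  ring

variable (μ ν) in
-- Used when `p` is so large against `√d` that smoothing is pointless. The factor is the largest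
-- convenient one with `1.017 · 3.52 ≤ 3.58`.
lemma cutoff_le_beta234 : ENNReal.ofReal 1.017 * cutoff μ ν ≤
    beta234 μ ν (ENNReal.ofReal 1.8) (ENNReal.ofReal (3.58 + 0.55 * Real.log d))
      (ENNReal.ofReal 3.5) := by
  have hlog : 0 ≤ Real.log d := Real.log_natCast_nonneg d
  rw [cutoff, beta23, ← lintegral_const_mul' _ _ ENNReal.ofReal_ne_top]
  refine lintegral_mono fun ξ => ?_
  rw [betaXi12, betaXi123, ← lintegral_const_mul' _ _ ENNReal.ofReal_ne_top]
  refine lintegral_mono fun η => ?_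
  rw [mul_min, mul_one, ← mul_assoc, ← ENNReal.ofReal_mul (by norm_num)]
  refine min_le_min (ENNReal.ofReal_le_ofReal (by norm_num)) (le_add_right ?_)
  gcongr
  norm_num
  linarith

variable (μ ν) in
/-- The combination of the smoothed estimate and of the smoothing cost. -/
lemma lintegral_min_add_cutoff_le {L : ℝ} (hL0 : 0 ≤ L)
    (hL : L + 0.204 * 3.52 ≤ 3.58 + 0.55 * Real.log d) :
    (∫⁻ ξ, ∫⁻ η, min (ENNReal.ofReal 1.596)
      (ENNReal.ofReal L * betaXi1 ν η + ENNReal.ofReal 3.5 * betaXi2 ν η ^ (1 / 2 : ℝ))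
        ∂(ν ξ).variation ∂μ.variation) + ENNReal.ofReal 0.204 * cutoff μ ν ≤
    beta234 μ ν (ENNReal.ofReal 1.8) (ENNReal.ofReal (3.58 + 0.55 * Real.log d))
      (ENNReal.ofReal 3.5) := by
  rw [cutoff, beta23, ← lintegral_const_mul' _ _ ENNReal.ofReal_ne_top]
  -- The lower integral is superadditive without any measurability of the integrands.
  refine (le_lintegral_add _ _).trans (lintegral_mono fun ξ => ?_)
  simp only []
  rw [betaXi12, betaXi123, ← lintegral_const_mul' _ _ ENNReal.ofReal_ne_top]
  refine (le_lintegral_add _ _).trans (lintegral_mono fun η => ?_)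
  simp only []
  refine le_min ?_ ?_
  · calc _ ≤ ENNReal.ofReal 1.596 + ENNReal.ofReal 0.204 * 1 := by
          gcongr <;> exact min_le_left _ _
      _ = ENNReal.ofReal 1.8 := by
          rw [mul_one, ← ENNReal.ofReal_add (by norm_num) (by norm_num)]; norm_num
  · calc _ ≤ (ENNReal.ofReal L * betaXi1 ν η + ENNReal.ofReal 3.5 * betaXi2 ν η ^ (1 / 2 : ℝ)) +
          ENNReal.ofReal 0.204 * (ENNReal.ofReal 3.52 * betaXi1 ν η) := by
          gcongr <;> exact min_le_right _ _
      _ = ENNReal.ofReal (L + 0.204 * 3.52) * betaXi1 ν η +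
          ENNReal.ofReal 3.5 * betaXi2 ν η ^ (1 / 2 : ℝ) := by
          rw [ENNReal.ofReal_add hL0 (by norm_num), ENNReal.ofReal_mul (by norm_num)]
          ring
      _ ≤ _ := by gcongr

section Smoothed

variable (hW : Measurable W) (hSt : Standardized P W)
  (hV : MeasurableFamily Q V) (hS : SizeBias P W Q V μ) (hPx : Proximity P W Q V ν)
  (hβ : beta2 μ ν < ⊤)
  {f : Euc d → ℝ} {M : ℝ} (hf : IsTest f) (hM0 : 0 ≤ M) (hM : ∀ x u, |dd u f x| ≤ M * ‖u‖)

lemma abs_sub_T_one_le {a b : ℝ} (hf : IsTest f) (hM : ∀ x u, |dd u f x| ≤ M * ‖u‖)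
    (ha : 0 ≤ a) (hab : a ≤ b) (hb : b < 1) (η : Ξ) (u w : Euc d) :
    |∫ ω, T 1 a b (dd w (dd u f)) (W ω) ∂P - ∫ ω, T 1 a b (dd w (dd u f)) (V η ω) ∂(Q η)| ≤
      2 * (M * (e1 * (√(1 - a ^ 2) - √(1 - b ^ 2)))) * ‖u‖ * ‖w‖ := by
  refine (abs_sub _ _).trans ?_
  have i1 := abs_integral_le_of_bdd (ρ := P) (fun ω => abs_T_one_le hf hM ha hab hb w u (W ω))
  have i2 := abs_integral_le_of_bdd (ρ := Q η) (fun ω => abs_T_one_le hf hM ha hab hb w u (V η ω))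
  linarith

include hW hSt hV hS hPx hβ hf hM0 hM

/-- Proximity is used twice, with the bootstrapped mean of the third-order averages and the supremum
of the fourth-order ones. -/
lemma ofReal_abs_sub_T_le {c s0 ℓ : ℝ} (hc0 : 0 ≤ c) (hc : c < 1) (hs0 : 0 < s0)
    (hsb : s0 ≤ √(1 - c ^ 2)) (hℓ : 0 ≤ ℓ) (hp0 : 0 < (cutoff μ ν).toReal)
    (hℓs : Real.log (0.94 / e2 * (cutoff μ ν).toReal) - Real.log s0 ≤ ℓ) (η : Ξ) (u w : Euc d) :
    ENNReal.ofReal |∫ ω, T 1 0 c (dd w (dd u f)) (W ω) ∂P -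
        ∫ ω, T 1 0 c (dd w (dd u f)) (V η ω) ∂(Q η)| ≤
      (ENNReal.ofReal (M * (e2 * (4 / 3 + ℓ))) * betaXi1 ν η +
        ENNReal.ofReal (M * (e3 / √(1 - c ^ 2))) * betaXi2 ν η) * ‖u‖ₑ * ‖w‖ₑ := by
  have he2 : (0 : ℝ) < e2 := by unfold e2; norm_num
  have he3 : (0 : ℝ) < e3 := by unfold e3; norm_num
  have hs := sqrt_pos_of_mem hc0 hc
  have hF : IsTest (dd w (dd u f)) := (hf.dd u).dd w
  refine (proximity_two hV hPx (φ := T 1 0 c (dd w (dd u f))) (T_SB le_rfl hc.le (hF.SB 2))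
    (L := ENNReal.ofReal (M * (e2 * (4 / 3 + ℓ)) * ‖u‖ * ‖w‖))
    (K := ENNReal.ofReal (M * (e3 / √(1 - c ^ 2)) * ‖u‖ * ‖w‖)) ENNReal.ofReal_ne_top
    (fun y => ?_) (fun x y z => ?_) η).trans (le_of_eq ?_)
  · rw [dd_T le_rfl hc.le (hF.SB 1), ← ofReal_norm, ← ENNReal.ofReal_mul (by positivity)]
    refine ENNReal.ofReal_le_ofReal ((abs_integral_T_two_le hW hSt hV hS hPx hβ hf hM0 hM hc0 hc
      hs0 hsb hℓ hp0 hℓs y w u).trans (le_of_eq (by ring)))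
  · rw [dd_T le_rfl hc.le (hF.SB 1), dd_T le_rfl hc.le ((hF.dd y).SB 1), ← ofReal_norm,
      ← ofReal_norm, ← ENNReal.ofReal_mul (by positivity), ← ENNReal.ofReal_mul (by positivity)]
    exact ENNReal.ofReal_le_ofReal ((abs_T_three_le hf hM0 hM hc0 hc z y w u x).trans
      (le_of_eq (by ring)))
  · rw [ofReal_mul_norm_mul_norm (by positivity), ofReal_mul_norm_mul_norm (by positivity)]
    ring

lemma ofReal_abs_sub_T_le_min {c ℓ : ℝ} (hc0 : 0 ≤ c) (hc : c < 1) (hℓ : 0 ≤ ℓ)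
    (hp0 : 0 < (cutoff μ ν).toReal)
    (hℓs : Real.log (0.94 / e2 * (cutoff μ ν).toReal) - Real.log (√(1 - c ^ 2)) ≤ ℓ)
    (η : Ξ) (u w : Euc d) :
    ENNReal.ofReal |∫ ω, T 1 0 c (dd w (dd u f)) (W ω) ∂P -
        ∫ ω, T 1 0 c (dd w (dd u f)) (V η ω) ∂(Q η)| ≤
      ENNReal.ofReal M * min (ENNReal.ofReal 1.596)
        (ENNReal.ofReal (e2 * (4 / 3 + ℓ)) * betaXi1 ν η +
          ENNReal.ofReal 3.5 * betaXi2 ν η ^ (1 / 2 : ℝ)) * ‖u‖ₑ * ‖w‖ₑ := by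
  have he2 : (0 : ℝ) < e2 := by unfold e2; norm_num
  set s0 := √(1 - c ^ 2) with hs0d
  have hs0 : 0 < s0 := sqrt_pos_of_mem hc0 hc
  have hs01 : s0 ≤ 1 := by
    rw [hs0d, Real.sqrt_le_left zero_le_one]; nlinarith [sq_nonneg c]
  have hcap : ENNReal.ofReal |∫ ω, T 1 0 c (dd w (dd u f)) (W ω) ∂P -
        ∫ ω, T 1 0 c (dd w (dd u f)) (V η ω) ∂(Q η)| ≤
      ENNReal.ofReal M * ENNReal.ofReal 1.596 * ‖u‖ₑ * ‖w‖ₑ := by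
    rw [← ENNReal.ofReal_mul hM0]
    refine ofReal_abs_le_two (by positivity) ((abs_sub_T_one_le hf hM le_rfl hc0 hc η u w).trans ?_)
    refine mul_le_mul_of_nonneg_right (mul_le_mul_of_nonneg_right ?_ (norm_nonneg _))
      (norm_nonneg _)
    have h := mul_le_mul e1_le (by linarith : 1 - s0 ≤ 1) (by linarith) (by norm_num)
    have e : √(1 - (0 : ℝ) ^ 2) = 1 := by simp
    rw [e]
    calc 2 * (M * (e1 * (1 - s0))) ≤ 2 * (M * (0.798 * 1)) := by gcongr
      _ = M * 1.596 := by ring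
  set r := betaXi2 ν η ^ (1 / 2 : ℝ) with hr
  -- At `r = 0.456` the term `3.5 r` reaches the cap `1.596`, so beyond that the crude bound
  -- suffices.
  rcases le_or_gt (ENNReal.ofReal 0.456) r with h | h
  · rw [min_eq_left]
    · exact hcap
    · calc ENNReal.ofReal 1.596 = ENNReal.ofReal 3.5 * ENNReal.ofReal 0.456 := by
            rw [← ENNReal.ofReal_mul (by norm_num)]; norm_num
        _ ≤ ENNReal.ofReal 3.5 * r := by gcongr
        _ ≤ _ := le_add_self
  · rw [mul_min, mul_assoc, mul_comm, mul_min]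
    refine le_min (hcap.trans (le_of_eq (by ring))) ?_
    have hrt : r ≠ ⊤ := h.ne_top
    set q := r.toReal with hq
    have hrq : r = ENNReal.ofReal q := (ENNReal.ofReal_toReal hrt).symm
    have hq0 : 0 ≤ q := ENNReal.toReal_nonneg
    have hq1 : q < 0.456 := by
      rw [hrq] at h
      exact (ENNReal.ofReal_lt_ofReal_iff (by norm_num)).1 h
    have hβ2 : betaXi2 ν η = ENNReal.ofReal (q ^ 2) := by
      rw [ENNReal.ofReal_pow hq0, ← hrq, hr, ← ENNReal.rpow_natCast, ← ENNReal.rpow_mul]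
      norm_num
    -- The noise level at which the average is cut. It nearly balances `e3 q² / s` against `2 e1 s`,
    -- the optimal ratio `s / q` being `√(1.8 / 1.596)`. The two parts together stay below `3.5 q`.
    set s := max s0 (1.06 * q) with hs
    have hss0 : s0 ≤ s := le_max_left _ _
    have hspos : 0 < s := hs0.trans_le hss0
    have hs1 : s ≤ 1 := max_le hs01 (by linarith)
    set b := √(1 - s ^ 2) with hb
    have hbs : √(1 - b ^ 2) = s := sqrt_one_sub_sqrt hspos.le hs1
    have hb0 : 0 ≤ b := Real.sqrt_nonneg _
    have hbc : b ≤ c := by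
      rw [hb, Real.sqrt_le_left hc0]
      have := pow_le_pow_left₀ hs0.le hss0 2
      rw [hs0d, Real.sq_sqrt (one_sub_sq_pos hc0 hc).le] at this
      linarith
    have hF : IsTest (dd w (dd u f)) := (hf.dd u).dd w
    have h1 := ofReal_abs_sub_T_le hW hSt hV hS hPx hβ hf hM0 hM hb0 (hbc.trans_lt hc) hs0
      (by rw [hbs]; exact hss0) hℓ hp0 hℓs η u w
    have h2 := ofReal_abs_le_two (by
      rw [hbs]
      have := e1_nonneg
      have : 0 ≤ s - s0 := by linarith
      positivity) (abs_sub_T_one_le (P := P) (Q := Q) (V := V) (W := W) hf hM hb0 hbc hc η u w)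
    rw [hbs] at h1 h2
    rw [integral_T_split P hW hb0 hbc hc.le (hF.SB 0),
      integral_T_split (Q η) (hV.measurable η) hb0 hbc hc.le (hF.SB 0), add_sub_add_comm]
    refine (ENNReal.ofReal_le_ofReal (abs_add_le _ _)).trans
      (ENNReal.ofReal_add_le.trans ((add_le_add h1 h2).trans ?_))
    have hfin : M * (e3 / s) * q ^ 2 + 2 * (M * (e1 * (s - s0))) ≤ M * (3.5 * q) := by
      have a1 : e3 / s * q ^ 2 ≤ 1.7 * q := by
        rw [div_mul_eq_mul_div, div_le_iff₀ hspos]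
        have : 1.06 * q ≤ s := le_max_right _ _
        unfold e3
        nlinarith
      have a2 : e1 * (s - s0) ≤ 0.798 * (1.06 * q) := by
        refine mul_le_mul e1_le ?_ (by linarith) (by norm_num)
        rw [sub_le_iff_le_add]
        exact max_le (by linarith) (by linarith)
      calc _ = M * (e3 / s * q ^ 2 + 2 * (e1 * (s - s0))) := by ring
        _ ≤ _ := by gcongr; linarith
    have hfin2 : ENNReal.ofReal (M * (e3 / s)) * betaXi2 ν η +
        ENNReal.ofReal (2 * (M * (e1 * (s - s0)))) ≤ ENNReal.ofReal M * (ENNReal.ofReal 3.5 * r) := by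
      have he3 : (0 : ℝ) < e3 := by unfold e3; norm_num
      have : 0 ≤ s - s0 := by linarith
      have := e1_nonneg
      rw [hβ2, hrq, ← ENNReal.ofReal_mul (by positivity), ← ENNReal.ofReal_mul (by norm_num),
        ← ENNReal.ofReal_mul hM0, ← ENNReal.ofReal_add (by positivity) (by positivity)]
      exact ENNReal.ofReal_le_ofReal hfin
    rw [ENNReal.ofReal_mul hM0 (q := e2 * (4 / 3 + ℓ))]
    calc _ = (ENNReal.ofReal M * (ENNReal.ofReal (e2 * (4 / 3 + ℓ)) * betaXi1 ν η) +
          (ENNReal.ofReal (M * (e3 / s)) * betaXi2 ν η +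
            ENNReal.ofReal (2 * (M * (e1 * (s - s0)))))) * (‖u‖ₑ * ‖w‖ₑ) := by ring
      _ ≤ (ENNReal.ofReal M * (ENNReal.ofReal (e2 * (4 / 3 + ℓ)) * betaXi1 ν η) +
          ENNReal.ofReal M * (ENNReal.ofReal 3.5 * r)) * (‖u‖ₑ * ‖w‖ₑ) := by gcongr
      _ = _ := by ring

lemma enorm_sub_le_beta234_of_test (hd : 1 ≤ d) :
    ‖∫ ω, f (W ω) ∂P - ∫ z, f z ∂gd d‖ₑ ≤
      beta234 μ ν (ENNReal.ofReal 1.8) (ENNReal.ofReal (3.58 + 0.55 * Real.log d))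
        (ENNReal.ofReal 3.5) * ENNReal.ofReal M := by
  have hlog : 0 ≤ Real.log d := Real.log_natCast_nonneg d
  have hd0 : (0 : ℝ) < d := by exact_mod_cast hd
  -- If `cutoff` vanishes, so does the second-order bound, since a test function has some finite
  -- Hessian bound. The logarithm of `p` is thus avoided at zero.
  rcases eq_or_ne (cutoff μ ν) 0 with h0 | h0
  · obtain ⟨C, hC0, hC⟩ := hf.exists_hessian_bound
    have h := enorm_sub_le_beta23_of_test hW hSt hV hS hPx hβ hf hC0 hC
    have h2 : beta23 μ ν 1 (ENNReal.ofReal (√(2 * Real.pi) / 4)) ≤ cutoff μ ν := by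
      refine lintegral_mono fun ξ => lintegral_mono fun η => ?_
      gcongr
      have : √(2 * Real.pi) ≤ 3 := by
        rw [Real.sqrt_le_left (by norm_num)]
        nlinarith [Real.pi_lt_four]
      linarith
    rw [h0, nonpos_iff_eq_zero] at h2
    rw [h2, zero_mul] at h
    exact h.trans zero_le
  set p := (cutoff μ ν).toReal with hp
  have hpt := (cutoff_lt_top hβ).ne
  have hp0 : 0 < p := ENNReal.toReal_pos h0 hpt
  have hcp : cutoff μ ν = ENNReal.ofReal p := (ENNReal.ofReal_toReal hpt).symm
  set D := √(d : ℝ) with hD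
  have hD0 : 0 < D := Real.sqrt_pos.2 hd0
  have hD2 : D ^ 2 = d := Real.sq_sqrt hd0.le
  rcases le_or_gt (0.204 * p) (0.3 * D) with hε | hε
  · set ε := 0.204 * p / D with hεd
    have hε0 : 0 < ε := by positivity
    have hε1 : ε ≤ 0.3 := by rw [hεd, div_le_iff₀ hD0]; exact hε
    have hεD : ε * D = 0.204 * p := div_mul_cancel₀ _ hD0.ne'
    -- Chosen so that `2 (1 - c) d = (ε √d)²`, which makes the smoothing cost exactly `0.204 p M`.
    set c := 1 - ε ^ 2 / 2 with hc
    have hc0 : 0 ≤ c := by nlinarith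
    have hc1 : c < 1 := by have : 0 < ε ^ 2 := by positivity
                           linarith
    have h1 := abs_integral_sub_U_le hd hW hSt hf hM0 hM hc0 hc1.le
    have e1 : √(2 * (1 - c) * d) = 0.204 * p := by
      rw [← hεD, ← hD2, show 2 * (1 - c) * D ^ 2 = (ε * D) ^ 2 by rw [hc]; ring,
        Real.sqrt_sq (by positivity)]
    rw [e1] at h1
    -- Here `1 - c² = ε² (1 - ε²/4)`, and `ε ≤ 0.3` makes the second factor at least `0.9775`, which
    -- exceeds `0.9886²`.
    have hs : 0.9886 * ε ≤ √(1 - c ^ 2) := by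
      refine Real.le_sqrt_of_sq_le ?_
      have : 1 - c ^ 2 = ε ^ 2 * (1 - ε ^ 2 / 4) := by rw [hc]; ring
      rw [this, mul_pow, mul_comm]
      have h2 : ε ^ 2 ≤ 0.09 := by nlinarith
      gcongr
      norm_num at h2 ⊢
      linarith
    have hs0 : 0 < √(1 - c ^ 2) := sqrt_pos_of_mem hc0 hc1
    -- The number `4 · 1.205 · 0.9886 · 0.204` just exceeds `0.94 / e2`, so the ratio of levels is
    -- at most `4 · 1.205 √d`, where `log (4 · 1.205)` is below `1.592`.
    set ℓ := 1.592 + Real.log d / 2 with hℓd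
    have hℓ : 0 ≤ ℓ := by positivity
    have hℓs : Real.log (0.94 / e2 * p) - Real.log (√(1 - c ^ 2)) ≤ ℓ := by
      have a1 : 0.94 / e2 * p ≤ 4 * 1.205 * D * √(1 - c ^ 2) := by
        have : 4 * 1.205 * D * (0.9886 * ε) ≤ 4 * 1.205 * D * √(1 - c ^ 2) := by gcongr
        have e : 4 * 1.205 * D * (0.9886 * ε) = 4 * 1.205 * 0.9886 * 0.204 * p := by
          linear_combination (4 * 1.205 * 0.9886) * hεD
        rw [e] at this
        refine le_trans ?_ this
        unfold e2
        gcongr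
        norm_num
      have a0 : 0 < 0.94 / e2 * p := by unfold e2; positivity
      have a2 := Real.log_le_log a0 a1
      rw [Real.log_mul (x := 4 * 1.205 * D) (by positivity) hs0.ne',
        Real.log_mul (x := 4 * 1.205) (by norm_num) hD0.ne',
        Real.log_mul (x := 4) (by norm_num) (by norm_num), hD, Real.log_sqrt hd0.le] at a2
      have h4 : Real.log 4 = 2 * Real.log 2 := by
        rw [show (4 : ℝ) = 2 ^ 2 by norm_num, Real.log_pow]; norm_num
      have hl2 := Real.log_two_lt_d9
      have h5 := Real.log_le_sub_one_of_pos (by norm_num : (0 : ℝ) < 1.205)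
      linarith
    have h2 := enorm_integral_U_sub_le hW hSt hV hS hPx hβ (hf.SB 2) hc0 hc1.le
      (ofReal_abs_sub_T_le_min hW hSt hV hS hPx hβ hf hM0 hM hc0 hc1 hℓ hp0 hℓs)
    simp_rw [lintegral_const_mul' _ _ ENNReal.ofReal_ne_top] at h2
    have h3 : ‖∫ ω, f (W ω) ∂P - ∫ ω, U c f (W ω) ∂P‖ₑ ≤
        ENNReal.ofReal M * (ENNReal.ofReal 0.204 * cutoff μ ν) := by
      rw [hcp, ← ENNReal.ofReal_mul (by norm_num), ← ENNReal.ofReal_mul hM0,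
        Real.enorm_eq_ofReal_abs]
      exact ENNReal.ofReal_le_ofReal h1
    -- The constant part is `0.968 (4/3 + 1.592) + 0.204 · 3.52`, about `3.55`, and the coefficient
    -- of `log d` is `0.484`.
    have h4 := lintegral_min_add_cutoff_le μ ν (L := e2 * (4 / 3 + ℓ))
      (by unfold e2; positivity) (by rw [hℓd]; unfold e2; linarith)
    rw [← sub_add_sub_cancel _ (∫ ω, U c f (W ω) ∂P)]
    refine (enorm_add_le _ _).trans ((add_le_add h3 h2).trans ?_)
    rw [← mul_add, mul_comm, add_comm]
    gcongr
  -- For large `p` the function is smoothed completely, at `c = 0`. The whole error is then the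
  -- smoothing cost `M √(2d)`, and `√2 · 0.204 / 0.3 < 1.017`.
  · have h1 := abs_integral_sub_U_le hd hW hSt hf hM0 hM le_rfl zero_le_one
    simp only [U_zero, integral_const, probReal_univ, one_smul] at h1
    have h2 : √(2 * (1 - 0) * d) ≤ 1.017 * p := by
      refine Real.sqrt_le_iff.2 ⟨by positivity, ?_⟩
      rw [← hD2]
      nlinarith
    rw [Real.enorm_eq_ofReal_abs]
    refine (ENNReal.ofReal_le_ofReal (h1.trans (mul_le_mul_of_nonneg_left h2 hM0))).trans ?_
    rw [ENNReal.ofReal_mul hM0, mul_comm]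
    gcongr
    refine le_trans (le_of_eq ?_) (cutoff_le_beta234 μ ν)
    rw [hcp, ← ENNReal.ofReal_mul (by norm_num)]

end Smoothed

end Setting

end

end SteinCLT

/-! ### Symbol classes and slowly varying cutoffs. -/

namespace SteinCLT

noncomputable section

open Filter Topology Set
open scoped NNReal RealInnerProductSpace ContDiff

variable {d : ℕ}

lemma dd_add_fun {f g : Euc d → ℝ} (hf : Differentiable ℝ f) (hg : Differentiable ℝ g)
    (u : Euc d) : dd u (fun x => f x + g x) = fun x => dd u f x + dd u g x := by
  ext x
  simp [dd, fderiv_fun_add (hf x) (hg x)]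

lemma dd_mul_fun {f g : Euc d → ℝ} (hf : Differentiable ℝ f) (hg : Differentiable ℝ g)
    (u : Euc d) : dd u (fun x => f x * g x) = fun x => dd u f x * g x + f x * dd u g x := by
  ext x
  simp [dd, fderiv_fun_mul (hf x) (hg x)]
  ring

lemma dd_const (c : ℝ) (u : Euc d) : dd u (fun _ : Euc d => c) = fun _ => 0 := by
  ext x; simp [dd]

lemma bracket_pos (x : Euc d) : 0 < bracket x := zero_lt_one.trans_le (one_le_bracket x)

/-- `f` and its directional derivatives up to the order `n` are controlled by powers of the
bracket, the exponent decreasing by one at each derivative. -/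
def Sym : ℕ → ℤ → ℝ → (Euc d → ℝ) → Prop
  | 0, p, C, f => ∀ x, |f x| ≤ C * bracket x ^ p
  | n + 1, p, C, f => (∀ x, |f x| ≤ C * bracket x ^ p) ∧ ∀ u, Sym n (p - 1) (C * ‖u‖) (dd u f)

lemma Sym.bound {n : ℕ} {p : ℤ} {C : ℝ} {f : Euc d → ℝ} (h : Sym n p C f) (x : Euc d) :
    |f x| ≤ C * bracket x ^ p := by
  cases n with
  | zero => exact h x
  | succ n => exact h.1 x

lemma Sym.nonneg {n : ℕ} {p : ℤ} {C : ℝ} {f : Euc d → ℝ} (h : Sym n p C f) : 0 ≤ C := by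
  have := (abs_nonneg _).trans (h.bound 0)
  exact nonneg_of_mul_nonneg_left this (zpow_pos (bracket_pos 0) p)

lemma Sym.pred {n : ℕ} {p : ℤ} {C : ℝ} {f : Euc d → ℝ} (h : Sym (n + 1) p C f) : Sym n p C f := by
  induction n generalizing p C f with
  | zero => exact h.1
  | succ n ih => exact ⟨h.1, fun u => ih (h.2 u)⟩

lemma Sym.mono {n : ℕ} {p : ℤ} {C D : ℝ} (hCD : C ≤ D) {f : Euc d → ℝ} (h : Sym n p C f) :
    Sym n p D f := by
  have hb : ∀ x, |f x| ≤ D * bracket x ^ p := fun x =>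
    (h.bound x).trans (mul_le_mul_of_nonneg_right hCD (zpow_pos (bracket_pos x) p).le)
  induction n generalizing p C D f with
  | zero => exact hb
  | succ n ih =>
    refine ⟨hb, fun u => ?_⟩
    have h2 : C * ‖u‖ ≤ D * ‖u‖ := by gcongr
    exact ih h2 (h.2 u) fun x => ((h.2 u).bound x).trans
      (mul_le_mul_of_nonneg_right h2 (zpow_pos (bracket_pos x) _).le)

lemma Sym.add {n : ℕ} {p : ℤ} {C D : ℝ} {f g : Euc d → ℝ} (hf : ContDiff ℝ ∞ f)
    (hg : ContDiff ℝ ∞ g) (h : Sym n p C f) (k : Sym n p D g) :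
    Sym n p (C + D) (fun x => f x + g x) := by
  have hb : ∀ x, |f x + g x| ≤ (C + D) * bracket x ^ p := fun x =>
    (abs_add_le _ _).trans ((add_le_add (h.bound x) (k.bound x)).trans (le_of_eq (by ring)))
  induction n generalizing p C D f g with
  | zero => exact hb
  | succ n ih =>
    refine ⟨hb, fun u => ?_⟩
    rw [dd_add_fun (hf.differentiable (by simp)) (hg.differentiable (by simp)), add_mul]
    exact ih (contDiff_dd hf u) (contDiff_dd hg u) (h.2 u) (k.2 u) fun x =>
      (abs_add_le _ _).trans ((add_le_add ((h.2 u).bound x) ((k.2 u).bound x)).trans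
        (le_of_eq (by ring)))

lemma Sym.const_mul {n : ℕ} {p : ℤ} {C : ℝ} {f : Euc d → ℝ} (a : ℝ) (h : Sym n p C f) :
    Sym n p (|a| * C) (fun x => a * f x) := by
  induction n generalizing p C f with
  | zero =>
    intro x
    rw [abs_mul, mul_assoc]
    exact mul_le_mul_of_nonneg_left (h x) (abs_nonneg a)
  | succ n ih =>
    refine ⟨fun x => ?_, fun u => ?_⟩
    · rw [abs_mul, mul_assoc]
      exact mul_le_mul_of_nonneg_left (h.1 x) (abs_nonneg a)
    · rw [dd_const_mul, mul_assoc]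
      exact ih (h.2 u)

/-- The product rule doubles the number of terms with each derivative, hence `2 ^ n`. -/
lemma Sym.mul {n : ℕ} {p q : ℤ} {C D : ℝ} {f g : Euc d → ℝ} (hf : ContDiff ℝ ∞ f)
    (hg : ContDiff ℝ ∞ g) (h : Sym n p C f) (k : Sym n q D g) :
    Sym n (p + q) (2 ^ n * C * D) (fun x => f x * g x) := by
  have hb : ∀ {n : ℕ} {p q : ℤ} {C D : ℝ} {f g : Euc d → ℝ}, Sym n p C f → Sym n q D g → ∀ x,
      |f x * g x| ≤ C * D * bracket x ^ (p + q) := fun h k x => by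
    rw [abs_mul, zpow_add₀ (bracket_pos x).ne']
    refine (mul_le_mul (h.bound x) (k.bound x) (abs_nonneg _)
      (mul_nonneg h.nonneg (zpow_pos (bracket_pos x) _).le)).trans (le_of_eq (by ring))
  induction n generalizing p q C D f g with
  | zero => exact fun x => (hb h k x).trans (le_of_eq (by ring))
  | succ n ih =>
    refine ⟨fun x => (hb h k x).trans ?_, fun u => ?_⟩
    · refine mul_le_mul_of_nonneg_right ?_ (zpow_pos (bracket_pos x) _).le
      rw [mul_assoc]
      exact le_mul_of_one_le_left (mul_nonneg h.nonneg k.nonneg) (one_le_pow₀ (by norm_num))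
    · rw [dd_mul_fun (hf.differentiable (by simp)) (hg.differentiable (by simp))]
      have h1 := ih (contDiff_dd hf u) hg (h.2 u) k.pred
      have h2 := ih hf (contDiff_dd hg u) h.pred (k.2 u)
      rw [show p - 1 + q = p + q - 1 by ring] at h1
      rw [show p + (q - 1) = p + q - 1 by ring] at h2
      exact (h1.add ((contDiff_dd hf u).mul hg) (hf.mul (contDiff_dd hg u)) h2).mono
        (le_of_eq (by ring))

lemma Sym_zero (n : ℕ) (p : ℤ) : Sym n p 0 (fun _ : Euc d => 0) := by
  induction n generalizing p with
  | zero => intro x; simp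
  | succ n ih =>
    refine ⟨fun x => by simp, fun u => ?_⟩
    rw [dd_const, zero_mul]
    exact ih _

lemma Sym_sum {ι : Type*} (s : Finset ι) (r : ι → ℝ) {n : ℕ} {p : ℤ} {C : ι → ℝ}
    {F : ι → Euc d → ℝ} (hF : ∀ i, ContDiff ℝ ∞ (F i)) (h : ∀ i, Sym n p (C i) (F i)) :
    Sym n p (∑ i ∈ s, |r i| * C i) (fun x => ∑ i ∈ s, r i * F i x) := by
  classical
  induction s using Finset.induction_on with
  | empty => simpa using Sym_zero n p
  | insert i s hi ih =>
    simp_rw [Finset.sum_insert hi]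
    exact ((h i).const_mul (r i)).add (contDiff_const.mul (hF i))
      (ContDiff.sum fun j _ => contDiff_const.mul (hF j)) ih

lemma Sym_const (n : ℕ) (c : ℝ) : Sym n 0 |c| (fun _ : Euc d => c) := by
  cases n with
  | zero => intro x; simp
  | succ n =>
    refine ⟨fun x => by simp, fun u => ?_⟩
    rw [dd_const]
    exact (Sym_zero n _).mono (by positivity)

lemma Sym_inner (n : ℕ) (u : Euc d) : Sym n 1 ‖u‖ (fun x => ⟪u, x⟫) := by
  have hb : ∀ x : Euc d, |⟪u, x⟫| ≤ ‖u‖ * bracket x ^ (1 : ℤ) := fun x => by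
    rw [zpow_one]
    exact (abs_real_inner_le_norm u x).trans
      (mul_le_mul_of_nonneg_left (norm_le_bracket x) (norm_nonneg u))
  cases n with
  | zero => exact hb
  | succ n =>
    refine ⟨hb, fun v => ?_⟩
    have : dd v (fun x => ⟪u, x⟫) = fun _ => ⟪u, v⟫ := by
      ext x
      change fderiv ℝ (innerSL ℝ u) x v = _
      rw [ContinuousLinearMap.fderiv]
      rfl
    rw [this]
    exact (Sym_const n _).mono (abs_real_inner_le_norm u v)

lemma contDiff_bracket_zpow (p : ℤ) : ContDiff ℝ ∞ (fun x : Euc d => bracket x ^ p) := by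
  obtain ⟨n, rfl | rfl⟩ := p.eq_nat_or_neg
  · simpa using (contDiff_bracket (d := d)).pow n
  · simp only [zpow_neg, zpow_natCast]
    exact ((contDiff_bracket (d := d)).pow n).inv fun x => (pow_pos (bracket_pos x) n).ne'

lemma dd_bracket (u x : Euc d) : dd u bracket x = bracket x ^ (-1 : ℤ) * ⟪u, x⟫ := by
  rw [dd, (hasFDerivAt_bracket x).fderiv, zpow_neg_one, real_inner_comm]
  have := bracket_pos x
  simp
  field_simp

lemma dd_bracket_zpow (p : ℤ) (u : Euc d) : dd u (fun x : Euc d => bracket x ^ p) =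
    fun x => p * (bracket x ^ (p - 2) * ⟪u, x⟫) := by
  ext x
  have h := (hasDerivAt_zpow p (bracket x) (Or.inl (bracket_pos x).ne')).comp_hasFDerivAt x
    (contDiff_bracket.differentiable (n := 1) (by simp) x).hasFDerivAt
  have h2 : dd u (fun x : Euc d => bracket x ^ p) x = p * bracket x ^ (p - 1) * dd u bracket x := by
    rw [dd, show (fun x : Euc d => bracket x ^ p) = (fun t : ℝ => t ^ p) ∘ bracket from rfl,
      h.fderiv]
    simp [dd]
  rw [h2, dd_bracket, show p - 2 = p - 1 + -1 by ring, zpow_add₀ (bracket_pos x).ne']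
  ring

lemma contDiff_inner_left (u : Euc d) : ContDiff ℝ ∞ (fun x : Euc d => ⟪u, x⟫) :=
  contDiff_const.inner ℝ contDiff_id

lemma Sym_bracket_zpow (n : ℕ) (p : ℤ) : ∃ C, Sym n p C (fun x : Euc d => bracket x ^ p) := by
  have hb : ∀ (p : ℤ) (x : Euc d), |bracket x ^ p| ≤ 1 * bracket x ^ p := fun p x => by
    rw [one_mul, abs_of_pos (zpow_pos (bracket_pos x) p)]
  induction n generalizing p with
  | zero => exact ⟨1, hb p⟩
  | succ n ih =>
    obtain ⟨C, hC⟩ := ih (p - 2)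
    refine ⟨max 1 (|(p : ℝ)| * (2 ^ n * C)), fun x => (hb p x).trans ?_, fun u => ?_⟩
    · exact mul_le_mul_of_nonneg_right (le_max_left _ _) (zpow_pos (bracket_pos x) _).le
    · rw [dd_bracket_zpow]
      have h := (hC.mul (contDiff_bracket_zpow _) (contDiff_inner_left u) (Sym_inner n u)).const_mul
        (p : ℝ)
      rw [show p - 2 + 1 = p - 1 by ring] at h
      refine h.mono ?_
      calc _ = |(p : ℝ)| * (2 ^ n * C) * ‖u‖ := by ring
        _ ≤ _ := mul_le_mul_of_nonneg_right (le_max_right _ _) (norm_nonneg u)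

section LogCutoff

lemma contDiff_comp_log {θ : ℝ → ℝ} (hθ : ContDiff ℝ ∞ θ) (ε : ℝ) :
    ContDiff ℝ ∞ (fun x : Euc d => θ (ε * Real.log (bracket x))) :=
  hθ.comp (contDiff_const.mul ((contDiff_bracket (d := d)).log fun x => (bracket_pos x).ne'))

lemma dd_comp_log {θ : ℝ → ℝ} (hθ : ContDiff ℝ ∞ θ) (ε : ℝ) (u : Euc d) :
    dd u (fun x : Euc d => θ (ε * Real.log (bracket x))) = fun x =>
      ε * (deriv θ (ε * Real.log (bracket x)) * (bracket x ^ (-2 : ℤ) * ⟪u, x⟫)) := by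
  ext x
  have h1 := ((contDiff_bracket.differentiable (n := 1) (by simp) x).hasFDerivAt.log
    (bracket_pos x).ne').const_mul ε
  have h2 := (hθ.differentiable (by simp) _).hasDerivAt.comp_hasFDerivAt x h1
  rw [dd, show (fun x : Euc d => θ (ε * Real.log (bracket x))) =
    θ ∘ fun x => ε * Real.log (bracket x) from rfl, h2.fderiv]
  have h3 : fderiv ℝ bracket x u = bracket x ^ (-1 : ℤ) * ⟪u, x⟫ := dd_bracket u x
  simp only [smul_apply, smul_eq_mul, h3]
  rw [show (-2 : ℤ) = -1 + -1 by norm_num, zpow_add₀ (bracket_pos x).ne', zpow_neg_one]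
  ring

/-- Every derivative of `ε log (bracket x)` yields a decay of one order and a factor `ε ≤ 1`. The
class is therefore of order zero uniformly in `ε`, although the cutoff region grows exponentially in
`1/ε`. -/
lemma Sym_comp_log (n : ℕ) {θ : ℝ → ℝ} (hθ : ContDiff ℝ ∞ θ) (hc : HasCompactSupport θ) :
    ∃ C, ∀ ε, 0 ≤ ε → ε ≤ 1 → Sym n 0 C (fun x : Euc d => θ (ε * Real.log (bracket x))) := by
  obtain ⟨B, hB⟩ := hc.exists_bound_of_continuous hθ.continuous
  induction n generalizing θ B with
  | zero => exact ⟨B, fun ε _ _ x => by simpa using hB _⟩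
  | succ n ih =>
    have hθ' : ContDiff ℝ ∞ (deriv θ) := ContDiff.deriv' hθ
    obtain ⟨B', hB'⟩ := hc.deriv.exists_bound_of_continuous hθ'.continuous
    obtain ⟨C, hC⟩ := ih hθ' hc.deriv B' hB'
    obtain ⟨D, hD⟩ := Sym_bracket_zpow (d := d) n (-2)
    have hD0 := hD.nonneg
    have hC0 := (hC 0 le_rfl zero_le_one).nonneg
    refine ⟨max B (2 ^ n * C * (2 ^ n * D)), fun ε h0 h1 => ⟨fun x => ?_, fun u => ?_⟩⟩
    · simpa using (hB _).trans (le_max_left _ _)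
    · rw [dd_comp_log hθ]
      have h := ((hC ε h0 h1).mul (contDiff_comp_log hθ' ε)
        ((contDiff_bracket_zpow _).mul (contDiff_inner_left u))
        (hD.mul (contDiff_bracket_zpow _) (contDiff_inner_left u) (Sym_inner n u))).const_mul ε
      refine Sym.mono ?_ h
      rw [abs_of_nonneg h0]
      calc _ ≤ 1 * (2 ^ n * C * (2 ^ n * D * ‖u‖)) := by gcongr
        _ = 2 ^ n * C * (2 ^ n * D) * ‖u‖ := by ring
        _ ≤ _ := mul_le_mul_of_nonneg_right (le_max_right _ _) (norm_nonneg u)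

/-- The derivatives of a slowly varying cutoff. -/
lemma Sym_dd_comp_log (n : ℕ) {θ : ℝ → ℝ} (hθ : ContDiff ℝ ∞ θ) (hc : HasCompactSupport θ) :
    ∃ C, ∀ ε, 0 ≤ ε → ε ≤ 1 → ∀ u,
      Sym n (-1) (ε * C * ‖u‖) (dd u (fun x : Euc d => θ (ε * Real.log (bracket x)))) := by
  have hθ' : ContDiff ℝ ∞ (deriv θ) := ContDiff.deriv' hθ
  obtain ⟨C, hC⟩ := Sym_comp_log (d := d) n hθ' hc.deriv
  obtain ⟨D, hD⟩ := Sym_bracket_zpow (d := d) n (-2)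
  refine ⟨2 ^ n * C * (2 ^ n * D), fun ε h0 h1 u => ?_⟩
  rw [dd_comp_log hθ]
  have h := ((hC ε h0 h1).mul (contDiff_comp_log hθ' ε)
    ((contDiff_bracket_zpow _).mul (contDiff_inner_left u))
    (hD.mul (contDiff_bracket_zpow _) (contDiff_inner_left u) (Sym_inner n u))).const_mul ε
  exact Sym.mono (le_of_eq (by rw [abs_of_nonneg h0]; ring)) h

end LogCutoff

/-- The directional derivatives of order `n` are bounded by `m`. -/
def Top : ℕ → ℝ → (Euc d → ℝ) → Prop
  | 0, m, f => ∀ x, |f x| ≤ m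
  | n + 1, m, f => ∀ u, Top n (m * ‖u‖) (dd u f)

lemma Top.add {n : ℕ} {m l : ℝ} {f g : Euc d → ℝ} (hf : ContDiff ℝ ∞ f)
    (hg : ContDiff ℝ ∞ g) (h : Top n m f) (k : Top n l g) :
    Top n (m + l) (fun x => f x + g x) := by
  induction n generalizing m l f g with
  | zero => exact fun x => (abs_add_le _ _).trans (add_le_add (h x) (k x))
  | succ n ih =>
    intro u
    rw [dd_add_fun (hf.differentiable (by simp)) (hg.differentiable (by simp)), add_mul]
    exact ih (contDiff_dd hf u) (contDiff_dd hg u) (h u) (k u)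

lemma Sym.top {n : ℕ} {C : ℝ} {f : Euc d → ℝ} (h : Sym n n C f) : Top n C f := by
  induction n generalizing C f with
  | zero => exact fun x => by simpa using h x
  | succ n ih =>
    intro u
    refine ih ?_
    have := h.2 u
    rwa [show ((n + 1 : ℕ) : ℤ) - 1 = n by push_cast; ring] at this

/-- In the product rule the terms that differentiate `χ` carry a factor `ε`, and the decay of its
derivatives exactly compensates the growth of the lower derivatives of `f`. Only the
undifferentiated `χ` meets the top derivative. -/
lemma Top.mul_cutoff {n : ℕ} {m C ε : ℝ} {f χ : Euc d → ℝ} (hf : ContDiff ℝ ∞ f)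
    (hχ : ContDiff ℝ ∞ χ) (h : Top n m f) (hS : Sym n n C f) (h1 : ∀ x, |χ x| ≤ 1)
    (hε0 : 0 ≤ ε) (hε : ∀ k < n, ∀ u, Sym k (-1) (ε * ‖u‖) (dd u χ)) :
    Top n (m + 2 ^ n * C * ε) (fun x => f x * χ x) := by
  induction n generalizing m C f with
  | zero =>
    intro x
    have hx := h x
    have hC := hS.nonneg
    rw [abs_mul]
    calc |f x| * |χ x| ≤ m * 1 := mul_le_mul hx (h1 x) (abs_nonneg _) ((abs_nonneg _).trans hx)
      _ ≤ m + 2 ^ 0 * C * ε := by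
        rw [mul_one]
        exact le_add_of_nonneg_right (by positivity)
  | succ n ih =>
    intro u
    rw [dd_mul_fun (hf.differentiable (by simp)) (hχ.differentiable (by simp))]
    have hS1 := hS.2 u
    have e : ((n + 1 : ℕ) : ℤ) - 1 = n := by push_cast; ring
    rw [e] at hS1
    have h2 := ih (contDiff_dd hf u) (h u) hS1 fun k hk => hε k (by omega)
    have h3 := hS.pred.mul hf (contDiff_dd hχ u) (hε n (by omega) u)
    rw [← sub_eq_add_neg, e] at h3
    have h4 := h2.add ((contDiff_dd hf u).mul hχ) (hf.mul (contDiff_dd hχ u)) h3.top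
    convert h4 using 1
    ring

/-- The mean value inequality on the ball of radius `‖x‖`, in which `bracket` is largest on the
boundary. -/
lemma exists_growth_of_dd {f : Euc d → ℝ} (hf : Differentiable ℝ f) {n : ℕ}
    (h : ∀ u, ∃ C, ∀ x, |dd u f x| ≤ C * bracket x ^ n) :
    ∃ C, ∀ x, |f x| ≤ C * bracket x ^ (n + 1) := by
  choose C hC using fun i : Fin d => h (EuclideanSpace.single i 1)
  have hC0 : ∀ i, 0 ≤ C i := fun i => by simpa [bracket] using (abs_nonneg _).trans (hC i 0)
  set S := ∑ i, C i
  have hS : 0 ≤ S := Finset.sum_nonneg fun i _ => hC0 i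
  refine ⟨|f 0| + S, fun x => ?_⟩
  have hb : ∀ y ∈ Metric.closedBall (0 : Euc d) ‖x‖, ‖fderiv ℝ f y‖ ≤ S * bracket x ^ n := by
    intro y hy
    have hyx : bracket y ≤ bracket x := by
      rw [mem_closedBall_zero_iff] at hy
      unfold bracket
      gcongr
    have hx0 := (bracket_pos x).le
    have hy0 := (bracket_pos y).le
    refine ContinuousLinearMap.opNorm_le_bound _ (by positivity) fun u => ?_
    change |dd u f y| ≤ _
    rw [dd_eq_sum, Finset.sum_mul, Finset.sum_mul]
    refine (Finset.abs_sum_le_sum_abs _ _).trans (Finset.sum_le_sum fun i _ => ?_)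
    rw [abs_mul, mul_comm]
    refine mul_le_mul ((hC i y).trans ?_) (PiLp.norm_apply_le u i) (abs_nonneg _)
      (mul_nonneg (hC0 i) (by positivity))
    have := hC0 i
    gcongr
  have hm := Convex.norm_image_sub_le_of_norm_fderiv_le (f := f) (𝕜 := ℝ) (fun y _ => hf y) hb
    (convex_closedBall 0 _) (x := 0) (y := x) (by simp) (by simp)
  rw [sub_zero, Real.norm_eq_abs] at hm
  have h1 := one_le_bracket x
  have h2 : 1 ≤ bracket x ^ (n + 1) := one_le_pow₀ h1
  calc |f x| ≤ |f 0| + |f x - f 0| := by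
        have := abs_add_le (f 0) (f x - f 0); rwa [add_sub_cancel] at this
    _ ≤ |f 0| * bracket x ^ (n + 1) + S * bracket x ^ n * bracket x := by
        refine add_le_add (le_mul_of_one_le_right (abs_nonneg _) h2) (hm.trans ?_)
        have := bracket_pos x
        gcongr
        exact norm_le_bracket x
    _ = _ := by ring

lemma Top.exists_Sym {n : ℕ} {m : ℝ} {f : Euc d → ℝ} (hf : ContDiff ℝ ∞ f) (h : Top n m f) :
    ∃ C, Sym n n C f := by
  induction n generalizing m f with
  | zero => exact ⟨m, fun x => by simpa using h x⟩
  | succ n ih =>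
    choose C hC using fun i : Fin d => ih (contDiff_dd hf (EuclideanSpace.single i 1)) (h _)
    have hdd : ∀ u, Sym n n ((∑ i, C i) * ‖u‖) (dd u f) := fun u => by
      have e : dd u f = fun x => ∑ i, u i * dd (EuclideanSpace.single i 1) f x := by
        ext x; exact dd_eq_sum u f x
      rw [e]
      refine (Sym_sum _ _ (fun i => contDiff_dd hf _) hC).mono ?_
      rw [Finset.sum_mul]
      refine Finset.sum_le_sum fun i _ => ?_
      rw [mul_comm]
      exact mul_le_mul_of_nonneg_left (PiLp.norm_apply_le u i) (hC i).nonneg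
    obtain ⟨D, hD⟩ := exists_growth_of_dd (hf.differentiable (by simp)) (n := n)
      fun u => ⟨_, fun x => by simpa using (hdd u).bound x⟩
    refine ⟨max D (∑ i, C i), fun x => ?_, fun u => ?_⟩
    · rw [zpow_natCast]
      exact (hD x).trans (mul_le_mul_of_nonneg_right (le_max_left _ _)
        (pow_pos (bracket_pos x) _).le)
    · rw [show ((n + 1 : ℕ) : ℤ) - 1 = n by push_cast; ring]
      exact (hdd u).mono (mul_le_mul_of_nonneg_right (le_max_right _ _) (norm_nonneg u))

end

end SteinCLT

/-! ### Finite differences, mollification and truncation. -/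

namespace SteinCLT

noncomputable section

open Filter Topology Set
open scoped NNReal RealInnerProductSpace ContDiff

variable {d : ℕ}

lemma dd_comp_add_right (a u : Euc d) (f : Euc d → ℝ) :
    dd u (fun x => f (x + a)) = fun x => dd u f (x + a) := by
  ext x
  simp [dd, fderiv_comp_add_right]

/-- The finite difference of `f` in the direction `u`. -/
def fd (u : Euc d) (f : Euc d → ℝ) : Euc d → ℝ := fun x => f (x + u) - f x

/-- `f` is `n` times differentiable and its derivatives of order `n` are Lipschitz. -/
def LD : ℕ → ℝ → (Euc d → ℝ) → Prop
  | 0, m, f => ∀ x y, |f x - f y| ≤ m * ‖x - y‖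
  | n + 1, m, f => Differentiable ℝ f ∧ ∀ u, LD n (m * ‖u‖) (dd u f)

/-- The finite differences of order `n` of `f` are bounded. -/
def FD : ℕ → ℝ → (Euc d → ℝ) → Prop
  | 0, m, f => ∀ x, |f x| ≤ m
  | n + 1, m, f => ∀ u, FD n (m * ‖u‖) (fd u f)

lemma LD.continuous {n : ℕ} {m : ℝ} (hm : 0 ≤ m) {f : Euc d → ℝ} (h : LD n m f) :
    Continuous f := by
  cases n with
  | zero => exact (LipschitzWith.of_dist_le_mul (K := ⟨m, hm⟩) fun x y => by
      rw [Real.dist_eq, dist_eq_norm]; exact h x y).continuous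
  | succ n => exact h.1.continuous

lemma dd_fd {f : Euc d → ℝ} (hf : Differentiable ℝ f) (u v : Euc d) :
    dd v (fd u f) = fd u (dd v f) := by
  ext x
  have h1 : Differentiable ℝ fun x => f (x + u) := by fun_prop
  have := congrFun (dd_comp_add_right u v f) x
  have e : fd u f = fun x => f (x + u) - f x := rfl
  rw [e]
  simp only [dd, fd] at this ⊢
  rw [fderiv_fun_sub (h1 x) (hf x)]
  simp [this]

lemma LD.fd {n : ℕ} {m : ℝ} (hm : 0 ≤ m) {f : Euc d → ℝ} (h : LD (n + 1) m f) (u : Euc d) :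
    LD n (m * ‖u‖) (fd u f) := by
  induction n generalizing m f with
  | zero =>
    intro x y
    have hf : Differentiable ℝ f := h.1
    have hx : Differentiable ℝ fun z => f (z + x) := by fun_prop
    have hy : Differentiable ℝ fun z => f (z + y) := by fun_prop
    -- The second difference is the increment between `0` and `u` of a function of the shift `z`,
    -- whose gradient is small because that of `f` is Lipschitz.
    have key := abs_sub_le_of_abs_dd_le (f := fun z => f (z + x) - f (z + y)) (hx.sub hy)
      (C := m * ‖x - y‖) (by positivity) (fun z w => by
        have e : dd w (fun z => f (z + x) - f (z + y)) z = dd w f (z + x) - dd w f (z + y) := by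
          rw [← congrFun (dd_comp_add_right x w f) z, ← congrFun (dd_comp_add_right y w f) z]
          simp only [dd]
          rw [fderiv_fun_sub (hx z) (hy z)]
          simp
        rw [e]
        refine (h.2 w _ _).trans (le_of_eq ?_)
        rw [add_sub_add_left_eq_sub]
        ring) u 0
    simp only [zero_add, sub_zero, SteinCLT.fd] at key ⊢
    rw [add_comm u x, add_comm u y] at key
    calc _ = |f (x + u) - f (y + u) - (f x - f y)| := by congr 1; ring
      _ ≤ _ := key.trans (le_of_eq (by ring))
  | succ n ih =>
    have h1 : Differentiable ℝ fun x => f (x + u) := by have := h.1; fun_prop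
    refine ⟨h1.sub h.1, fun v => ?_⟩
    rw [dd_fd h.1, mul_right_comm]
    exact ih (by positivity) (h.2 v)

/-- A Lipschitz derivative of order `n` need not be differentiable, but it bounds differences of
order `n + 1`. Those commute with convolution and pass to pointwise limits, so the exact constant
survives mollification. -/
lemma LD.finiteDifference {n : ℕ} {m : ℝ} (hm : 0 ≤ m) {f : Euc d → ℝ} (h : LD n m f) :
    FD (n + 1) m f := by
  induction n generalizing m f with
  | zero => exact fun u x => by simpa [SteinCLT.fd] using h (x + u) x
  | succ n ih => exact fun u => ih (by positivity) (h.fd hm u)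

lemma FD.const_mul {n : ℕ} {m : ℝ} {f : Euc d → ℝ} (a : ℝ) (h : FD n m f) :
    FD n (|a| * m) (fun x => a * f x) := by
  induction n generalizing m f with
  | zero => intro x; rw [abs_mul]; exact mul_le_mul_of_nonneg_left (h x) (abs_nonneg a)
  | succ n ih =>
    intro u
    have e : fd u (fun x => a * f x) = fun x => a * fd u f x := by ext x; simp [fd, mul_sub]
    rw [e, mul_assoc]
    exact ih (h u)

lemma FD.of_tendsto {n : ℕ} {m : ℝ} {F : ℕ → Euc d → ℝ} {f : Euc d → ℝ}
    (hF : ∀ x, Tendsto (fun k => F k x) atTop (𝓝 (f x))) (h : ∀ k, FD n m (F k)) : FD n m f := by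
  induction n generalizing m F f with
  | zero => exact fun x => le_of_tendsto' (hF x).abs fun k => h k x
  | succ n ih => exact fun u => ih (fun x => (hF (x + u)).sub (hF x)) fun k => h k u

/-- Directional derivatives are limits of rescaled differences, and difference bounds are
homogeneous in the direction. -/
lemma FD.top {n : ℕ} {m : ℝ} {f : Euc d → ℝ} (hf : ContDiff ℝ ∞ f) (h : FD n m f) :
    Top n m f := by
  induction n generalizing m f with
  | zero => exact h
  | succ n ih =>
    intro u
    refine ih (contDiff_dd hf u) (FD.of_tendsto
      (F := fun k x => ((k : ℝ) + 1) * fd (((k : ℝ) + 1)⁻¹ • u) f x) (fun x => ?_) fun k => ?_)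
    · refine ((hf.differentiable (by simp) x).hasFDerivAt.lim u (c := fun k : ℕ => (k : ℝ) + 1)
        (l := atTop) ?_)
      refine (tendsto_atTop_add_const_right _ 1 tendsto_natCast_atTop_atTop).congr fun k => ?_
      rw [Real.norm_of_nonneg (by positivity)]
    · have hk : (0 : ℝ) < k + 1 := by positivity
      have := (h (((k : ℝ) + 1)⁻¹ • u)).const_mul ((k : ℝ) + 1)
      rw [norm_smul, norm_inv, Real.norm_of_nonneg hk.le, abs_of_pos hk] at this
      convert this using 1
      field_simp

lemma LD.exists_growth {n : ℕ} {m : ℝ} (hm : 0 ≤ m) {f : Euc d → ℝ} (h : LD n m f) :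
    ∃ C, ∀ x, |f x| ≤ C * bracket x ^ (n + 1) := by
  induction n generalizing m f with
  | zero =>
    refine ⟨|f 0| + m, fun x => ?_⟩
    have h1 := h x 0
    rw [sub_zero] at h1
    have h2 := abs_add_le (f 0) (f x - f 0)
    rw [add_sub_cancel] at h2
    have h3 := le_mul_of_one_le_right (abs_nonneg (f 0)) (one_le_bracket x)
    have h4 := mul_le_mul_of_nonneg_left (norm_le_bracket x) hm
    rw [zero_add, pow_one]
    linarith
  | succ n ih => exact exists_growth_of_dd h.1 fun u => ih (by positivity) (h.2 u)

lemma LD.exists_growth_of_zero {n : ℕ} {f : Euc d → ℝ} (h : LD n 0 f) :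
    ∃ C, ∀ x, |f x| ≤ C * bracket x ^ n := by
  induction n generalizing f with
  | zero =>
    refine ⟨|f 0|, fun x => ?_⟩
    have h1 := h x 0
    rw [zero_mul, abs_nonpos_iff, sub_eq_zero] at h1
    simp [h1]
  | succ n ih => exact exists_growth_of_dd h.1 fun u => ih (by simpa using h.2 u)

section Mollification

/-- The regularization of `f` by a bump function. -/
def moll (φ : ContDiffBump (0 : Euc d)) (f : Euc d → ℝ) : Euc d → ℝ :=
  convolution (φ.normed volume) f (ContinuousLinearMap.lsmul ℝ ℝ) volume

variable (φ : ContDiffBump (0 : Euc d))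

lemma contDiff_moll {f : Euc d → ℝ} (hf : Continuous f) : ContDiff ℝ ∞ (moll φ f) :=
  φ.hasCompactSupport_normed.contDiff_convolution_left _ φ.contDiff_normed hf.locallyIntegrable

lemma abs_moll_le {f : Euc d → ℝ} (hf : Continuous f) {x : Euc d} {C : ℝ}
    (hC : ∀ y, ‖y - x‖ ≤ φ.rOut → |f y| ≤ C) : |moll φ f x| ≤ C := by
  have h0 : 0 ≤ C := (abs_nonneg _).trans (hC x (by simpa using φ.rOut_pos.le))
  have := dist_convolution_le (μ := volume) (f := φ.normed volume) (g := f) (x₀ := x)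
    (R := φ.rOut) (z₀ := 0) h0 φ.support_normed_eq.subset φ.nonneg_normed φ.integral_normed
    hf.aestronglyMeasurable (fun y hy => by
      rw [dist_zero_right]
      exact hC y (by rw [← dist_eq_norm]; exact (Metric.mem_ball.1 hy).le))
  rwa [dist_zero_right] at this

lemma fd_moll {f : Euc d → ℝ} (hf : Continuous f) (u : Euc d) :
    fd u (moll φ f) = moll φ (fd u f) := by
  ext x
  have hi : ∀ x, Integrable (fun t => φ.normed volume t • f (x - t)) := fun x =>
    (φ.contDiff_normed (n := 0).continuous.smul (by fun_prop)).integrable_of_hasCompactSupport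
      φ.hasCompactSupport_normed.smul_right
  simp only [fd, moll, convolution_def, ContinuousLinearMap.lsmul_apply]
  rw [← integral_sub (hi _) (hi _)]
  refine integral_congr_ae (ae_of_all _ fun t => ?_)
  simp only [smul_eq_mul]
  rw [mul_sub, add_sub_right_comm]

lemma FD.moll {n : ℕ} {m : ℝ} {f : Euc d → ℝ} (hf : Continuous f) (h : FD n m f) :
    FD n m (moll φ f) := by
  induction n generalizing m f with
  | zero => exact fun x => abs_moll_le φ hf fun y _ => h y
  | succ n ih =>
    intro u
    rw [fd_moll φ hf]
    exact ih (by unfold fd; fun_prop) (h u)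

lemma abs_moll_le_of_growth (hφ : φ.rOut ≤ 1) {f : Euc d → ℝ} (hf : Continuous f) {C : ℝ} {n : ℕ}
    (hC : ∀ x, |f x| ≤ C * bracket x ^ n) (x : Euc d) :
    |SteinCLT.moll φ f x| ≤ 3 ^ n * C * bracket x ^ n := by
  have hC0 : 0 ≤ C := by simpa [bracket] using (abs_nonneg _).trans (hC 0)
  refine abs_moll_le φ hf fun y hy => (hC y).trans ?_
  have h1 : bracket y ≤ 3 * bracket x := by
    have h2 : ‖y‖ ≤ 1 + ‖x‖ := by
      have := norm_add_le (y - x) x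
      rw [sub_add_cancel] at this
      linarith
    have h3 := bracket_le y
    have h4 := norm_le_bracket x
    have h5 := one_le_bracket x
    linarith
  have := (bracket_pos y).le
  calc C * bracket y ^ n ≤ C * (3 * bracket x) ^ n := by gcongr
    _ = _ := by rw [mul_pow]; ring

variable (d) in
lemma exists_moll_seq : ∃ φ : ℕ → ContDiffBump (0 : Euc d), (∀ k, (φ k).rOut ≤ 1) ∧
    ∀ f : Euc d → ℝ, Continuous f → ∀ x, Tendsto (fun k => moll (φ k) f x) atTop (𝓝 (f x)) := by
  refine ⟨fun k => ⟨1 / ((k : ℝ) + 1) / 2, 1 / ((k : ℝ) + 1), by positivity,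
    half_lt_self (by positivity)⟩, fun k => ?_, fun f hf x => ?_⟩
  · change 1 / ((k : ℝ) + 1) ≤ 1
    rw [div_le_one (by positivity)]
    linarith [(k.cast_nonneg : (0 : ℝ) ≤ k)]
  · exact ContDiffBump.convolution_tendsto_right_of_continuous
      tendsto_one_div_add_atTop_nhds_zero_nat hf x

end Mollification

section Cutoff

/-- A smooth bump on the line. -/
def lineBump : ContDiffBump (0 : ℝ) := ⟨1, 2, one_pos, one_lt_two⟩

/-- A slowly varying cutoff function. -/
def slowCutoff (ε : ℝ) : Euc d → ℝ := fun x => lineBump (ε * Real.log (bracket x))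

lemma contDiff_slowCutoff (ε : ℝ) : ContDiff ℝ ∞ (slowCutoff ε : Euc d → ℝ) :=
  contDiff_comp_log lineBump.contDiff ε

lemma slowCutoff_nonneg (ε : ℝ) (x : Euc d) : 0 ≤ slowCutoff ε x := lineBump.nonneg

lemma slowCutoff_le_one (ε : ℝ) (x : Euc d) : slowCutoff ε x ≤ 1 := lineBump.le_one

lemma hasCompactSupport_slowCutoff {ε : ℝ} (hε : 0 < ε) :
    HasCompactSupport (slowCutoff ε : Euc d → ℝ) := by
  refine HasCompactSupport.of_support_subset_isCompact
    (isCompact_closedBall (0 : Euc d) (Real.exp (2 / ε))) fun x hx => ?_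
  rw [mem_closedBall_zero_iff]
  by_contra h
  push Not at h
  refine hx (lineBump.zero_of_le_dist ?_)
  have h1 : 2 / ε ≤ Real.log (bracket x) := by
    rw [Real.le_log_iff_exp_le (bracket_pos x)]
    exact h.le.trans (norm_le_bracket x)
  rw [div_le_iff₀ hε] at h1
  rw [dist_zero_right]
  exact (by linarith : (2 : ℝ) ≤ ε * Real.log (bracket x)).trans (le_abs_self _)

lemma tendsto_slowCutoff (x : Euc d) :
    Tendsto (fun k : ℕ => slowCutoff (1 / ((k : ℝ) + 1)) x) atTop (𝓝 1) := by
  have h1 : Tendsto (fun k : ℕ => 1 / ((k : ℝ) + 1) * Real.log (bracket x)) atTop (𝓝 0) := by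
    simpa using tendsto_one_div_add_atTop_nhds_zero_nat.mul_const (Real.log (bracket x))
  have h2 := ((lineBump.contDiff (n := 0)).continuous.tendsto 0).comp h1
  have h3 : lineBump 0 = 1 := lineBump.one_of_mem_closedBall (by simp [lineBump])
  rwa [h3] at h2

end Cutoff

lemma Sym.mono_order {k n : ℕ} (hkn : k ≤ n) {p : ℤ} {C : ℝ} {f : Euc d → ℝ} (h : Sym n p C f) :
    Sym k p C f := by
  induction n, hkn using Nat.le_induction with
  | base => exact h
  | succ n _ ih => exact ih h.pred

lemma exists_top_mul_slowCutoff (n : ℕ) {C : ℝ} {f : Euc d → ℝ} (hf : ContDiff ℝ ∞ f)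
    (hS : Sym n n C f) : ∃ K, 0 ≤ K ∧ ∀ m, Top n m f → ∀ k : ℕ,
      Top n (m + K * (1 / ((k : ℝ) + 1))) (fun x => f x * slowCutoff (1 / ((k : ℝ) + 1)) x) := by
  obtain ⟨D, hD⟩ := Sym_dd_comp_log (d := d) n lineBump.contDiff lineBump.hasCompactSupport
  refine ⟨2 ^ n * C * |D|, by have := hS.nonneg; positivity, fun m hm k => ?_⟩
  have h1 : 1 / ((k : ℝ) + 1) ≤ 1 := by
    rw [div_le_one (by positivity)]
    linarith [(k.cast_nonneg : (0 : ℝ) ≤ k)]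
  have := hm.mul_cutoff (ε := 1 / ((k : ℝ) + 1) * |D|) hf (contDiff_slowCutoff _) hS
    (fun x => abs_le.2 ⟨by linarith [slowCutoff_nonneg (1 / ((k : ℝ) + 1)) x],
      slowCutoff_le_one _ x⟩) (by positivity) fun j hj u =>
        ((hD _ (by positivity) h1 u).mono_order hj.le).mono (by
          gcongr
          exact le_abs_self D)
  convert this using 1
  ring

end

end SteinCLT

/-! ### From test functions to functions with Lipschitz derivatives. -/

namespace SteinCLT

noncomputable section

open Filter Topology Set
open scoped NNReal RealInnerProductSpace ContDiff

variable {d : ℕ}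

lemma continuous_bracket : Continuous (bracket : Euc d → ℝ) :=
  (contDiff_bracket (n := 0)).continuous

lemma integrable_bracket_pow_gd (n : ℕ) : Integrable (fun z => bracket z ^ n) (gd d) := by
  refine (((integrable_const (1 ^ n)).add (integrable_norm_pow_gd n)).const_mul
    (2 ^ (n - 1))).mono' (continuous_bracket.pow n).aestronglyMeasurable
    (ae_of_all _ fun z => ?_)
  rw [norm_pow, Real.norm_of_nonneg (bracket_pos z).le]
  have := (bracket_pos z).le
  calc bracket z ^ n ≤ (1 + ‖z‖) ^ n := by gcongr; exact bracket_le z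
    _ ≤ _ := add_pow_le zero_le_one (norm_nonneg z) n

lemma integrable_of_growth {Θ : Type*} [MeasurableSpace Θ] {ρ : Measure Θ} {X : Θ → Euc d}
    (hX : Measurable X) {n : ℕ} (hi : Integrable (fun θ => bracket (X θ) ^ n) ρ)
    {f : Euc d → ℝ} (hf : Continuous f) {C : ℝ} (hC : ∀ x, |f x| ≤ C * bracket x ^ n) :
    Integrable (fun θ => f (X θ)) ρ :=
  (hi.const_mul C).mono' (hf.measurable.comp hX).aestronglyMeasurable (ae_of_all _ fun _ => hC _)

section Law

variable {Ω : Type*} [MeasurableSpace Ω] {P : Measure Ω} [IsProbabilityMeasure P]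
  {W : Ω → Euc d}

lemma integrable_bracket_pow_W (hW : Measurable W) (hSt : Standardized P W) {n : ℕ} (hn : n ≤ 2) :
    Integrable (fun o => bracket (W o) ^ n) P := by
  refine ((integrable_const (1 : ℝ)).add (integrable_norm_sq hSt)).mono'
    ((continuous_bracket.pow n).measurable.comp hW).aestronglyMeasurable (ae_of_all _ fun o => ?_)
  rw [norm_pow, Real.norm_of_nonneg (bracket_pos _).le]
  refine (pow_le_pow_right₀ (one_le_bracket _) hn).trans (le_of_eq ?_)
  exact Real.sq_sqrt (by positivity)

variable (P W) in
/-- A comparison between the law of `W` and the Gaussian law for test functions with bounded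
derivatives of order `r`. -/
def TestBound (r : ℕ) (A : ℝ≥0∞) : Prop :=
  ∀ g : Euc d → ℝ, IsTest g → ∀ m, 0 ≤ m → Top r m g →
    ‖∫ o, g (W o) ∂P - ∫ z, g z ∂gd d‖ₑ ≤ A * ENNReal.ofReal m

lemma abs_mul_slowCutoff_le (ε : ℝ) (f : Euc d → ℝ) (x : Euc d) :
    |f x * slowCutoff ε x| ≤ |f x| := by
  rw [abs_mul, abs_of_nonneg (slowCutoff_nonneg ε x)]
  exact mul_le_of_le_one_right (abs_nonneg _) (slowCutoff_le_one ε x)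

lemma tendsto_ofReal_add_const_mul (A : ℝ≥0∞) (hA : A ≠ ⊤) (m K : ℝ) :
    Tendsto (fun k : ℕ => A * ENNReal.ofReal (m + K * (1 / ((k : ℝ) + 1)))) atTop
      (𝓝 (A * ENNReal.ofReal m)) := by
  refine ENNReal.Tendsto.const_mul ((ENNReal.continuous_ofReal.tendsto _).comp ?_) (Or.inr hA)
  simpa using (tendsto_one_div_add_atTop_nhds_zero_nat.const_mul K).const_add m

lemma isTest_mul_slowCutoff {f : Euc d → ℝ} (hf : ContDiff ℝ ∞ f) (k : ℕ) :
    IsTest (fun x => f x * slowCutoff (1 / ((k : ℝ) + 1)) x) :=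
  ⟨hf.mul (contDiff_slowCutoff _), (hasCompactSupport_slowCutoff (by positivity)).mul_left⟩

omit [IsProbabilityMeasure P] in
-- Truncation at scale `1 / (k + 1)` raises the derivative bound by `K / (k + 1)` only, so the
-- constant `m` is recovered in the limit.
lemma TestBound.smooth (hW : Measurable W) {r : ℕ} {A : ℝ≥0∞} (hT : TestBound P W r A)
    (hA : A ≠ ⊤) {f : Euc d → ℝ} (hf : ContDiff ℝ ∞ f) {m : ℝ} (hm0 : 0 ≤ m) (hm : Top r m f)
    (hiW : Integrable (fun o => f (W o)) P) (hiZ : Integrable f (gd d)) :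
    ‖∫ o, f (W o) ∂P - ∫ z, f z ∂gd d‖ₑ ≤ A * ENNReal.ofReal m := by
  obtain ⟨C, hC⟩ := hm.exists_Sym hf
  obtain ⟨K, hK0, hK⟩ := exists_top_mul_slowCutoff r hf hC
  have hc : ∀ k : ℕ, Continuous fun x => f x * slowCutoff (1 / ((k : ℝ) + 1)) x := fun k =>
    (isTest_mul_slowCutoff hf k).1.continuous
  have h1 : Tendsto (fun k : ℕ => ∫ o, f (W o) * slowCutoff (1 / ((k : ℝ) + 1)) (W o) ∂P) atTop
      (𝓝 (∫ o, f (W o) ∂P)) := by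
    refine tendsto_integral_of_dominated_convergence (fun o => |f (W o)|)
      (fun k => ((hc k).measurable.comp hW).aestronglyMeasurable) hiW.abs
      (fun k => ae_of_all _ fun o => abs_mul_slowCutoff_le _ f _) (ae_of_all _ fun o => ?_)
    simpa using (tendsto_slowCutoff (W o)).const_mul (f (W o))
  have h2 : Tendsto (fun k : ℕ => ∫ z, f z * slowCutoff (1 / ((k : ℝ) + 1)) z ∂gd d) atTop
      (𝓝 (∫ z, f z ∂gd d)) := by
    refine tendsto_integral_of_dominated_convergence (fun z => |f z|)
      (fun k => (hc k).aestronglyMeasurable) hiZ.abs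
      (fun k => ae_of_all _ fun z => abs_mul_slowCutoff_le _ f _) (ae_of_all _ fun z => ?_)
    simpa using (tendsto_slowCutoff z).const_mul (f z)
  exact le_of_tendsto_of_tendsto' (h1.sub h2).enorm (tendsto_ofReal_add_const_mul A hA m K)
    fun k => hT _ (isTest_mul_slowCutoff hf k) _ (by positivity) (hK m hm k)

/-- The comparison applied to truncations of the `r`-th power of `bracket` bounds their means under
`W` uniformly, and Fatou's lemma concludes. For `r = 3` this is the only source of third moments of
`W`. -/
lemma TestBound.integrable_bracket_pow (hW : Measurable W) {r : ℕ} {A : ℝ≥0∞}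
    (hT : TestBound P W r A) (hA : A ≠ ⊤) : Integrable (fun o => bracket (W o) ^ r) P := by
  obtain ⟨C, hC⟩ := Sym_bracket_zpow (d := d) r r
  simp only [zpow_natCast] at hC
  set f : Euc d → ℝ := fun x => bracket x ^ r with hf'
  have hf : ContDiff ℝ ∞ f := contDiff_bracket.pow r
  have hf0 : ∀ x, 0 ≤ f x := fun x => (pow_pos (bracket_pos x) r).le
  obtain ⟨K, hK0, hK⟩ := exists_top_mul_slowCutoff r hf hC
  have hC0 := hC.nonneg
  set F : ℕ → Euc d → ℝ := fun k x => f x * slowCutoff (1 / ((k : ℝ) + 1)) x with hF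
  have hF0 : ∀ k x, 0 ≤ F k x := fun k x => mul_nonneg (hf0 x) (slowCutoff_nonneg _ x)
  have hFt : ∀ k, IsTest (F k) := isTest_mul_slowCutoff hf
  have hFi : ∀ k, Integrable (fun o => F k (W o)) P := fun k => by
    obtain ⟨B, hB⟩ := ((hFt k).SB 0).bounded
    exact integrable_bdd_W hW (hFt k).1.continuous hB
  have hZ : Integrable f (gd d) := integrable_bracket_pow_gd r
  have hb : ∀ k, ∫⁻ o, ENNReal.ofReal (F k (W o)) ∂P ≤
      ENNReal.ofReal (∫ z, f z ∂gd d) + A * ENNReal.ofReal (C + K) := by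
    intro k
    rw [← ofReal_integral_eq_lintegral_ofReal (hFi k) (ae_of_all _ fun o => hF0 k _)]
    have h1 : ∫ z, F k z ∂gd d ≤ ∫ z, f z ∂gd d :=
      integral_mono_of_nonneg (ae_of_all _ fun z => hF0 k z) hZ (ae_of_all _ fun z =>
        mul_le_of_le_one_right (hf0 z) (slowCutoff_le_one _ z))
    have h2 := hT _ (hFt k) _ (by positivity) (hK C hC.top k)
    calc ENNReal.ofReal (∫ o, F k (W o) ∂P)
        ≤ ENNReal.ofReal (∫ z, F k z ∂gd d + |∫ o, F k (W o) ∂P - ∫ z, F k z ∂gd d|) :=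
          ENNReal.ofReal_le_ofReal (by
            linarith [le_abs_self (∫ o, F k (W o) ∂P - ∫ z, F k z ∂gd d)])
      _ ≤ ENNReal.ofReal (∫ z, F k z ∂gd d) + ‖∫ o, F k (W o) ∂P - ∫ z, F k z ∂gd d‖ₑ := by
          rw [Real.enorm_eq_ofReal_abs]
          exact ENNReal.ofReal_add_le
      _ ≤ _ := by
          refine add_le_add (ENNReal.ofReal_le_ofReal h1) (h2.trans ?_)
          gcongr
          have : 1 / ((k : ℝ) + 1) ≤ 1 := by
            rw [div_le_one (by positivity)]
            linarith [(k.cast_nonneg : (0 : ℝ) ≤ k)]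
          exact mul_le_of_le_one_right hK0 this
  refine ⟨(hf.continuous.measurable.comp hW).aestronglyMeasurable, ?_⟩
  rw [hasFiniteIntegral_iff_ofReal (ae_of_all _ fun o => hf0 (W o))]
  have hlim : ∀ o, liminf (fun k => ENNReal.ofReal (F k (W o))) atTop =
      ENNReal.ofReal (f (W o)) := fun o =>
    ((ENNReal.continuous_ofReal.tendsto _).comp (by
      have := (tendsto_slowCutoff (W o)).const_mul (f (W o))
      rwa [mul_one] at this)).liminf_eq
  have hfat := lintegral_liminf_le (μ := P) (u := atTop)
    (f := fun k o => ENNReal.ofReal (F k (W o)))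
    fun k => ((hFt k).1.continuous.measurable.comp hW).ennreal_ofReal
  simp_rw [hlim] at hfat
  refine hfat.trans_lt (lt_of_le_of_lt (liminf_le_of_frequently_le'
    (Frequently.of_forall hb)) ?_)
  exact ENNReal.add_lt_top.2 ⟨ENNReal.ofReal_lt_top,
    ENNReal.mul_lt_top hA.lt_top ENNReal.ofReal_lt_top⟩

omit [IsProbabilityMeasure P] in
lemma TestBound.of_LD (hW : Measurable W) {n : ℕ} {A : ℝ≥0∞} (hT : TestBound P W (n + 1) A)
    (hA : A ≠ ⊤) {f : Euc d → ℝ} {m : ℝ} (hm0 : 0 ≤ m) (hf : LD n m f)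
    (hi : Integrable (fun o => bracket (W o) ^ (n + 1)) P) :
    ‖∫ o, f (W o) ∂P - ∫ z, f z ∂gd d‖ₑ ≤ A * ENNReal.ofReal m := by
  have hfc := hf.continuous hm0
  obtain ⟨C, hC⟩ := hf.exists_growth hm0
  obtain ⟨φ, hφ1, hφ⟩ := exists_moll_seq d
  have hs := fun k => contDiff_moll (φ k) hfc
  have hg := fun k => abs_moll_le_of_growth (φ k) (hφ1 k) hfc hC
  have hiZ : Integrable (fun z : Euc d => bracket z ^ (n + 1)) (gd d) := integrable_bracket_pow_gd _
  have h1 : Tendsto (fun k : ℕ => ∫ o, moll (φ k) f (W o) ∂P) atTop (𝓝 (∫ o, f (W o) ∂P)) :=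
    tendsto_integral_of_dominated_convergence (fun o => 3 ^ (n + 1) * C * bracket (W o) ^ (n + 1))
      (fun k => ((hs k).continuous.measurable.comp hW).aestronglyMeasurable) (hi.const_mul _)
      (fun k => ae_of_all _ fun o => hg k _) (ae_of_all _ fun o => hφ f hfc _)
  have h2 : Tendsto (fun k : ℕ => ∫ z, moll (φ k) f z ∂gd d) atTop (𝓝 (∫ z, f z ∂gd d)) :=
    tendsto_integral_of_dominated_convergence (fun z => 3 ^ (n + 1) * C * bracket z ^ (n + 1))
      (fun k => (hs k).continuous.aestronglyMeasurable) (hiZ.const_mul _)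
      (fun k => ae_of_all _ fun z => hg k _) (ae_of_all _ fun z => hφ f hfc _)
  refine le_of_tendsto' (h1.sub h2).enorm fun k => ?_
  exact hT.smooth hW hA (hs k) hm0 (((hf.finiteDifference hm0).moll (φ k) hfc).top (hs k))
    (integrable_of_growth hW hi (hs k).continuous (hg k))
    (integrable_of_growth measurable_id hiZ (hs k).continuous (hg k))

/-- The expectation of a quadratic function depends on the first two moments only. -/
lemma integral_eq_of_LD_two_zero (hW : Measurable W) (hSt : Standardized P W) {f : Euc d → ℝ}
    (hf : LD 2 0 f) : ∫ o, f (W o) ∂P = f 0 + (1 / 2) *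
      ∑ i, dd (EuclideanSpace.single i 1) (dd (EuclideanSpace.single i 1) f) 0 := by
  have hconst : ∀ u v x, dd v (dd u f) x = dd v (dd u f) 0 := fun u v x => by
    have := ((hf.2 u).2 v) x 0
    rwa [zero_mul, zero_mul, zero_mul, abs_nonpos_iff, sub_eq_zero] at this
  have hline : ∀ {F : Euc d → ℝ}, Differentiable ℝ F → ∀ (x : Euc d) (t : ℝ),
      HasDerivAt (fun t : ℝ => F (t • x)) (dd x F (t • x)) t := fun hF x t => by
    simpa using hasDerivAt_line hF 0 x 1 t
  have h1 : ∀ (x : Euc d) (t : ℝ), dd x f (t • x) = dd x f 0 + t * dd x (dd x f) 0 := by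
    intro x t
    have hd : ∀ t, HasDerivAt (fun t : ℝ => dd x f (t • x) - t * dd x (dd x f) 0) 0 t := fun t => by
      refine ((hline (hf.2 x).1 x t).fun_sub
        ((hasDerivAt_id' t).mul_const (dd x (dd x f) 0))).congr_deriv ?_
      rw [hconst]; ring
    have := is_const_of_deriv_eq_zero (fun t => (hd t).differentiableAt) (fun t => (hd t).deriv) t 0
    simp only [zero_smul, zero_mul, sub_zero] at this
    linarith
  have h2 : ∀ x : Euc d, f x = f 0 + dd x f 0 + (1 / 2) * dd x (dd x f) 0 := by
    intro x
    have hd : ∀ t, HasDerivAt (fun t : ℝ => f (t • x) -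
        (t * dd x f 0 + t ^ 2 * (dd x (dd x f) 0 / 2))) 0 t := fun t => by
      refine ((hline hf.1 x t).fun_sub (((hasDerivAt_id' t).mul_const (dd x f 0)).fun_add
        (((hasDerivAt_id' t).fun_pow 2).mul_const (dd x (dd x f) 0 / 2)))).congr_deriv ?_
      rw [h1]
      norm_num
      ring
    have := is_const_of_deriv_eq_zero (fun t => (hd t).differentiableAt) (fun t => (hd t).deriv) 1 0
    simp at this
    linarith
  set a : Fin d → ℝ := fun i => dd (EuclideanSpace.single i 1) f 0
  set H : Fin d → Fin d → ℝ := fun i j =>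
    dd (EuclideanSpace.single i 1) (dd (EuclideanSpace.single j 1) f) 0 with hH
  have h3 : ∀ x : Euc d, f x = f 0 + ∑ i, x i * a i + (1 / 2) * ∑ i, ∑ j, x i * x j * H i j := by
    intro x
    rw [h2 x, dd_eq_sum x f 0, dd_eq_sum x (dd x f) 0]
    congr 2
    refine Finset.sum_congr rfl fun i _ => ?_
    have e : dd x f = fun y => ∑ j, x j * dd (EuclideanSpace.single j 1) f y := by
      ext y; exact dd_eq_sum x f y
    rw [e, dd_sum _ _ fun j => (hf.2 _).1, Finset.mul_sum]
    exact Finset.sum_congr rfl fun j _ => by rw [hH]; ring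
  have hgr : ∀ (i : Fin d) (x : Euc d), |x i| ≤ 1 * (1 + ‖x‖) := fun i x => by
    have := PiLp.norm_apply_le x i; rw [Real.norm_eq_abs] at this; linarith
  have i1 : ∀ i, Integrable (fun o => W o i * a i) P := fun i =>
    (integrable_growth hW hSt (φ := fun x => x i) (by fun_prop) (hgr i)).mul_const _
  have i2 : ∀ i j, Integrable (fun o => W o i * W o j * H i j) P := fun i j =>
    (integrable_growth_mul hW hSt (φ := fun x => x i) (ψ := fun x => x j) (by fun_prop)
      (by fun_prop) (hgr i) (hgr j)).mul_const _
  have hm : ∀ i : Fin d, ∫ o, W o i ∂P = 0 := by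
    intro i
    have := (EuclideanSpace.proj i : Euc d →L[ℝ] ℝ).integral_comp_comm (integrable_W hSt)
    rw [hSt.mean] at this
    simpa using this
  have j1 : Integrable (fun o => ∑ i, W o i * a i) P := integrable_finsetSum _ fun i _ => i1 i
  have j2' : ∀ i, Integrable (fun o => ∑ j, W o i * W o j * H i j) P := fun i =>
    integrable_finsetSum _ fun j _ => i2 i j
  have j2 : Integrable (fun o => (1 / 2) * ∑ i, ∑ j, W o i * W o j * H i j) P :=
    (integrable_finsetSum _ fun i _ => j2' i).const_mul _
  have j3 : Integrable (fun o => f 0 + ∑ i, W o i * a i) P := (integrable_const _).add j1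
  rw [integral_congr_ae (ae_of_all _ fun o => h3 (W o))]
  rw [integral_add j3 j2, integral_add (integrable_const _) j1, integral_finsetSum _ fun i _ => i1 i,
    integral_const_mul, integral_finsetSum _ fun i _ => j2' i]
  simp_rw [integral_finsetSum _ fun j _ => i2 _ j, integral_mul_const, hm,
    integral_apply_mul_apply hSt]
  have e0 : ∑ i : Fin d, (0 : ℝ) * a i = 0 := Finset.sum_eq_zero fun i _ => zero_mul _
  have e1 : ∑ i : Fin d, ∑ j : Fin d, (if i = j then (1 : ℝ) else 0) * H i j = ∑ i, H i i :=
    Finset.sum_congr rfl fun i _ => by simp only [ite_mul, one_mul, zero_mul, Finset.sum_ite_eq,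
      Finset.mem_univ, if_true]
  rw [e0, e1, integral_const, probReal_univ, one_smul, add_zero]

end Law

/-- Makes the computation for quadratic functions available for the Gaussian law as well. -/
lemma standardized_gd : Standardized (gd d) (fun z => z) where
  memLp := memLp_id_gd
  mean := integral_id_stdGaussian
  cov i j := by
    have h := covariance_eval_multivariateGaussian (μ := (0 : Euc d))
      (S := (1 : Matrix (Fin d) (Fin d) ℝ)) Matrix.PosSemidef.one i j
    rw [multivariateGaussian_zero_one] at h
    rw [h, Matrix.one_apply]

/-! ### Translation of the quantities `M` into Lipschitz directional derivatives. -/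

section Seminorm

lemma M_succ_lt_top {s : ℕ} {f : Euc d → ℝ} (h : M (s + 1) f < ⊤) :
    (∀ k < s, Differentiable ℝ (iteratedFDeriv ℝ k f)) ∧ ∀ x y,
      ‖iteratedFDeriv ℝ s f x - iteratedFDeriv ℝ s f y‖ ≤ (M (s + 1) f).toReal * ‖x - y‖ := by
  by_cases hd : ∀ k < s, Differentiable ℝ (iteratedFDeriv ℝ k f)
  · refine ⟨hd, fun x y => ?_⟩
    rcases eq_or_ne x y with rfl | hxy
    · simp
    have h1 : ‖iteratedFDeriv ℝ s f x - iteratedFDeriv ℝ s f y‖ₑ / ‖x - y‖ₑ ≤ M (s + 1) f := by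
      rw [M, if_pos hd]
      exact le_iSup_of_le x (le_iSup_of_le y (le_iSup_of_le hxy le_rfl))
    have h0 : ‖x - y‖ₑ ≠ 0 := by simpa [sub_eq_zero] using hxy
    rw [ENNReal.div_le_iff h0 enorm_ne_top] at h1
    have h2 := ENNReal.toReal_mono (ENNReal.mul_ne_top h.ne enorm_ne_top) h1
    simpa [ENNReal.toReal_mul] using h2
  · rw [M, if_neg hd] at h
    exact absurd h (lt_irrefl _)

lemma abs_iteratedFDeriv_sub_le {s : ℕ} {f : Euc d → ℝ} (h : M (s + 1) f < ⊤) (x y : Euc d)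
    (m : Fin s → Euc d) : |iteratedFDeriv ℝ s f x m - iteratedFDeriv ℝ s f y m| ≤
      (M (s + 1) f).toReal * ‖x - y‖ * ∏ i, ‖m i‖ := by
  have := (iteratedFDeriv ℝ s f x - iteratedFDeriv ℝ s f y).le_opNorm m
  exact this.trans (mul_le_mul_of_nonneg_right ((M_succ_lt_top h).2 x y)
    (Finset.prod_nonneg fun i _ => norm_nonneg _))

lemma LD_zero_of_M {f : Euc d → ℝ} (h : M 1 f < ⊤) : LD 0 (M 1 f).toReal f := fun x y => by
  simpa using abs_iteratedFDeriv_sub_le h x y ![]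

lemma differentiable_of_iteratedFDeriv_zero {F : Type*} [NormedAddCommGroup F] [NormedSpace ℝ F]
    {f : Euc d → F} (h : Differentiable ℝ (iteratedFDeriv ℝ 0 f)) : Differentiable ℝ f := by
  rw [iteratedFDeriv_zero_eq_comp] at h
  exact (LinearIsometryEquiv.comp_differentiable_iff _).1 h

lemma LD_one_of_M {f : Euc d → ℝ} (h : M 2 f < ⊤) : LD 1 (M 2 f).toReal f := by
  refine ⟨differentiable_of_iteratedFDeriv_zero ((M_succ_lt_top h).1 0 (by norm_num)),
    fun u x y => ?_⟩
  have := abs_iteratedFDeriv_sub_le h x y ![u]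
  simp only [iteratedFDeriv_one_apply] at this
  simp only [Finset.univ_unique, Fin.default_eq_zero, Finset.prod_singleton,
    Matrix.cons_val_zero] at this
  exact this.trans (le_of_eq (by ring))

lemma LD_two_of_M {f : Euc d → ℝ} (h : M 3 f < ⊤) : LD 2 (M 3 f).toReal f := by
  have h0 := differentiable_of_iteratedFDeriv_zero ((M_succ_lt_top h).1 0 (by norm_num))
  have h1 : Differentiable ℝ (fderiv ℝ f) := by
    have := (M_succ_lt_top h).1 1 (by norm_num)
    have e : iteratedFDeriv ℝ 1 f = (continuousMultilinearCurryRightEquiv' ℝ 0 (Euc d) ℝ).symm ∘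
        iteratedFDeriv ℝ 0 (fderiv ℝ f) := funext fun x => iteratedFDeriv_succ_eq_comp_right
    rw [e] at this
    exact differentiable_of_iteratedFDeriv_zero
      ((LinearIsometryEquiv.comp_differentiable_iff _).1 this)
  have hdd : ∀ u v x, dd v (dd u f) x = fderiv ℝ (fderiv ℝ f) x v u := fun u v x => by
    have := (h1 x).hasFDerivAt.clm_apply (hasFDerivAt_const u x)
    change fderiv ℝ (fun y => fderiv ℝ f y u) x v = _
    rw [this.fderiv]
    simp
  refine ⟨h0, fun u => ⟨fun x => ((h1 x).clm_apply (differentiableAt_const u)),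
    fun v x y => ?_⟩⟩
  have := abs_iteratedFDeriv_sub_le h x y ![v, u]
  simp only [iteratedFDeriv_two_apply, Fin.prod_univ_two, Matrix.cons_val_zero,
    Matrix.cons_val_one] at this
  rw [hdd, hdd]
  exact this.trans (le_of_eq (by ring))

end Seminorm

end

end SteinCLT

/-! ### Conclusion for general functions. -/

namespace SteinCLT

noncomputable section

section Setting

variable {d : ℕ} {Ω : Type*} [MeasurableSpace Ω] {P : Measure Ω} [IsProbabilityMeasure P]
  {W : Ω → Euc d} {Ξ : Type*} [MeasurableSpace Ξ]
  {Ω' : Ξ → Type*} [∀ ξ, MeasurableSpace (Ω' ξ)]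
  {Q : ∀ ξ, Measure (Ω' ξ)} [∀ ξ, IsProbabilityMeasure (Q ξ)]
  {V : ∀ ξ, Ω' ξ → Euc d}
  {μ : VectorMeasure Ξ (Euc d)} {ν : Ξ → VectorMeasure Ξ (Euc d)}

lemma integrable_gd_of_LD {n : ℕ} {m : ℝ} (hm : 0 ≤ m) {f : Euc d → ℝ} (h : LD n m f) :
    Integrable f (gd d) := by
  obtain ⟨C, hC⟩ := h.exists_growth hm
  exact integrable_of_growth measurable_id (integrable_bracket_pow_gd _) (h.continuous hm) hC

omit [IsProbabilityMeasure P] in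
lemma integrable_W_of_LD (hW : Measurable W) {n : ℕ}
    (hi : Integrable (fun ω => bracket (W ω) ^ (n + 1)) P) {m : ℝ} (hm : 0 ≤ m) {f : Euc d → ℝ}
    (h : LD n m f) : Integrable (fun ω => f (W ω)) P := by
  obtain ⟨C, hC⟩ := h.exists_growth hm
  exact integrable_of_growth hW hi (h.continuous hm) hC

lemma beta23_le (b : ℝ≥0∞) : beta23 μ ν 1 b ≤ beta2 μ ν := by
  refine lintegral_mono fun ξ => ?_
  rw [betaXi1, ← lintegral_one]
  exact lintegral_mono fun η => min_le_left _ _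

lemma beta234_le {a : ℝ≥0∞} (ha : a ≠ ⊤) (b c : ℝ≥0∞) : beta234 μ ν a b c ≤ a * beta2 μ ν := by
  rw [beta2, ← lintegral_const_mul' _ _ ha]
  refine lintegral_mono fun ξ => ?_
  rw [betaXi1, ← lintegral_const]
  exact lintegral_mono fun η => min_le_left _ _

variable (hW : Measurable W) (hSt : Standardized P W)
  (hV : MeasurableFamily Q V) (hS : SizeBias P W Q V μ) (hPx : Proximity P W Q V ν)
  (hβ : beta2 μ ν < ⊤)
include hW hSt hV hS hPx hβ

lemma testBound_three : TestBound P W 3 (beta3 μ ν / 3) := fun _ hg _ hm0 hm =>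
  enorm_sub_le_beta3_of_test hW hSt hV hS hPx hβ hg hm0 fun x u v w =>
    (hm w v u x).trans (le_of_eq (by ring))

lemma testBound_two :
    TestBound P W 2 (beta23 μ ν 1 (ENNReal.ofReal (Real.sqrt (2 * Real.pi) / 4))) :=
  fun _ hg _ hm0 hm => enorm_sub_le_beta23_of_test hW hSt hV hS hPx hβ hg hm0 fun x u v =>
    (hm v u x).trans (le_of_eq (by ring))

lemma testBound_one (hd : 1 ≤ d) : TestBound P W 1 (beta234 μ ν (ENNReal.ofReal 1.8)
    (ENNReal.ofReal (3.58 + 0.55 * Real.log d)) (ENNReal.ofReal 3.5)) :=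
  fun _ hg _ hm0 hm => enorm_sub_le_beta234_of_test hW hSt hV hS hPx hβ hg hm0
    (fun x u => hm u x) hd

lemma comparison_three {f : Euc d → ℝ} (hf : M 3 f < ⊤) :
    Integrable f (gd d) ∧
      (beta3 μ ν / 3 * M 3 f < ⊤ → Integrable (fun ω => f (W ω)) P) ∧
      ‖∫ ω, f (W ω) ∂P - ∫ z, f z ∂gd d‖ₑ ≤ beta3 μ ν / 3 * M 3 f := by
  have hL := LD_two_of_M hf
  have hT := testBound_three hW hSt hV hS hPx hβ
  refine ⟨integrable_gd_of_LD ENNReal.toReal_nonneg hL, ?_⟩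
  -- Then `f` is quadratic and both means coincide by the first two moments. This case stands apart
  -- because `β_3` may be infinite while the bound is `∞ · 0 = 0`.
  rcases eq_or_ne (M 3 f) 0 with h0 | h0
  · rw [h0, ENNReal.toReal_zero] at hL
    obtain ⟨C, hC⟩ := hL.exists_growth_of_zero
    refine ⟨fun _ => integrable_of_growth hW (integrable_bracket_pow_W hW hSt le_rfl)
      (hL.continuous le_rfl) hC, ?_⟩
    rw [integral_eq_of_LD_two_zero hW hSt hL,
      integral_eq_of_LD_two_zero measurable_id' standardized_gd hL, sub_self, enorm_zero]
    exact zero_le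
  rcases eq_or_ne (beta3 μ ν / 3) ⊤ with hA | hA
  · rw [hA, ENNReal.top_mul h0]
    exact ⟨fun h => absurd h (lt_irrefl _), le_top⟩
  · have hi := hT.integrable_bracket_pow hW hA
    refine ⟨fun _ => integrable_W_of_LD hW hi ENNReal.toReal_nonneg hL, ?_⟩
    have := hT.of_LD hW hA ENNReal.toReal_nonneg hL hi
    rwa [ENNReal.ofReal_toReal hf.ne] at this

lemma comparison_two {f : Euc d → ℝ} (hf : M 2 f < ⊤) :
    Integrable f (gd d) ∧ Integrable (fun ω => f (W ω)) P ∧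
      ‖∫ ω, f (W ω) ∂P - ∫ z, f z ∂gd d‖ₑ ≤
        beta23 μ ν 1 (ENNReal.ofReal (Real.sqrt (2 * Real.pi) / 4)) * M 2 f := by
  have hL := LD_one_of_M hf
  have hi := integrable_bracket_pow_W hW hSt le_rfl
  refine ⟨integrable_gd_of_LD ENNReal.toReal_nonneg hL,
    integrable_W_of_LD hW hi ENNReal.toReal_nonneg hL, ?_⟩
  have := (testBound_two hW hSt hV hS hPx hβ).of_LD hW ((beta23_le _).trans_lt hβ).ne
    ENNReal.toReal_nonneg hL hi
  rwa [ENNReal.ofReal_toReal hf.ne] at this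

lemma comparison_one (hd : 1 ≤ d) {f : Euc d → ℝ} (hf : M 1 f < ⊤) :
    Integrable f (gd d) ∧ Integrable (fun ω => f (W ω)) P ∧
      ‖∫ ω, f (W ω) ∂P - ∫ z, f z ∂gd d‖ₑ ≤ beta234 μ ν (ENNReal.ofReal 1.8)
        (ENNReal.ofReal (3.58 + 0.55 * Real.log d)) (ENNReal.ofReal 3.5) * M 1 f := by
  have hL := LD_zero_of_M hf
  have hi := integrable_bracket_pow_W hW hSt one_le_two
  refine ⟨integrable_gd_of_LD ENNReal.toReal_nonneg hL,
    integrable_W_of_LD hW hi ENNReal.toReal_nonneg hL, ?_⟩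
  have := (testBound_one hW hSt hV hS hPx hβ hd).of_LD hW
    ((beta234_le ENNReal.ofReal_ne_top _ _).trans_lt
      (ENNReal.mul_lt_top ENNReal.ofReal_lt_top hβ)).ne ENNReal.toReal_nonneg hL hi
  rwa [ENNReal.ofReal_toReal hf.ne] at this

end Setting

end

end SteinCLT

theorem theorem1 {d : ℕ} (hd : 1 ≤ d)
    {Ω : Type*} [MeasurableSpace Ω] (P : Measure Ω) [IsProbabilityMeasure P]
    (W : Ω → SteinCLT.Euc d) (hW : Measurable W)
    {Ξ : Type*} [MeasurableSpace Ξ]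
    {Ω' : Ξ → Type*} [∀ ξ, MeasurableSpace (Ω' ξ)]
    (Q : ∀ ξ, Measure (Ω' ξ)) [∀ ξ, IsProbabilityMeasure (Q ξ)]
    (V : ∀ ξ, Ω' ξ → SteinCLT.Euc d) (hV : SteinCLT.MeasurableFamily Q V)
    (μ : VectorMeasure Ξ (SteinCLT.Euc d))
    (ν : Ξ → VectorMeasure Ξ (SteinCLT.Euc d))
    (hν : ∀ A : Set Ξ, MeasurableSet A → Measurable fun ξ => ν ξ A)
    (hSt : SteinCLT.Standardized P W)
    (hS : SteinCLT.SizeBias P W Q V μ)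
    (hPx : SteinCLT.Proximity P W Q V ν)
    (hβ : SteinCLT.beta2 μ ν < ∞)
    (f : SteinCLT.Euc d → ℝ) :
    (SteinCLT.M 3 f < ∞ →
      Integrable f (stdGaussian (SteinCLT.Euc d)) ∧
      (SteinCLT.beta3 μ ν / 3 * SteinCLT.M 3 f < ∞ → Integrable (fun ω => f (W ω)) P) ∧
      ‖∫ ω, f (W ω) ∂P - ∫ z, f z ∂(stdGaussian (SteinCLT.Euc d))‖ₑ ≤
        SteinCLT.beta3 μ ν / 3 * SteinCLT.M 3 f) ∧
    (SteinCLT.M 2 f < ∞ →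
      Integrable f (stdGaussian (SteinCLT.Euc d)) ∧
      Integrable (fun ω => f (W ω)) P ∧
      ‖∫ ω, f (W ω) ∂P - ∫ z, f z ∂(stdGaussian (SteinCLT.Euc d))‖ₑ ≤
        SteinCLT.beta23 μ ν 1 (ENNReal.ofReal (Real.sqrt (2 * Real.pi) / 4)) *
          SteinCLT.M 2 f) ∧
    (SteinCLT.M 1 f < ∞ →
      Integrable f (stdGaussian (SteinCLT.Euc d)) ∧
      Integrable (fun ω => f (W ω)) P ∧
      ‖∫ ω, f (W ω) ∂P - ∫ z, f z ∂(stdGaussian (SteinCLT.Euc d))‖ₑ ≤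
        SteinCLT.beta234 μ ν (ENNReal.ofReal 1.8)
          (ENNReal.ofReal (3.58 + 0.55 * Real.log d)) (ENNReal.ofReal 3.5) *
          SteinCLT.M 1 f) :=
    ⟨fun h => SteinCLT.comparison_three hW hSt hV hS hPx hβ h,
      fun h => SteinCLT.comparison_two hW hSt hV hS hPx hβ h,
      fun h => SteinCLT.comparison_one hW hSt hV hS hPx hβ hd h⟩
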